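/- Let $\Bbbk$ be an algebraically closed field of characteristic zero and let $\xi\in\Bbbk$ be a primitive $4$-th root of unity. Let $\mathcal K$ be the Hopf algebra generated as an algebra by $a,b,c,d$ with relations $$ab=\xi ba,\quad ac=\xi ca,\quad cb=bc=0,\quad cd=\xi dc,\quad bd=\xi db,\quad ad=da=1,\quad b^2=c^2=0,\quad a^2c=b,\quad a^4=1,$$ with comultiplication $\Delta(a)=a\otimes a+b\otimes c$, $\Delta(b)=a\otimes b+b\otimes d$, $\Delta(c)=c\otimes a+d\otimes c$, $\Delta(d)=c\otimes b+d\otimes d$, counit $\varepsilon(a)=\varepsilon(d)=1$, $\varepsilon(b)=\varepsilon(c)=0$, and antipode $S(a)=d$, $S(b)=\xi b$, $S(c)=-\xi c$, $S(d)=a$. Let $V_{2,1}$ be the left Yetter--Drinfeld module over $\mathcal K$ with basis $e_1,e_2$, action $$a\cdot e_1=-e_1,\ b\cdot e_1=c\cdot e_1=0,\ d\cdot e_1=-e_1,\qquad a\cdot e_2=\xi e_2,\ b\cdot e_2=c\cdot e_2=e_1,\ d\cdot e_2=-\xi e_2,$$ and coaction $$\delta(e_1)=d\otimes e_1+(\xi-1)\,c\otimes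 e_2,\qquad \delta(e_2)=a\otimes e_2-\tfrac12(1+\xi)\,b\otimes e_1.$$ A Nichols algebra of a Yetter--Drinfeld module $V$ over $\mathcal K$ is an $\mathbb N$-graded Hopf algebra $R=\bigoplus_{n\ge 0}R(n)$ in the braided category ${}^{\mathcal K}_{\mathcal K}\mathcal{YD}$ of left Yetter--Drinfeld modules (with braiding $c(m\otimes n)=m_{(-1)}\cdot n\otimes m_{(0)}$) such that $R(0)=\Bbbk$, $R(1)\simeq V$, $R(1)$ is the space of primitive elements of $R$, and $R$ is generated as an algebra by $R(1)$. Then the Nichols algebra $\mathfrak B(V_{2,1})$ is the algebra generated by $x=e_1$ and $y=e_2$ subject to the relations $$x^2=0,\qquad xy+\xi yx=0,\qquad y^4=0.$$ That is, the algebra with this presentation carries a structure of Nichols algebra of $V_{2,1}$ in which $x,y$ correspond to $e_1,e_2$, and for every Nichols algebra $R$ of $V_{2,1}$ (with a chosen isomorphism $V_{2,1}\simeq R(1)$) there is an algebra isomorphism from the presented algebra onto $R$ that sends $x,y$ to the images of $e_1,e_2$. In particular $\dim\mathfrak B(V_{2,1})=8$. -/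

import Mathlib

open scoped TensorProduct

universe u v w x

/-! ## Yetter-Drinfeld modules and their braiding -/

section YetterDrinfeld

variable {k : Type u} {H : Type v} [CommRing k] [Ring H] [HopfAlgebra k H]

/-- For an action `ρ` of `H` on `V`, the linear map sending `h₁ ⊗ (h₂ ⊗ h₃)` to the endomorphism
`g ⊗ v ↦ h₁ g S(h₃) ⊗ h₂ · v` of `H ⊗ V`. -/
noncomputable def ydTwist {V : Type w} [AddCommGroup V] [Module k V]
    (ρ : H →ₐ[k] Module.End k V) :
    H ⊗[k] (H ⊗[k] H) →ₗ[k] Module.End k (H ⊗[k] V) :=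
  LinearMap.mul' k _ ∘ₗ TensorProduct.map
    (LinearMap.rTensorHom V ∘ₗ LinearMap.mul k H)
    (LinearMap.mul' k _ ∘ₗ TensorProduct.map
      (LinearMap.lTensorHom H ∘ₗ ρ.toLinearMap)
      (LinearMap.rTensorHom V ∘ₗ (LinearMap.mul k H).flip ∘ₗ HopfAlgebra.antipode k))

theorem ydTwist_tmul {V : Type w} [AddCommGroup V] [Module k V]
    (ρ : H →ₐ[k] Module.End k V) (h₁ h₂ h₃ g : H) (v : V) :
    ydTwist ρ (h₁ ⊗ₜ[k] (h₂ ⊗ₜ[k] h₃)) (g ⊗ₜ[k] v) =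
      (h₁ * (g * HopfAlgebra.antipode k h₃)) ⊗ₜ[k] ρ h₂ v := by
  simp [ydTwist]

/-- The structure of a left Yetter-Drinfeld module over the Hopf algebra `H` on the `k`-module `V`:
an action, a coaction, and the condition
`δ(h · v) = h₍₁₎ v₍₋₁₎ S(h₍₃₎) ⊗ h₍₂₎ · v₍₀₎`. -/
structure YDModule (k : Type u) (H : Type v) [CommRing k] [Ring H] [HopfAlgebra k H]
    (V : Type w) [AddCommGroup V] [Module k V] where
  act : H →ₐ[k] Module.End k V
  coact : V →ₗ[k] H ⊗[k] V
  coact_coassoc : ∀ v : V,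
    TensorProduct.assoc k H H V ((Coalgebra.comul (R := k) (A := H)).rTensor V (coact v)) =
      coact.lTensor H (coact v)
  coact_counit : ∀ v : V,
    TensorProduct.lid k V ((Coalgebra.counit (R := k) (A := H)).rTensor V (coact v)) = v
  compat : ∀ (h : H) (v : V),
    coact (act h v) =
      ydTwist act ((Coalgebra.comul (R := k) (A := H)).lTensor H (Coalgebra.comul h)) (coact v)

variable {M : Type w} {N : Type x} [AddCommGroup M] [Module k M] [AddCommGroup N] [Module k N]

/-- The braiding `c(m ⊗ n) = m₍₋₁₎ · n ⊗ m₍₀₎`. -/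
noncomputable def ydBraiding (X : YDModule k H M) (Y : YDModule k H N) :
    M ⊗[k] N →ₗ[k] N ⊗[k] M :=
  (TensorProduct.lift Y.act.toLinearMap).rTensor M
    ∘ₗ (TensorProduct.assoc k H N M).symm.toLinearMap
    ∘ₗ (TensorProduct.comm k M N).toLinearMap.lTensor H
    ∘ₗ (TensorProduct.assoc k H M N).toLinearMap
    ∘ₗ X.coact.rTensor N

/-- The diagonal action `h · (m ⊗ n) = h₍₁₎ · m ⊗ h₍₂₎ · n`. -/
noncomputable def ydTensorAct (X : YDModule k H M) (Y : YDModule k H N) :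
    H →ₗ[k] Module.End k (M ⊗[k] N) :=
  TensorProduct.homTensorHomMap (RingHom.id k) M N M N
    ∘ₗ TensorProduct.map X.act.toLinearMap Y.act.toLinearMap
    ∘ₗ Coalgebra.comul

/-- The codiagonal coaction `m ⊗ n ↦ m₍₋₁₎ n₍₋₁₎ ⊗ (m₍₀₎ ⊗ n₍₀₎)`. -/
noncomputable def ydTensorCoact (X : YDModule k H M) (Y : YDModule k H N) :
    M ⊗[k] N →ₗ[k] H ⊗[k] (M ⊗[k] N) :=
  (LinearMap.mul' k H).rTensor (M ⊗[k] N)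
    ∘ₗ (TensorProduct.tensorTensorTensorComm k H M H N).toLinearMap
    ∘ₗ TensorProduct.map X.coact Y.coact

/-- Morphisms of Yetter-Drinfeld modules: linear and colinear maps. -/
structure IsYDHom (X : YDModule k H M) (Y : YDModule k H N) (f : M →ₗ[k] N) : Prop where
  map_act : ∀ (h : H) (m : M), f (X.act h m) = Y.act h (f m)
  map_coact : ∀ m : M, Y.coact (f m) = f.lTensor H (X.coact m)

end YetterDrinfeld

/-! ## Braided Hopf algebras and Nichols algebras -/

section Nichols

variable {k : Type u} {H : Type v} [CommRing k] [Ring H] [HopfAlgebra k H]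

/-- The product of the braided tensor product algebra `R ⊗ R`:
`(r ⊗ s)(r' ⊗ s') = r (s₍₋₁₎ · r') ⊗ s₍₀₎ s'`. -/
noncomputable def braidedTensorMul {R : Type w} [Ring R] [Algebra k R] (X : YDModule k H R) :
    (R ⊗[k] R) ⊗[k] (R ⊗[k] R) →ₗ[k] R ⊗[k] R :=
  TensorProduct.map (LinearMap.mul' k R) (LinearMap.mul' k R)
    ∘ₗ (TensorProduct.assoc k R R (R ⊗[k] R)).symm.toLinearMap
    ∘ₗ ((TensorProduct.assoc k R R R).toLinearMap
        ∘ₗ (ydBraiding X X).rTensor R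
        ∘ₗ (TensorProduct.assoc k R R R).symm.toLinearMap).lTensor R
    ∘ₗ (TensorProduct.assoc k R R (R ⊗[k] R)).toLinearMap

/-- A Hopf algebra in the braided category of left Yetter-Drinfeld modules over `H`, with
underlying algebra `R`. -/
structure YDHopfAlgebra (k : Type u) (H : Type v) [CommRing k] [Ring H] [HopfAlgebra k H]
    (R : Type w) [Ring R] [Algebra k R] extends YDModule k H R, Coalgebra k R where
  antipode : R →ₗ[k] R
  -- the structure maps are morphisms of Yetter-Drinfeld modules
  act_one : ∀ h : H, act h 1 = Coalgebra.counit (R := k) h • (1 : R)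
  coact_one : coact 1 = 1 ⊗ₜ[k] 1
  act_mul : ∀ (h : H) (z : R ⊗[k] R),
    act h (LinearMap.mul' k R z) =
      LinearMap.mul' k R (ydTensorAct toYDModule toYDModule h z)
  coact_mul : ∀ z : R ⊗[k] R,
    coact (LinearMap.mul' k R z) =
      (LinearMap.mul' k R).lTensor H (ydTensorCoact toYDModule toYDModule z)
  counit_act : ∀ (h : H) (r : R), counit (act h r) = Coalgebra.counit (R := k) h * counit r
  counit_coact : ∀ r : R, counit.lTensor H (coact r) = 1 ⊗ₜ[k] counit r
  comul_act : ∀ (h : H) (r : R),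
    comul (act h r) = ydTensorAct toYDModule toYDModule h (comul r)
  comul_coact : ∀ r : R,
    comul.lTensor H (coact r) = ydTensorCoact toYDModule toYDModule (comul r)
  antipode_hom : IsYDHom toYDModule toYDModule antipode
  -- counit and comultiplication are algebra maps, for the braided product on `R ⊗ R`
  counit_one : counit 1 = 1
  counit_mul : ∀ r s : R, counit (r * s) = counit r * counit s
  comul_one : comul 1 = 1 ⊗ₜ[k] 1
  comul_mul : ∀ r s : R, comul (r * s) = braidedTensorMul toYDModule (comul r ⊗ₜ[k] comul s)
  -- the antipode is the convolution inverse of the identity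
  antipode_left : ∀ r : R,
    LinearMap.mul' k R (antipode.rTensor R (comul r)) = algebraMap k R (counit r)
  antipode_right : ∀ r : R,
    LinearMap.mul' k R (antipode.lTensor R (comul r)) = algebraMap k R (counit r)

/-- The structure, on the algebra `R`, of a Nichols algebra of the Yetter-Drinfeld module `X` with
underlying space `V`: `R = ⨁ R(n)` is an `ℕ`-graded Hopf algebra in the category of Yetter-Drinfeld
modules with `R(0) = k`, with a fixed isomorphism of Yetter-Drinfeld modules `ι : V ≃ R(1)`,
with `R(1)` equal to the space of primitive elements, and generated as an algebra by `R(1)`. -/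
structure NicholsAlgebra {V : Type x} [AddCommGroup V] [Module k V] (X : YDModule k H V)
    (R : Type w) [Ring R] [Algebra k R] extends YDHopfAlgebra k H R where
  /-- the homogeneous component `R(n)` -/
  deg : ℕ → Submodule k R
  deg_isInternal : DirectSum.IsInternal deg
  deg_gradedMonoid : SetLike.GradedMonoid deg
  act_mem : ∀ (n : ℕ) (h : H), ∀ r ∈ deg n, act h r ∈ deg n
  coact_mem : ∀ (n : ℕ), ∀ r ∈ deg n, coact r ∈ LinearMap.range ((deg n).subtype.lTensor H)
  comul_mem : ∀ (n : ℕ), ∀ r ∈ deg n, comul r ∈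
    ⨆ p ∈ Finset.HasAntidiagonal.antidiagonal n,
      LinearMap.range (TensorProduct.map (deg p.1).subtype (deg p.2).subtype)
  counit_eq_zero : ∀ n : ℕ, n ≠ 0 → ∀ r ∈ deg n, counit r = 0
  antipode_mem : ∀ (n : ℕ), ∀ r ∈ deg n, antipode r ∈ deg n
  deg_zero : deg 0 = k ∙ (1 : R)
  ι : V →ₗ[k] R
  ι_injective : Function.Injective ι
  ι_range : LinearMap.range ι = deg 1
  ι_hom : IsYDHom X toYDModule ι
  mem_deg_one_iff : ∀ r : R, r ∈ deg 1 ↔ comul r = r ⊗ₜ[k] 1 + 1 ⊗ₜ[k] r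
  adjoin_deg_one : Algebra.adjoin k (deg 1 : Set R) = ⊤

end Nichols

/-! ## The Hopf algebra `K` -/

/-- Names of the algebra generators of `K`. -/
inductive KGen
  | a | b | c | d

section KAlgebra

set_option linter.unusedSimpArgs false

variable {k : Type u} [Field k] (ξ : k)

/-- The generators as elements of the free algebra. -/
def kFree (k : Type u) [Field k] (s : KGen) : FreeAlgebra k KGen := FreeAlgebra.ι k s

open KGen in
/-- The defining relations of `K`. -/
inductive KRel : FreeAlgebra k KGen → FreeAlgebra k KGen → Prop
  | ab : KRel (kFree k a * kFree k b) (ξ • (kFree k b * kFree k a))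
  | ac : KRel (kFree k a * kFree k c) (ξ • (kFree k c * kFree k a))
  | cb : KRel (kFree k c * kFree k b) 0
  | bc : KRel (kFree k b * kFree k c) 0
  | cd : KRel (kFree k c * kFree k d) (ξ • (kFree k d * kFree k c))
  | bd : KRel (kFree k b * kFree k d) (ξ • (kFree k d * kFree k b))
  | ad_da : KRel (kFree k a * kFree k d) (kFree k d * kFree k a)
  | ad : KRel (kFree k a * kFree k d) 1
  | bb : KRel (kFree k b * kFree k b) 0
  | cc : KRel (kFree k c * kFree k c) 0
  | aac : KRel (kFree k a ^ 2 * kFree k c) (kFree k b)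
  | aaaa : KRel (kFree k a ^ 4) 1

variable {ξ}

/-- The algebra `K`, presented by generators and relations. The root of unity hypothesis is part of
the type so that the Hopf algebra structure is an instance. -/
def KAlg (_hξ : IsPrimitiveRoot ξ 4) : Type u := RingQuot (KRel ξ)

namespace KAlg

variable (hξ : IsPrimitiveRoot ξ 4)

noncomputable instance : Ring (KAlg hξ) := inferInstanceAs (Ring (RingQuot (KRel ξ)))

noncomputable instance : Algebra k (KAlg hξ) := inferInstanceAs (Algebra k (RingQuot (KRel ξ)))

/-- The quotient map from the free algebra. -/
noncomputable def mk : FreeAlgebra k KGen →ₐ[k] KAlg hξ := RingQuot.mkAlgHom k (KRel ξ)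

/-- The generators `a, b, c, d` of `K`. -/
noncomputable def gen (s : KGen) : KAlg hξ := mk hξ (kFree k s)

theorem mk_rel {x y : FreeAlgebra k KGen} (h : KRel ξ x y) : mk hξ x = mk hξ y :=
  RingQuot.mkAlgHom_rel k h

variable {A : Type*} [Ring A] [Algebra k A]

/-- The algebra map out of `K` given by images of the generators satisfying the relations. -/
noncomputable def lift (f : KGen → A)
    (h : ∀ ⦃x y⦄, KRel ξ x y → FreeAlgebra.lift k f x = FreeAlgebra.lift k f y) :
    KAlg hξ →ₐ[k] A :=
  RingQuot.liftAlgHom k ⟨FreeAlgebra.lift k f, h⟩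

theorem lift_gen (f : KGen → A)
    (h : ∀ ⦃x y⦄, KRel ξ x y → FreeAlgebra.lift k f x = FreeAlgebra.lift k f y) (s : KGen) :
    lift hξ f h (gen hξ s) = f s := by
  simp only [lift, gen, mk, kFree]
  erw [RingQuot.liftAlgHom_mkAlgHom_apply]
  simp

variable {hξ}

theorem algHom_ext {f g : KAlg hξ →ₐ[k] A} (h : ∀ s, f (gen hξ s) = g (gen hξ s)) : f = g := by
  refine RingQuot.ringQuot_ext' (S := k) (s := KRel ξ) f g ?_
  exact FreeAlgebra.hom_ext (funext h)

theorem induction {P : KAlg hξ → Prop} (hs : ∀ r : k, P (algebraMap k _ r))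
    (hg : ∀ s, P (gen hξ s)) (hm : ∀ x y, P x → P y → P (x * y))
    (ha : ∀ x y, P x → P y → P (x + y)) (x : KAlg hξ) : P x := by
  obtain ⟨y, rfl⟩ := RingQuot.mkAlgHom_surjective k (KRel ξ) x
  change P (mk hξ y)
  induction y using FreeAlgebra.induction with
  | grade0 r => rw [AlgHom.commutes]; exact hs r
  | grade1 s => exact hg s
  | mul x y hx hy => rw [map_mul]; exact hm _ _ hx hy
  | add x y hx hy => rw [map_add]; exact ha _ _ hx hy

variable (hξ)

/-- The generator `a`. -/
noncomputable abbrev a : KAlg hξ := gen hξ .a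
/-- The generator `b`. -/
noncomputable abbrev b : KAlg hξ := gen hξ .b
/-- The generator `c`. -/
noncomputable abbrev c : KAlg hξ := gen hξ .c
/-- The generator `d`. -/
noncomputable abbrev d : KAlg hξ := gen hξ .d

theorem xi_sq {ξ : k} (hξ : IsPrimitiveRoot ξ 4) : ξ * ξ = -1 := by
  have h2 : IsPrimitiveRoot (ξ ^ 2) 2 := hξ.pow (by norm_num) (by norm_num)
  rw [← pow_two]; exact h2.eq_neg_one_of_two_right

theorem c_mul_c : c hξ * c hξ = 0 := by
  simpa [c, gen] using mk_rel hξ (KRel.cc)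

theorem c_mul_a : c hξ * a hξ = (-ξ) • (a hξ * c hξ) := by
  have h : a hξ * c hξ = ξ • (c hξ * a hξ) := by simpa [a, b, c, d, gen] using mk_rel hξ (KRel.ac)
  rw [h, smul_smul]
  have : -ξ * ξ = 1 := by linear_combination -xi_sq hξ
  rw [this, one_smul]

theorem a_pow : a hξ * (a hξ * (a hξ * a hξ)) = 1 := by
  have h : a hξ ^ 4 = 1 := by simpa [a, b, c, d, gen] using mk_rel hξ (KRel.aaaa)
  rw [← h]; noncomm_ring

theorem b_eq : b hξ = a hξ * (a hξ * c hξ) := by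
  have h : a hξ ^ 2 * c hξ = b hξ := by simpa [a, b, c, d, gen] using mk_rel hξ (KRel.aac)
  rw [← h]; noncomm_ring

theorem d_eq : d hξ = a hξ * (a hξ * a hξ) := by
  have h : a hξ * d hξ = 1 := by simpa [a, b, c, d, gen] using mk_rel hξ (KRel.ad)
  calc d hξ = (a hξ * (a hξ * (a hξ * a hξ))) * d hξ := by rw [a_pow, one_mul]
    _ = a hξ * (a hξ * (a hξ * (a hξ * d hξ))) := by noncomm_ring
    _ = _ := by rw [h, mul_one]

theorem c_mul_c' (z : KAlg hξ) : c hξ * (c hξ * z) = 0 := by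
  rw [← mul_assoc, c_mul_c, zero_mul]

theorem c_mul_a' (z : KAlg hξ) : c hξ * (a hξ * z) = (-ξ) • (a hξ * (c hξ * z)) := by
  rw [← mul_assoc, c_mul_a, smul_mul_assoc, mul_assoc]

theorem a_pow' (z : KAlg hξ) : a hξ * (a hξ * (a hξ * (a hξ * z))) = z := by
  calc _ = (a hξ * (a hξ * (a hξ * a hξ))) * z := by noncomm_ring
    _ = z := by rw [a_pow, one_mul]

/-- The images of the generators satisfy all relations as soon as they satisfy these ones. -/
theorem rel_of {ξ : k} (hξ : IsPrimitiveRoot ξ 4) {f : KGen → A} (h4 : f .a * (f .a * (f .a * f .a)) = 1)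
    (hb : f .b = f .a * (f .a * f .c)) (hd : f .d = f .a * (f .a * f .a))
    (hcc : f .c * f .c = 0) (hca : f .c * f .a = (-ξ) • (f .a * f .c))
    ⦃x y : FreeAlgebra k KGen⦄ (h : KRel ξ x y) :
    FreeAlgebra.lift k f x = FreeAlgebra.lift k f y := by
  have hξ2 := xi_sq hξ
  have hca' : ∀ z, f .c * (f .a * z) = (-ξ) • (f .a * (f .c * z)) := fun z => by
    rw [← mul_assoc, hca, smul_mul_assoc, mul_assoc]
  have h4' : ∀ z, f .a * (f .a * (f .a * (f .a * z))) = z := fun z => by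
    calc _ = (f .a * (f .a * (f .a * f .a))) * z := by noncomm_ring
      _ = z := by rw [h4, one_mul]
  cases h <;>
  simp only [kFree, map_mul, map_smul, map_one, map_zero, FreeAlgebra.lift_ι_apply,
    hb, hd, mul_assoc, hcc, hca, hca', h4, h4', pow_succ, pow_zero, one_mul,
    mul_smul_comm, smul_smul, mul_zero, smul_zero] <;>
  match_scalars <;> first | linear_combination hξ2 | linear_combination -ξ * hξ2

/-- The comultiplication on the generators. -/
noncomputable def comulGen : KGen → KAlg hξ ⊗[k] KAlg hξ
  | .a => a hξ ⊗ₜ a hξ + b hξ ⊗ₜ c hξ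
  | .b => a hξ ⊗ₜ b hξ + b hξ ⊗ₜ d hξ
  | .c => c hξ ⊗ₜ a hξ + d hξ ⊗ₜ c hξ
  | .d => c hξ ⊗ₜ b hξ + d hξ ⊗ₜ d hξ

/-- The counit on the generators. -/
def counitGen (k : Type u) [Field k] : KGen → k
  | .a => 1
  | .b => 0
  | .c => 0
  | .d => 1

/-- The antipode on the generators. -/
noncomputable def antipodeGen : KGen → (KAlg hξ)ᵐᵒᵖ
  | .a => .op (d hξ)
  | .b => .op (ξ • b hξ)
  | .c => .op (-ξ • c hξ)
  | .d => .op (a hξ)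

theorem xi_mul {ξ : k} (hξ : IsPrimitiveRoot ξ 4) : -ξ * -ξ = -1 := by
  linear_combination xi_sq hξ

theorem xi_mul' {ξ : k} (hξ : IsPrimitiveRoot ξ 4) (z : k) : -ξ * (-ξ * z) = -z := by
  linear_combination z * xi_sq hξ

theorem comulGen_rel ⦃x y : FreeAlgebra k KGen⦄ (h : KRel ξ x y) :
    FreeAlgebra.lift k (comulGen hξ) x = FreeAlgebra.lift k (comulGen hξ) y := by
  refine rel_of hξ ?_ ?_ ?_ ?_ ?_ h <;>
  simp only [comulGen, mul_add, add_mul, Algebra.TensorProduct.tmul_mul_tmul, b_eq, d_eq,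
    mul_assoc, c_mul_c, c_mul_c', c_mul_a, c_mul_a', a_pow, a_pow', mul_smul_comm, smul_smul,
    mul_zero, smul_zero, TensorProduct.tmul_smul, ← TensorProduct.smul_tmul',
    TensorProduct.zero_tmul, TensorProduct.tmul_zero, add_zero, zero_add, smul_add, mul_one,
    one_mul, Algebra.TensorProduct.one_def, xi_mul, xi_mul', hξ] <;>
  first | module | (match_scalars <;> first
    | ring1 | linear_combination xi_sq hξ)

theorem counitGen_rel ⦃x y : FreeAlgebra k KGen⦄ (h : KRel ξ x y) :
    FreeAlgebra.lift k (counitGen k) x = FreeAlgebra.lift k (counitGen k) y := by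
  cases h <;> simp [counitGen, kFree]

theorem antipodeGen_rel ⦃x y : FreeAlgebra k KGen⦄ (h : KRel ξ x y) :
    FreeAlgebra.lift k (antipodeGen hξ) x = FreeAlgebra.lift k (antipodeGen hξ) y := by
  refine rel_of hξ ?_ ?_ ?_ ?_ ?_ h <;>
  simp only [antipodeGen, ← MulOpposite.op_mul, ← MulOpposite.op_smul, ← MulOpposite.op_one,
    ← MulOpposite.op_zero] <;>
  congr 1 <;>
  simp only [b_eq, d_eq,
    mul_assoc, c_mul_c, c_mul_c', c_mul_a, c_mul_a', a_pow, a_pow', mul_smul_comm, smul_smul,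
    smul_mul_assoc, mul_zero, smul_zero, mul_one, xi_mul, xi_mul', hξ] <;>
  first | done | module

noncomputable instance : Bialgebra k (KAlg hξ) :=
  Bialgebra.ofAlgHom (lift hξ _ (comulGen_rel hξ)) (lift hξ _ counitGen_rel)
    (algHom_ext fun s => by
      cases s <;>
        simp [lift_gen, comulGen, TensorProduct.tmul_add, TensorProduct.add_tmul] <;> abel)
    (algHom_ext fun s => by
      cases s <;> simp [lift_gen, comulGen, counitGen])
    (algHom_ext fun s => by
      cases s <;> simp [lift_gen, comulGen, counitGen])

theorem comul_gen (s : KGen) : Coalgebra.comul (R := k) (gen hξ s) = comulGen hξ s :=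
  lift_gen hξ _ (comulGen_rel hξ) s

theorem counit_gen (s : KGen) : Coalgebra.counit (R := k) (gen hξ s) = counitGen k s :=
  lift_gen hξ _ counitGen_rel s

/-- The antipode of `K` as an algebra map to the opposite algebra. -/
noncomputable def antipodeOp : KAlg hξ →ₐ[k] (KAlg hξ)ᵐᵒᵖ := lift hξ _ (antipodeGen_rel hξ)

/-- The antipode of `K` as a linear map. -/
noncomputable def antipodeLin : KAlg hξ →ₗ[k] KAlg hξ :=
  (MulOpposite.opLinearEquiv k).symm.toLinearMap ∘ₗ (antipodeOp hξ).toLinearMap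

theorem antipodeLin_mul (x y : KAlg hξ) :
    antipodeLin hξ (x * y) = antipodeLin hξ y * antipodeLin hξ x := by
  simp [antipodeLin]

theorem antipodeLin_algebraMap (r : k) :
    antipodeLin hξ (algebraMap k _ r) = algebraMap k _ r := by
  simp [antipodeLin]

theorem antipodeLin_one : antipodeLin hξ 1 = 1 := by
  simp [antipodeLin]

theorem antipodeLin_gen (s : KGen) :
    antipodeLin hξ (gen hξ s) = MulOpposite.unop (antipodeGen hξ s) := by
  simp [antipodeLin, antipodeOp, lift_gen]

theorem antipodeLin_rTensor_mul (x : KAlg hξ) (z : KAlg hξ ⊗[k] KAlg hξ) (e : k)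
    (hx : LinearMap.mul' k _ ((antipodeLin hξ).rTensor _ (Coalgebra.comul (R := k) x)) =
      algebraMap k _ e) :
    LinearMap.mul' k _ ((antipodeLin hξ).rTensor _ (Coalgebra.comul (R := k) x * z)) =
      e • LinearMap.mul' k _ ((antipodeLin hξ).rTensor _ z) := by
  induction z with
  | zero => simp
  | add z w hz hw => rw [mul_add, map_add, map_add, hz, hw, map_add, map_add, smul_add]
  | tmul p q =>
    have key : ∀ t : KAlg hξ ⊗[k] KAlg hξ,
        LinearMap.mul' k _ ((antipodeLin hξ).rTensor _ (t * p ⊗ₜ[k] q)) =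
          antipodeLin hξ p * LinearMap.mul' k _ ((antipodeLin hξ).rTensor _ t) * q := by
      intro t
      induction t with
      | zero => simp
      | add z w hz hw => rw [add_mul, map_add, map_add, hz, hw, map_add, map_add, mul_add, add_mul]
      | tmul r s => simp [antipodeLin_mul, mul_assoc]
    rw [key, hx, ← Algebra.commutes, mul_assoc, ← Algebra.smul_def]
    simp

theorem antipodeLin_lTensor_mul (y : KAlg hξ) (z : KAlg hξ ⊗[k] KAlg hξ) (e : k)
    (hy : LinearMap.mul' k _ ((antipodeLin hξ).lTensor _ (Coalgebra.comul (R := k) y)) =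
      algebraMap k _ e) :
    LinearMap.mul' k _ ((antipodeLin hξ).lTensor _ (z * Coalgebra.comul (R := k) y)) =
      e • LinearMap.mul' k _ ((antipodeLin hξ).lTensor _ z) := by
  induction z with
  | zero => simp
  | add z w hz hw => rw [add_mul, map_add, map_add, hz, hw, map_add, map_add, smul_add]
  | tmul p q =>
    have key : ∀ t : KAlg hξ ⊗[k] KAlg hξ,
        LinearMap.mul' k _ ((antipodeLin hξ).lTensor _ (p ⊗ₜ[k] q * t)) =
          p * LinearMap.mul' k _ ((antipodeLin hξ).lTensor _ t) * antipodeLin hξ q := by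
      intro t
      induction t with
      | zero => simp
      | add z w hz hw => rw [mul_add, map_add, map_add, hz, hw, map_add, map_add, mul_add, add_mul]
      | tmul r s => simp [antipodeLin_mul, mul_assoc]
    rw [key, hy, ← Algebra.commutes, mul_assoc, ← Algebra.smul_def]
    simp

noncomputable instance : HopfAlgebra k (KAlg hξ) where
  antipode := antipodeLin hξ
  mul_antipode_rTensor_comul := by
    ext x
    change LinearMap.mul' k _ ((antipodeLin hξ).rTensor _ (Coalgebra.comul (R := k) x)) =
      algebraMap k _ (Coalgebra.counit (R := k) x)
    induction x using induction with
    | hs r => simp [antipodeLin_algebraMap, antipodeLin_one, Algebra.TensorProduct.algebraMap_apply]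
    | hg s =>
      rw [comul_gen, counit_gen]
      cases s <;>
      simp only [comulGen, counitGen, map_add, LinearMap.rTensor_tmul, antipodeLin_gen,
        antipodeGen, MulOpposite.unop_op, LinearMap.mul'_apply, map_zero, map_one] <;>
      simp only [b_eq, d_eq,
        mul_assoc, c_mul_c, c_mul_c', c_mul_a, c_mul_a', a_pow, a_pow', mul_smul_comm, smul_smul,
        smul_mul_assoc, mul_zero, smul_zero, mul_one, xi_mul, xi_mul', hξ, add_zero, zero_add]
      all_goals first | done | module | (match_scalars; linear_combination xi_sq hξ)
    | hm x y hx hy =>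
      rw [Bialgebra.comul_mul, antipodeLin_rTensor_mul hξ x _ _ hx, hy, Bialgebra.counit_mul,
        map_mul, Algebra.smul_def]
    | ha x y hx hy => simp only [map_add, hx, hy]
  mul_antipode_lTensor_comul := by
    ext x
    change LinearMap.mul' k _ ((antipodeLin hξ).lTensor _ (Coalgebra.comul (R := k) x)) =
      algebraMap k _ (Coalgebra.counit (R := k) x)
    induction x using induction with
    | hs r => simp [antipodeLin_algebraMap, antipodeLin_one, Algebra.TensorProduct.algebraMap_apply]
    | hg s =>
      rw [comul_gen, counit_gen]
      cases s <;>
      simp only [comulGen, counitGen, map_add, LinearMap.lTensor_tmul, antipodeLin_gen,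
        antipodeGen, MulOpposite.unop_op, LinearMap.mul'_apply, map_zero, map_one] <;>
      simp only [b_eq, d_eq,
        mul_assoc, c_mul_c, c_mul_c', c_mul_a, c_mul_a', a_pow, a_pow', mul_smul_comm, smul_smul,
        smul_mul_assoc, mul_zero, smul_zero, mul_one, xi_mul, xi_mul', hξ, add_zero, zero_add]
      all_goals first | done | module
    | hm x y hx hy =>
      rw [Bialgebra.comul_mul, antipodeLin_lTensor_mul hξ y _ _ hy, hx, Bialgebra.counit_mul,
        map_mul, Algebra.smul_def, Algebra.commutes]
    | ha x y hx hy => simp only [map_add, hx, hy]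

theorem antipode_gen (s : KGen) :
    HopfAlgebra.antipode k (gen hξ s) = MulOpposite.unop (antipodeGen hξ s) :=
  antipodeLin_gen hξ s

end KAlg
end KAlgebra

/-! ## The Yetter-Drinfeld module `V_{2,1}` and the presented algebra -/

section V21

set_option linter.unusedSimpArgs false

theorem ydTwist_mul {k : Type u} {H : Type v} [CommRing k] [Ring H] [HopfAlgebra k H]
    {V : Type w} [AddCommGroup V] [Module k V] (ρ : H →ₐ[k] Module.End k V)
    (s t : H ⊗[k] (H ⊗[k] H)) : ydTwist ρ (s * t) = ydTwist ρ s * ydTwist ρ t := by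
  induction s with
  | zero => simp
  | add s s' hs hs' => rw [add_mul, map_add, hs, hs', map_add, add_mul]
  | tmul s₁ s₂ =>
    induction s₂ with
    | zero => simp
    | add s s' hs hs' =>
      rw [TensorProduct.tmul_add, add_mul, map_add, hs, hs', map_add, add_mul]
    | tmul s₂ s₃ =>
      induction t with
      | zero => simp
      | add s s' hs hs' => rw [mul_add, map_add, hs, hs', map_add, mul_add]
      | tmul t₁ t₂ =>
        induction t₂ with
        | zero => simp
        | add s s' hs hs' =>
          rw [TensorProduct.tmul_add, mul_add, map_add, hs, hs', map_add, mul_add]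
        | tmul t₂ t₃ =>
          ext g v
          simp [ydTwist_tmul, mul_assoc, HopfAlgebra.antipode_mul_antidistrib]

variable {k : Type u} [Field k] {ξ : k} (hξ : IsPrimitiveRoot ξ 4)

/-- The matrices of `a, b, c, d` on the basis `e₁, e₂` of `V_{2,1}`. -/
def v21Mat (ξ : k) : KGen → Matrix (Fin 2) (Fin 2) k
  | .a => !![-1, 0; 0, ξ]
  | .b => !![0, 1; 0, 0]
  | .c => !![0, 1; 0, 0]
  | .d => !![-1, 0; 0, -ξ]

theorem v21Mat_rel {ξ : k} (hξ : IsPrimitiveRoot ξ 4) ⦃x y : FreeAlgebra k KGen⦄ (h : KRel ξ x y) :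
    FreeAlgebra.lift k (v21Mat ξ) x = FreeAlgebra.lift k (v21Mat ξ) y := by
  have h2 := KAlg.xi_sq hξ
  refine KAlg.rel_of hξ ?_ ?_ ?_ ?_ ?_ h <;>
    ext i j <;> fin_cases i <;> fin_cases j <;> simp [v21Mat, Matrix.one_fin_two, h2]

/-- The action of `K` on `V_{2,1}`. -/
noncomputable def v21Act : KAlg hξ →ₐ[k] Module.End k (Fin 2 → k) :=
  (Matrix.toLinAlgEquiv' (R := k) (n := Fin 2)).toAlgHom.comp
    (KAlg.lift hξ (v21Mat ξ) (v21Mat_rel hξ))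

/-- The basis vector `e₁` of `V_{2,1}`. -/
def e₁ (k : Type u) [Field k] : Fin 2 → k := Pi.single 0 1

/-- The basis vector `e₂` of `V_{2,1}`. -/
def e₂ (k : Type u) [Field k] : Fin 2 → k := Pi.single 1 1

/-- The coaction of `K` on `V_{2,1}`:
`δ(e₁) = d ⊗ e₁ + (ξ - 1) c ⊗ e₂` and `δ(e₂) = a ⊗ e₂ - ½ (1 + ξ) b ⊗ e₁`. -/
noncomputable def v21Coact : (Fin 2 → k) →ₗ[k] KAlg hξ ⊗[k] (Fin 2 → k) :=
  (Pi.basisFun k (Fin 2)).constr k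
    ![KAlg.d hξ ⊗ₜ e₁ k + (ξ - 1) • KAlg.c hξ ⊗ₜ e₂ k,
      KAlg.a hξ ⊗ₜ e₂ k + (-(1 + ξ) / 2) • KAlg.b hξ ⊗ₜ e₁ k]

theorem v21Coact_e₁ :
    v21Coact hξ (e₁ k) = KAlg.d hξ ⊗ₜ e₁ k + (ξ - 1) • KAlg.c hξ ⊗ₜ e₂ k := by
  rw [e₁, ← Pi.basisFun_apply, v21Coact, Module.Basis.constr_basis]; simp [e₁]

theorem v21Coact_e₂ :
    v21Coact hξ (e₂ k) = KAlg.a hξ ⊗ₜ e₂ k + (-(1 + ξ) / 2) • KAlg.b hξ ⊗ₜ e₁ k := by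
  rw [e₂, ← Pi.basisFun_apply, v21Coact, Module.Basis.constr_basis]; simp [e₂]

theorem v21Act_gen (s : KGen) (v : Fin 2 → k) :
    v21Act hξ (KAlg.gen hξ s) v = (v21Mat ξ s).mulVec v := by
  simp [v21Act, KAlg.lift_gen, Matrix.toLinAlgEquiv'_apply]

theorem v21Act_e₁ (s : KGen) :
    v21Act hξ (KAlg.gen hξ s) (e₁ k) = (v21Mat ξ s 0 0) • e₁ k := by
  rw [v21Act_gen]
  ext i; fin_cases i <;> cases s <;> simp [v21Mat, e₁]

theorem v21Act_e₂ (s : KGen) :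
    v21Act hξ (KAlg.gen hξ s) (e₂ k) = (v21Mat ξ s 0 1) • e₁ k + (v21Mat ξ s 1 1) • e₂ k := by
  rw [v21Act_gen]
  ext i; fin_cases i <;> cases s <;> simp [v21Mat, e₁, e₂]

theorem v21_ext {W : Type*} [AddCommGroup W] [Module k W] {f g : (Fin 2 → k) →ₗ[k] W}
    (h₁ : f (e₁ k) = g (e₁ k)) (h₂ : f (e₂ k) = g (e₂ k)) : f = g := by
  refine (Pi.basisFun k (Fin 2)).ext fun i => ?_
  fin_cases i
  · simpa [e₁] using h₁
  · simpa [e₂] using h₂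

theorem two_ne_zero_of_xi {ξ : k} (hξ : IsPrimitiveRoot ξ 4) : (2 : k) ≠ 0 := by
  intro h
  refine hξ.pow_ne_one_of_pos_of_lt (l := 2) (by norm_num) (by norm_num) ?_
  linear_combination KAlg.xi_sq hξ - h

/-- The Yetter-Drinfeld module `V_{2,1}` over `K`, with basis `e₁, e₂`. -/
noncomputable def V21 : YDModule k (KAlg hξ) (Fin 2 → k) where
  act := v21Act hξ
  coact := v21Coact hξ
  coact_coassoc := by
    have h2 := two_ne_zero_of_xi hξ
    have h1 := KAlg.xi_sq hξ
    refine LinearMap.congr_fun (f := (TensorProduct.assoc k _ _ _).toLinearMap ∘ₗ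
      (Coalgebra.comul (R := k) (A := KAlg hξ)).rTensor _ ∘ₗ v21Coact hξ)
      (g := (v21Coact hξ).lTensor _ ∘ₗ v21Coact hξ) (v21_ext ?_ ?_)
    · simp only [LinearMap.comp_apply, v21Coact_e₁, v21Coact_e₂, map_add, map_smul,
        LinearMap.rTensor_tmul, LinearMap.lTensor_tmul, KAlg.comul_gen, KAlg.comulGen,
        LinearEquiv.coe_coe, TensorProduct.assoc_tmul,
        TensorProduct.tmul_smul, TensorProduct.tmul_add, TensorProduct.add_tmul, smul_smul,
        smul_add]
      match_scalars <;> field_simp <;> grind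
    · simp only [LinearMap.comp_apply, v21Coact_e₁, v21Coact_e₂, map_add, map_smul,
        LinearMap.rTensor_tmul, LinearMap.lTensor_tmul, KAlg.comul_gen, KAlg.comulGen,
        LinearEquiv.coe_coe, TensorProduct.assoc_tmul,
        TensorProduct.tmul_smul, TensorProduct.tmul_add, TensorProduct.add_tmul, smul_smul,
        smul_add]
      match_scalars <;> field_simp <;> grind
  coact_counit := by
    refine LinearMap.congr_fun (f := (TensorProduct.lid k _).toLinearMap ∘ₗ
      (Coalgebra.counit (R := k) (A := KAlg hξ)).rTensor _ ∘ₗ v21Coact hξ)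
      (g := LinearMap.id) (v21_ext ?_ ?_)
    · simp [v21Coact_e₁, KAlg.counit_gen, KAlg.counitGen]
    · simp [v21Coact_e₂, KAlg.counit_gen, KAlg.counitGen]
  compat := by
    intro h
    refine LinearMap.congr_fun (f := v21Coact hξ ∘ₗ v21Act hξ h)
      (g := ydTwist (v21Act hξ) ((Coalgebra.comul (R := k) (A := KAlg hξ)).lTensor _
        (Coalgebra.comul h)) ∘ₗ v21Coact hξ) ?_
    induction h using KAlg.induction with
    | hs r =>
      rw [AlgHom.commutes, Bialgebra.comul_algebraMap, Algebra.TensorProduct.algebraMap_apply,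
        LinearMap.lTensor_tmul, Bialgebra.comul_one]
      have e : ydTwist (v21Act hξ) (algebraMap k (KAlg hξ) r ⊗ₜ[k] (1 : KAlg hξ ⊗[k] KAlg hξ)) =
          algebraMap k _ r := by
        ext g v
        simp [Algebra.TensorProduct.one_def, ydTwist_tmul, ← Algebra.smul_def,
          TensorProduct.smul_tmul']
      rw [e]
      ext v
      simp
    | hg s =>
      have h2 := two_ne_zero_of_xi hξ
      have h1 := KAlg.xi_sq hξ
      rw [KAlg.comul_gen]
      refine v21_ext ?_ ?_
      · cases s <;>
        simp only [LinearMap.comp_apply, v21Coact_e₁, v21Coact_e₂, map_add, map_smul, v21Act_e₁,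
          v21Act_e₂, LinearMap.lTensor_tmul, KAlg.comul_gen, KAlg.comulGen,
          TensorProduct.tmul_add, LinearMap.add_apply, ydTwist_tmul, KAlg.antipode_gen,
          KAlg.antipodeGen, MulOpposite.unop_op] <;>
        simp only [v21Mat, KAlg.b_eq, KAlg.d_eq, mul_assoc, smul_mul_assoc, mul_smul_comm,
          KAlg.c_mul_c, KAlg.c_mul_c', KAlg.c_mul_a, KAlg.c_mul_a', KAlg.a_pow, KAlg.a_pow',
          TensorProduct.tmul_smul, TensorProduct.tmul_add, ← TensorProduct.smul_tmul', smul_smul,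
          smul_add, Matrix.of_apply, Matrix.cons_val', Matrix.cons_val_zero, Matrix.cons_val_one,
          Matrix.cons_val_fin_one, mul_one, zero_smul, smul_zero, TensorProduct.zero_tmul,
          TensorProduct.tmul_zero, mul_zero, add_zero, zero_add] <;>
        match_scalars <;> field_simp <;> grind
      · cases s <;>
        simp only [LinearMap.comp_apply, v21Coact_e₁, v21Coact_e₂, map_add, map_smul, v21Act_e₁,
          v21Act_e₂, LinearMap.lTensor_tmul, KAlg.comul_gen, KAlg.comulGen,
          TensorProduct.tmul_add, LinearMap.add_apply, ydTwist_tmul, KAlg.antipode_gen,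
          KAlg.antipodeGen, MulOpposite.unop_op] <;>
        simp only [v21Mat, KAlg.b_eq, KAlg.d_eq, mul_assoc, smul_mul_assoc, mul_smul_comm,
          KAlg.c_mul_c, KAlg.c_mul_c', KAlg.c_mul_a, KAlg.c_mul_a', KAlg.a_pow, KAlg.a_pow',
          TensorProduct.tmul_smul, TensorProduct.tmul_add, ← TensorProduct.smul_tmul', smul_smul,
          smul_add, Matrix.of_apply, Matrix.cons_val', Matrix.cons_val_zero, Matrix.cons_val_one,
          Matrix.cons_val_fin_one, mul_one, zero_smul, smul_zero, TensorProduct.zero_tmul,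
          TensorProduct.tmul_zero, mul_zero, add_zero, zero_add] <;>
        match_scalars <;> field_simp <;> grind
    | hm x y hx hy =>
      have e : ∀ s : KAlg hξ ⊗[k] KAlg hξ,
          (Coalgebra.comul (R := k) (A := KAlg hξ)).lTensor (KAlg hξ) s =
          Algebra.TensorProduct.map (AlgHom.id k (KAlg hξ)) (Bialgebra.comulAlgHom k _) s :=
        fun s => rfl
      simp only [e] at hx hy ⊢
      rw [map_mul, Bialgebra.comul_mul, map_mul, ydTwist_mul, Module.End.mul_eq_comp,
        Module.End.mul_eq_comp, ← LinearMap.comp_assoc, hx, LinearMap.comp_assoc, hy,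
        LinearMap.comp_assoc]
    | ha x y hx hy =>
      rw [map_add, LinearMap.comp_add, hx, hy, map_add, map_add, map_add, LinearMap.add_comp]

end V21

section Presentation

variable {k : Type u} [Field k]

/-- The defining relations `x² = 0`, `xy + ξyx = 0`, `y⁴ = 0`, where `x`, `y` are the free
generators with index `0`, `1`. -/
inductive B21Rel (ξ : k) : FreeAlgebra k (Fin 2) → FreeAlgebra k (Fin 2) → Prop
  | xx : B21Rel ξ (FreeAlgebra.ι k 0 ^ 2) 0
  | xy : B21Rel ξ (FreeAlgebra.ι k 0 * FreeAlgebra.ι k 1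
      + ξ • (FreeAlgebra.ι k 1 * FreeAlgebra.ι k 0)) 0
  | yyyy : B21Rel ξ (FreeAlgebra.ι k 1 ^ 4) 0

/-- The algebra generated by `x, y` with relations `x² = 0`, `xy + ξyx = 0`, `y⁴ = 0`. -/
abbrev B21 (ξ : k) : Type u := RingQuot (B21Rel ξ)

/-- The generator `x`. -/
noncomputable def B21.x (ξ : k) : B21 ξ := RingQuot.mkAlgHom k (B21Rel ξ) (FreeAlgebra.ι k 0)

/-- The generator `y`. -/
noncomputable def B21.y (ξ : k) : B21 ξ := RingQuot.mkAlgHom k (B21Rel ξ) (FreeAlgebra.ι k 1)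

end Presentation

/-! Write `B` for the presented algebra and `K` for the Hopf algebra. First `B` is given an explicit
Nichols algebra structure; any other Nichols algebra `R` is then compared with it.

Structure on `B`. The generators of `K` form a 2 × 2 matrix `t` with `Δ(t i j) = ∑ l, t i l ⊗ t l
j`, so making `B` a module algebra amounts to giving an algebra map `B → M₂(B)` whose entries, as
operators, satisfy the relations of `K`. The coaction is an algebra map `B → K ⊗ B`. Both are fixed
by `x` and `y`, and exist because the proposed values satisfy the relations of `B`. The
comultiplication ought to be an algebra map into the braided tensor square. Rather than proving that
product associative, one writes left multiplication by `Δ(x)` and by `Δ(y)` as elements of `End B ⊗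
End B`, checks the relations of `B` there, and applies the resulting operators to `1 ⊗ 1`. The
antipode comes in the same way from the recursion `S(x r) = -(x₍₋₁₎ · S(r)) x₍₀₎`. Most of the
remaining axioms then hold because both sides obey the same recursion under left multiplication by
`x` and `y`.

Nondegeneracy. A functional `f` on degree one gives a skew derivation `r ↦ r₍₁₎ f(r₍₂₎)`. On the
eight monomials `x ^ i y ^ j` these are explicit, and `eq_zero_of_combination_mem` shows that a
subspace stable under both derivations and not containing `1` is zero. Applied to the zero subspace,
this says that the monomials are independent, so `dim B = 8`; independence then lets `primitive_iff`
identify the primitive elements with the span of `x` and `y`.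

Uniqueness. In `R` every primitive element has degree one. The elements `x²`, `xy + ξyx` and `y⁴`
are primitive of degrees 2, 2 and 4, hence zero, which yields a surjection `B → R` compatible with
action and comultiplication. The coordinates of degree one vanish on its kernel, so the kernel is
stable under the skew derivations; it omits `1`, hence it is zero. -/

/-- The algebra `B21`, as a type that does not unfold to a ring quotient during unification. -/
def B21Alg {k : Type u} [Field k] (ξ : k) : Type u := B21 ξ

namespace B21Alg

/-! ### The presented algebra: rewriting rules, universal property, induction. -/

section Algebra

variable {k : Type u} [Field k] {ξ : k}

noncomputable instance : Ring (B21Alg ξ) := inferInstanceAs (Ring (B21 ξ))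

noncomputable instance : Algebra k (B21Alg ξ) := inferInstanceAs (Algebra k (B21 ξ))

variable (ξ) in
/-- The quotient map from the free algebra. -/
noncomputable def mk : FreeAlgebra k (Fin 2) →ₐ[k] B21Alg ξ := RingQuot.mkAlgHom k (B21Rel ξ)

theorem mk_rel {s t : FreeAlgebra k (Fin 2)} (h : B21Rel ξ s t) : mk ξ s = mk ξ t :=
  RingQuot.mkAlgHom_rel k h

variable (ξ) in
/-- The generator `x`. -/
noncomputable def x : B21Alg ξ := mk ξ (FreeAlgebra.ι k 0)

variable (ξ) in
/-- The generator `y`. -/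
noncomputable def y : B21Alg ξ := mk ξ (FreeAlgebra.ι k 1)

theorem x_mul_x : x ξ * x ξ = 0 := by
  have h := mk_rel (B21Rel.xx (ξ := ξ))
  rwa [map_pow, map_zero, pow_two] at h

theorem x_mul_y_add : x ξ * y ξ + ξ • (y ξ * x ξ) = 0 := by
  have h := mk_rel (B21Rel.xy (ξ := ξ))
  rwa [map_add, map_smul, map_mul, map_mul, map_zero] at h

theorem y_pow : y ξ * (y ξ * (y ξ * y ξ)) = 0 := by
  have h := mk_rel (B21Rel.yyyy (ξ := ξ))
  rw [map_pow, map_zero] at h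
  rw [← h]
  change _ = y ξ ^ 4
  noncomm_ring

theorem y_mul_x (hξ : IsPrimitiveRoot ξ 4) : y ξ * x ξ = ξ • (x ξ * y ξ) := by
  have h := congrArg (ξ • ·) (x_mul_y_add (ξ := ξ))
  simp only [smul_add, smul_smul, KAlg.xi_sq hξ, smul_zero, neg_smul, one_smul] at h
  exact (sub_eq_zero.1 (by rw [sub_eq_add_neg]; exact h)).symm

/-- The primed rules carry a trailing factor, so that right-nested words can be rewritten to the
normal form `x ^ i y ^ j`. -/
theorem x_mul_x' (z : B21Alg ξ) : x ξ * (x ξ * z) = 0 := by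
  rw [← mul_assoc, x_mul_x, zero_mul]

theorem y_pow' (z : B21Alg ξ) : y ξ * (y ξ * (y ξ * (y ξ * z))) = 0 := by
  have : y ξ * (y ξ * (y ξ * (y ξ * z))) = (y ξ * (y ξ * (y ξ * y ξ))) * z := by
    simp only [mul_assoc]
  rw [this, y_pow, zero_mul]

theorem y_mul_x' (hξ : IsPrimitiveRoot ξ 4) (z : B21Alg ξ) :
    y ξ * (x ξ * z) = ξ • (x ξ * (y ξ * z)) := by
  rw [← mul_assoc, y_mul_x hξ, smul_mul_assoc, mul_assoc]

variable {A : Type*} [Ring A] [Algebra k A]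

/-- The algebra map out of `B21` given by the images of `x` and `y`. -/
noncomputable def lift (X Y : A) (hX : X * X = 0) (hXY : X * Y + ξ • (Y * X) = 0)
    (hY : Y ^ 4 = 0) : B21Alg ξ →ₐ[k] A :=
  RingQuot.liftAlgHom k ⟨FreeAlgebra.lift k ![X, Y], by
    rintro _ _ (_ | _ | _)
    · simpa [pow_two] using hX
    · simpa using hXY
    · simpa using hY⟩

section

variable (X Y : A) (hX : X * X = 0) (hXY : X * Y + ξ • (Y * X) = 0) (hY : Y ^ 4 = 0)

@[simp] theorem lift_x : lift X Y hX hXY hY (x ξ) = X := by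
  simp only [lift, x, mk]
  erw [RingQuot.liftAlgHom_mkAlgHom_apply]
  simp

@[simp] theorem lift_y : lift X Y hX hXY hY (y ξ) = Y := by
  simp only [lift, y, mk]
  erw [RingQuot.liftAlgHom_mkAlgHom_apply]
  simp

end

theorem algHom_ext {f g : B21Alg ξ →ₐ[k] A} (hx : f (x ξ) = g (x ξ)) (hy : f (y ξ) = g (y ξ)) :
    f = g := by
  refine RingQuot.ringQuot_ext' (S := k) (s := B21Rel ξ) f g (FreeAlgebra.hom_ext (funext ?_))
  intro i
  fin_cases i
  · exact hx
  · exact hy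

-- Only left multiplication by a generator has to be treated. This fits the operators below, which
-- are governed by their values on `x * s` and `y * s` and need not be multiplicative.
@[elab_as_elim]
theorem induction {P : B21Alg ξ → Prop} (one : P 1) (smul : ∀ (r : k) s, P s → P (r • s))
    (add : ∀ s t, P s → P t → P (s + t)) (x_mul : ∀ s, P s → P (x ξ * s))
    (y_mul : ∀ s, P s → P (y ξ * s)) (s : B21Alg ξ) : P s := by
  obtain ⟨z, rfl⟩ := RingQuot.mkAlgHom_surjective k (B21Rel ξ) s
  change P (mk ξ z)
  -- An arbitrary right factor is allowed, so that the statements for two free words compose.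
  suffices h : ∀ s, P s → P (mk ξ z * s) by simpa using h 1 one
  induction z using FreeAlgebra.induction with
  | grade0 r =>
    intro s hs
    rw [AlgHom.commutes, ← Algebra.smul_def]
    exact smul r s hs
  | grade1 i =>
    fin_cases i
    · exact x_mul
    · exact y_mul
  | mul z t hz ht =>
    intro s hs
    rw [map_mul, mul_assoc]
    exact hz _ (ht _ hs)
  | add z t hz ht =>
    intro s hs
    rw [map_add, add_mul]
    exact add _ _ (hz _ hs) (ht _ hs)

theorem linearMap_ext {M : Type*} [AddCommGroup M] [Module k M] {f g : B21Alg ξ →ₗ[k] M}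
    (one : f 1 = g 1) (x_mul : ∀ s, f s = g s → f (x ξ * s) = g (x ξ * s))
    (y_mul : ∀ s, f s = g s → f (y ξ * s) = g (y ξ * s)) : f = g := by
  ext s
  induction s using B21Alg.induction with
  | one => exact one
  | smul r s hs => rw [map_smul, map_smul, hs]
  | add s t hs ht => rw [map_add, map_add, hs, ht]
  | x_mul s hs => exact x_mul s hs
  | y_mul s hs => exact y_mul s hs

end Algebra

/-! ### The action of `K` on the algebra. -/

section Action

variable {k : Type u} [Field k] {ξ : k} (hξ : IsPrimitiveRoot ξ 4)

/-- The algebra map `r ↦ (a · r, b · r; c · r, d · r)`. -/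
noncomputable def actMatrix : B21Alg ξ →ₐ[k] Matrix (Fin 2) (Fin 2) (B21Alg ξ) :=
  lift !![-x ξ, 0; 0, -x ξ] !![ξ • y ξ, x ξ; x ξ, -(ξ • y ξ)]
    (by ext i j; fin_cases i <;> fin_cases j <;> simp [x_mul_x])
    (by
      have h := KAlg.xi_sq hξ
      ext i j
      fin_cases i <;> fin_cases j <;> simp [x_mul_x, y_mul_x hξ, smul_smul] <;> match_scalars <;>
        grind)
    (by
      have h := KAlg.xi_sq hξ
      -- The fourth power is computed as the square of this square.
      have e : !![ξ • y ξ, x ξ; x ξ, -(ξ • y ξ)] ^ 2 =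
          !![-(y ξ * y ξ), -(ξ + 1) • (x ξ * y ξ); (ξ + 1) • (x ξ * y ξ), -(y ξ * y ξ)] := by
        rw [pow_two]
        ext i j
        fin_cases i <;> fin_cases j <;> simp [x_mul_x, y_mul_x hξ, smul_smul] <;> match_scalars <;>
          grind
      rw [show (4 : ℕ) = 2 * 2 from rfl, pow_mul, e, pow_two]
      ext i j
      fin_cases i <;> fin_cases j <;>
        simp [x_mul_x', y_mul_x' hξ, y_pow, smul_smul, mul_assoc] <;>
        match_scalars <;> grind)

/-- The entries of `actMatrix` as linear maps. -/
noncomputable def actEntry (i j : Fin 2) : Module.End k (B21Alg ξ) :=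
  Matrix.entryLinearMap k (B21Alg ξ) i j ∘ₗ (actMatrix hξ).toLinearMap

theorem actEntry_apply (i j : Fin 2) (r : B21Alg ξ) : actEntry hξ i j r = actMatrix hξ r i j :=
  rfl

theorem actEntry_one (i j : Fin 2) :
    actEntry hξ i j 1 = (1 : Matrix (Fin 2) (Fin 2) (B21Alg ξ)) i j := by
  rw [actEntry_apply, map_one]

theorem actEntry_x_mul (i j : Fin 2) (s : B21Alg ξ) :
    actEntry hξ i j (x ξ * s) = -(x ξ * actEntry hξ i j s) := by
  simp only [actEntry_apply, map_mul, actMatrix, lift_x, Matrix.mul_apply, Fin.sum_univ_two]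
  fin_cases i <;> simp

theorem actEntry_zero_y_mul (j : Fin 2) (s : B21Alg ξ) :
    actEntry hξ 0 j (y ξ * s) = ξ • (y ξ * actEntry hξ 0 j s) + x ξ * actEntry hξ 1 j s := by
  simp [actEntry_apply, map_mul, actMatrix, lift_y, Matrix.mul_apply, Fin.sum_univ_two]

theorem actEntry_one_y_mul (j : Fin 2) (s : B21Alg ξ) :
    actEntry hξ 1 j (y ξ * s) = x ξ * actEntry hξ 0 j s - ξ • (y ξ * actEntry hξ 1 j s) := by
  simp [actEntry_apply, map_mul, actMatrix, lift_y, Matrix.mul_apply, Fin.sum_univ_two,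
    sub_eq_add_neg]

/-- The action of the generators of `K` on `B21`. -/
noncomputable def actGen : KGen → Module.End k (B21Alg ξ)
  | .a => actEntry hξ 0 0
  | .b => actEntry hξ 0 1
  | .c => actEntry hξ 1 0
  | .d => actEntry hξ 1 1

/-- The recursion for `y * s` mixes the rows of the matrix, so no relation can be proved alone: `c²
= 0` at `y * s` needs `ca = -ξ ac` at `s`, and conversely. These two come first; the expressions of
`b` and `d` through `a` and `c`, and `a⁴ = 1`, then follow in a joint induction that uses them at
every element. -/
theorem actGen_rel_apply (s : B21Alg ξ) :
    ((actGen hξ .c * actGen hξ .a) s = (-ξ) • (actGen hξ .a * actGen hξ .c) s ∧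
    (actGen hξ .c * actGen hξ .c) s = 0) ∧
    (actGen hξ .a * (actGen hξ .a * (actGen hξ .a * actGen hξ .a))) s = s ∧
    actGen hξ .b s = (actGen hξ .a * (actGen hξ .a * actGen hξ .c)) s ∧
    actGen hξ .d s = (actGen hξ .a * (actGen hξ .a * actGen hξ .a)) s := by
  have h := KAlg.xi_sq hξ
  have e1 : ∀ s : B21Alg ξ,
      (actGen hξ .c * actGen hξ .a) s = (-ξ) • (actGen hξ .a * actGen hξ .c) s ∧
      (actGen hξ .c * actGen hξ .c) s = 0 := by
    intro s
    simp only [actGen, Module.End.mul_apply]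
    induction s using B21Alg.induction with
    | one => simp [actEntry_one]
    | smul r s hs =>
      exact ⟨by simp only [map_smul, hs.1, smul_comm r], by simp only [map_smul, hs.2, smul_zero]⟩
    | add s t hs ht => simp only [map_add, hs, ht, smul_add, add_zero, and_self]
    | x_mul s hs =>
      simp only [actEntry_x_mul, map_neg, hs, mul_smul_comm, smul_neg, mul_zero, neg_zero, and_self]
    | y_mul s hs =>
      simp only [actEntry_x_mul, actEntry_zero_y_mul, actEntry_one_y_mul, map_add, map_sub,
        map_smul, hs, mul_smul_comm, mul_zero, neg_zero, smul_zero]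
      constructor <;> match_scalars <;> grind
  refine ⟨e1 s, ?_⟩
  simp only [actGen, Module.End.mul_apply] at e1 ⊢
  induction s using B21Alg.induction with
  | one => simp [actEntry_one]
  | smul r s hs => simp only [map_smul, hs.1, hs.2.1, hs.2.2, and_self]
  | add s t hs ht => simp only [map_add, hs.1, hs.2.1, hs.2.2, ht.1, ht.2.1, ht.2.2, and_self]
  | x_mul s hs =>
    simp only [actEntry_x_mul, map_neg, hs.2.1, hs.2.2, hs.1, neg_neg, and_self]
  | y_mul s hs =>
    simp only [actEntry_x_mul, actEntry_zero_y_mul, actEntry_one_y_mul, map_neg, map_add, map_sub,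
      map_smul, hs.2, e1, hs.1]
    simp only [mul_smul_comm, smul_neg, smul_add]
    refine ⟨?_, ?_, ?_⟩ <;> match_scalars <;> grind

theorem actGen_rel ⦃s t : FreeAlgebra k KGen⦄ (h : KRel ξ s t) :
    FreeAlgebra.lift k (actGen hξ) s = FreeAlgebra.lift k (actGen hξ) t :=
  KAlg.rel_of hξ (LinearMap.ext fun s => (actGen_rel_apply hξ s).2.1)
    (LinearMap.ext fun s => (actGen_rel_apply hξ s).2.2.1)
    (LinearMap.ext fun s => (actGen_rel_apply hξ s).2.2.2)
    (LinearMap.ext fun s => (actGen_rel_apply hξ s).1.2)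
    (LinearMap.ext fun s => (actGen_rel_apply hξ s).1.1) h

/-- The action of `K` on `B21`. -/
noncomputable def act : KAlg hξ →ₐ[k] Module.End k (B21Alg ξ) :=
  KAlg.lift hξ (actGen hξ) (actGen_rel hξ)

theorem act_gen (s : KGen) : act hξ (KAlg.gen hξ s) = actGen hξ s :=
  KAlg.lift_gen hξ _ (actGen_rel hξ) s

end Action

end B21Alg

/-! ### The generators of `K` as a matrix coalgebra. -/

namespace KAlg

variable {k : Type u} [Field k] {ξ : k} (hξ : IsPrimitiveRoot ξ 4)

/-- The matrix `(a, b; c, d)` of generators of `K`, with `Δ(t i j) = ∑ l, t i l ⊗ t l j`. -/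
noncomputable def genMatrix : Matrix (Fin 2) (Fin 2) (KAlg hξ) := !![a hξ, b hξ; c hξ, d hξ]

theorem comul_genMatrix (i j : Fin 2) :
    Coalgebra.comul (R := k) (genMatrix hξ i j) =
      ∑ l, genMatrix hξ i l ⊗ₜ[k] genMatrix hξ l j := by
  fin_cases i <;> fin_cases j <;> simp [genMatrix, comul_gen, comulGen]

theorem counit_genMatrix (i j : Fin 2) :
    Coalgebra.counit (R := k) (genMatrix hξ i j) = (1 : Matrix (Fin 2) (Fin 2) k) i j := by
  fin_cases i <;> fin_cases j <;> simp [genMatrix, counit_gen, counitGen]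

/-- The antipode axiom on the entries: applying `S` entrywise produces an inverse of the matrix of
generators. It is what removes `S` from the Yetter-Drinfeld condition. -/
theorem genMatrix_mul_antipode (i j : Fin 2) :
    ∑ l, genMatrix hξ i l * HopfAlgebra.antipode k (genMatrix hξ l j) =
      (1 : Matrix (Fin 2) (Fin 2) (KAlg hξ)) i j := by
  have h := HopfAlgebra.mul_antipode_lTensor_comul_apply (R := k) (genMatrix hξ i j)
  rw [comul_genMatrix, counit_genMatrix, map_sum, map_sum] at h
  simp only [LinearMap.lTensor_tmul, LinearMap.mul'_apply] at h
  rw [h, Matrix.one_apply, Matrix.one_apply]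
  split_ifs <;> simp

variable {hξ}

@[elab_as_elim]
theorem induction_genMatrix {P : KAlg hξ → Prop} (hs : ∀ r : k, P (algebraMap k _ r))
    (hg : ∀ i j, P (genMatrix hξ i j)) (hm : ∀ x y, P x → P y → P (x * y))
    (ha : ∀ x y, P x → P y → P (x + y)) (z : KAlg hξ) : P z := by
  refine KAlg.induction hs (fun s => ?_) hm ha z
  cases s
  · exact hg 0 0
  · exact hg 0 1
  · exact hg 1 0
  · exact hg 1 1

end KAlg

/-! ### The coaction and the Yetter-Drinfeld condition. -/

namespace B21Alg

variable {k : Type u} [Field k] {ξ : k} (hξ : IsPrimitiveRoot ξ 4)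

open KAlg (genMatrix)

theorem act_genMatrix (i j : Fin 2) : act hξ (genMatrix hξ i j) = actEntry hξ i j := by
  fin_cases i <;> fin_cases j <;> simp [genMatrix, act_gen, actGen]

/-- This is the module algebra axiom on the generators, obtained as multiplicativity of `actMatrix`
read entry by entry. -/
theorem actEntry_mul (i j : Fin 2) (r s : B21Alg ξ) :
    actEntry hξ i j (r * s) = ∑ l, actEntry hξ i l r * actEntry hξ l j s := by
  simp only [actEntry_apply, map_mul, Matrix.mul_apply]

theorem actEntry_x (i j : Fin 2) :
    actEntry hξ i j (x ξ) = (!![-x ξ, 0; 0, -x ξ] : Matrix (Fin 2) (Fin 2) (B21Alg ξ)) i j := by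
  rw [actEntry_apply, actMatrix, lift_x]

theorem actEntry_y (i j : Fin 2) :
    actEntry hξ i j (y ξ) =
      (!![ξ • y ξ, x ξ; x ξ, -(ξ • y ξ)] : Matrix (Fin 2) (Fin 2) (B21Alg ξ)) i j := by
  rw [actEntry_apply, actMatrix, lift_y]

/-- The element `δ(x)`. -/
noncomputable def coactX : KAlg hξ ⊗[k] B21Alg ξ :=
  KAlg.d hξ ⊗ₜ x ξ + (ξ - 1) • KAlg.c hξ ⊗ₜ y ξ

/-- The element `δ(y)`. -/
noncomputable def coactY : KAlg hξ ⊗[k] B21Alg ξ :=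
  KAlg.a hξ ⊗ₜ y ξ + (-(1 + ξ) / 2) • KAlg.b hξ ⊗ₜ x ξ

/-- The coaction on `B21`, as an algebra map. -/
noncomputable def coact : B21Alg ξ →ₐ[k] KAlg hξ ⊗[k] B21Alg ξ :=
  lift (coactX hξ) (coactY hξ)
    (by
      have h1 := KAlg.xi_sq hξ
      simp only [coactX, KAlg.d_eq, mul_add, add_mul, Algebra.TensorProduct.tmul_mul_tmul,
        smul_mul_assoc, mul_smul_comm, mul_assoc, KAlg.c_mul_c, KAlg.c_mul_a, KAlg.c_mul_a',
        x_mul_x, y_mul_x hξ, TensorProduct.zero_tmul, TensorProduct.tmul_zero, smul_zero, add_zero,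
        zero_add, TensorProduct.tmul_smul, ← TensorProduct.smul_tmul', smul_smul]
      match_scalars <;> grind)
    (by
      have h1 := KAlg.xi_sq hξ
      have h2 := two_ne_zero_of_xi hξ
      simp only [coactX, coactY, KAlg.d_eq, KAlg.b_eq, mul_add, add_mul,
        Algebra.TensorProduct.tmul_mul_tmul, smul_mul_assoc, mul_smul_comm, mul_assoc, KAlg.c_mul_c,
        KAlg.c_mul_a, KAlg.c_mul_a', KAlg.a_pow, KAlg.a_pow', x_mul_x, y_mul_x hξ,
        TensorProduct.zero_tmul, TensorProduct.tmul_zero, mul_zero, smul_add, smul_zero, add_zero,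
        TensorProduct.tmul_smul, ← TensorProduct.smul_tmul', smul_smul]
      match_scalars <;> field_simp <;> grind)
    (by
      have h1 := KAlg.xi_sq hξ
      -- The cross terms cancel: `ab = ξ ba` and `yx = ξ xy`, so `ab ⊗ yx = ξ² ba ⊗ xy = -ba ⊗ xy`.
      -- Hence `δ(y)⁴ = a⁴ ⊗ y⁴ = 0`.
      have e : coactY hξ * coactY hξ = (KAlg.a hξ * KAlg.a hξ) ⊗ₜ (y ξ * y ξ) := by
        simp only [coactY, KAlg.b_eq, mul_add, add_mul, Algebra.TensorProduct.tmul_mul_tmul,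
          smul_mul_assoc, mul_smul_comm, mul_assoc, KAlg.c_mul_c, KAlg.c_mul_a, KAlg.c_mul_a',
          x_mul_x, y_mul_x hξ, TensorProduct.tmul_zero, mul_zero, smul_zero, add_zero,
          TensorProduct.tmul_smul, ← TensorProduct.smul_tmul', smul_smul]
        match_scalars <;> grind
      have e4 : coactY hξ ^ 4 = coactY hξ * coactY hξ * (coactY hξ * coactY hξ) := by
        noncomm_ring
      rw [e4, e, Algebra.TensorProduct.tmul_mul_tmul]
      simp only [mul_assoc, y_pow, TensorProduct.tmul_zero])

theorem coact_x : coact hξ (x ξ) = coactX hξ := lift_x ..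

theorem coact_y : coact hξ (y ξ) = coactY hξ := lift_y ..

theorem coact_coassoc (r : B21Alg ξ) :
    TensorProduct.assoc k (KAlg hξ) (KAlg hξ) (B21Alg ξ)
      ((Coalgebra.comul (R := k) (A := KAlg hξ)).rTensor (B21Alg ξ) (coact hξ r)) =
      (coact hξ).toLinearMap.lTensor (KAlg hξ) (coact hξ r) := by
  have h1 := KAlg.xi_sq hξ
  have h2 := two_ne_zero_of_xi hξ
  -- Both iterated coactions are algebra maps, so it is enough to compare them on `x` and `y`.
  let f : B21Alg ξ →ₐ[k] KAlg hξ ⊗[k] (KAlg hξ ⊗[k] B21Alg ξ) :=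
    (Algebra.TensorProduct.assoc k k k (KAlg hξ) (KAlg hξ) (B21Alg ξ)).toAlgHom.comp
      ((Algebra.TensorProduct.map (Bialgebra.comulAlgHom k (KAlg hξ)) (AlgHom.id k _)).comp
        (coact hξ))
  let g : B21Alg ξ →ₐ[k] KAlg hξ ⊗[k] (KAlg hξ ⊗[k] B21Alg ξ) :=
    (Algebra.TensorProduct.map (AlgHom.id k _) (coact hξ)).comp (coact hξ)
  have hfg : f = g := by
    apply algHom_ext
    · change TensorProduct.assoc k _ _ _ ((Coalgebra.comul (R := k)).rTensor _ (coact hξ (x ξ))) =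
        (coact hξ).toLinearMap.lTensor _ (coact hξ (x ξ))
      simp only [coact_x, coact_y, coactX, coactY, map_add, map_smul,
        LinearMap.rTensor_tmul, LinearMap.lTensor_tmul, KAlg.comul_gen, KAlg.comulGen,
        TensorProduct.add_tmul, TensorProduct.tmul_add, AlgHom.toLinearMap_apply,
        TensorProduct.assoc_tmul, TensorProduct.tmul_smul, smul_add, smul_smul]
      match_scalars <;> field_simp <;> grind
    · change TensorProduct.assoc k _ _ _ ((Coalgebra.comul (R := k)).rTensor _ (coact hξ (y ξ))) =
        (coact hξ).toLinearMap.lTensor _ (coact hξ (y ξ))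
      simp only [coact_x, coact_y, coactX, coactY, map_add, map_smul,
        LinearMap.rTensor_tmul, LinearMap.lTensor_tmul, KAlg.comul_gen, KAlg.comulGen,
        TensorProduct.add_tmul, TensorProduct.tmul_add, AlgHom.toLinearMap_apply,
        TensorProduct.assoc_tmul, TensorProduct.tmul_smul, smul_add, smul_smul]
      match_scalars <;> field_simp <;> grind
  exact AlgHom.congr_fun hfg r

theorem coact_counit (r : B21Alg ξ) :
    TensorProduct.lid k (B21Alg ξ)
      ((Coalgebra.counit (R := k) (A := KAlg hξ)).rTensor (B21Alg ξ) (coact hξ r)) = r := by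
  let f : B21Alg ξ →ₐ[k] B21Alg ξ :=
    (Algebra.TensorProduct.lid k (B21Alg ξ)).toAlgHom.comp
      ((Algebra.TensorProduct.map (Bialgebra.counitAlgHom k (KAlg hξ)) (AlgHom.id k _)).comp
        (coact hξ))
  have hf : f = AlgHom.id k _ := by
    apply algHom_ext <;>
      simp [f, coact_x, coact_y, coactX, coactY, KAlg.counit_gen, KAlg.counitGen]
  exact AlgHom.congr_fun hf r

/-- The map `h ⊗ r ↦ h ⊗ t i j · r`, where `t` is the matrix of generators of `K`. -/
noncomputable def actRight (i j : Fin 2) :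
    KAlg hξ ⊗[k] B21Alg ξ →ₗ[k] KAlg hξ ⊗[k] B21Alg ξ :=
  (actEntry hξ i j).lTensor _

theorem actRight_tmul (i j : Fin 2) (h : KAlg hξ) (r : B21Alg ξ) :
    actRight hξ i j (h ⊗ₜ r) = h ⊗ₜ actEntry hξ i j r := rfl

theorem actRight_mul (i j : Fin 2) (u v : KAlg hξ ⊗[k] B21Alg ξ) :
    actRight hξ i j (u * v) = ∑ l, actRight hξ i l u * actRight hξ l j v := by
  induction u with
  | zero => simp
  | add u u' hu hu' => simp only [add_mul, map_add, hu, hu', Finset.sum_add_distrib]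
  | tmul h r =>
    induction v with
    | zero => simp
    | add v v' hv hv' => simp only [mul_add, map_add, hv, hv', Finset.sum_add_distrib]
    | tmul g s =>
      simp only [actRight_tmul, Algebra.TensorProduct.tmul_mul_tmul, actEntry_mul,
        TensorProduct.tmul_sum]

/-- The Yetter-Drinfeld condition in the form
`∑ l, t i l r₍₋₁₎ ⊗ t l j · r₍₀₎ = ∑ l, (t i l · r)₍₋₁₎ t l j ⊗ (t i l · r)₍₀₎`. -/
theorem coact_actEntry_mul (i j : Fin 2) (r : B21Alg ξ) :
    ∑ l, coact hξ (actEntry hξ i l r) * genMatrix hξ l j ⊗ₜ 1 =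
      ∑ l, genMatrix hξ i l ⊗ₜ 1 * actRight hξ l j (coact hξ r) := by
  have h1 := KAlg.xi_sq hξ
  have h2 := two_ne_zero_of_xi hξ
  -- As matrices the claim is `D r * T = T * F (δ r)`. Both `D` and `F` are multiplicative, so the
  -- identity passes from `x`, `y` and `s` to `x * s` and `y * s`.
  let T : Matrix (Fin 2) (Fin 2) (KAlg hξ ⊗[k] B21Alg ξ) := .of fun i j => genMatrix hξ i j ⊗ₜ 1
  let F (u : KAlg hξ ⊗[k] B21Alg ξ) : Matrix (Fin 2) (Fin 2) (KAlg hξ ⊗[k] B21Alg ξ) :=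
    .of fun i j => actRight hξ i j u
  let D (r : B21Alg ξ) : Matrix (Fin 2) (Fin 2) (KAlg hξ ⊗[k] B21Alg ξ) :=
    .of fun i j => coact hξ (actEntry hξ i j r)
  have hF : ∀ u v, F (u * v) = F u * F v := fun u v => by
    ext i j
    simp [F, actRight_mul, Matrix.mul_apply]
  have hD : ∀ r s, D (r * s) = D r * D s := fun r s => by
    ext i j
    simp [D, actEntry_mul, Matrix.mul_apply]
  have hx : D (x ξ) * T = T * F (coact hξ (x ξ)) := by
    ext i j
    simp only [Matrix.mul_apply, Fin.sum_univ_two, D, T, F, Matrix.of_apply, coact_x, coactX,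
      map_add, map_smul, actRight_tmul, actEntry_x, actEntry_y]
    fin_cases i <;> fin_cases j <;>
    simp only [genMatrix, Matrix.of_apply, Matrix.cons_val', Matrix.cons_val_zero,
      Matrix.cons_val_one, Matrix.cons_val_fin_one, Fin.zero_eta, Fin.mk_one, map_neg, map_zero,
      coact_x, coactX, KAlg.d_eq, KAlg.b_eq, mul_add, add_mul, Algebra.TensorProduct.tmul_mul_tmul,
      neg_mul, mul_neg, zero_mul, mul_one, one_mul, smul_mul_assoc, mul_smul_comm, mul_assoc,
      KAlg.c_mul_c, KAlg.c_mul_a, KAlg.c_mul_a', KAlg.a_pow, KAlg.a_pow', TensorProduct.zero_tmul,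
      TensorProduct.tmul_zero, mul_zero, TensorProduct.tmul_neg, smul_zero, add_zero, zero_add,
      TensorProduct.tmul_smul, ← TensorProduct.smul_tmul', smul_smul] <;>
    match_scalars <;> field_simp <;> grind
  have hy : D (y ξ) * T = T * F (coact hξ (y ξ)) := by
    ext i j
    simp only [Matrix.mul_apply, Fin.sum_univ_two, D, T, F, Matrix.of_apply, coact_y, coactY,
      map_add, map_smul, actRight_tmul, actEntry_x, actEntry_y]
    fin_cases i <;> fin_cases j <;>
    simp only [genMatrix, Matrix.of_apply, Matrix.cons_val', Matrix.cons_val_zero,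
      Matrix.cons_val_one, Matrix.cons_val_fin_one, Fin.zero_eta, Fin.mk_one, map_neg, map_smul,
      coact_x, coact_y, coactX, coactY, KAlg.d_eq, KAlg.b_eq, mul_add, add_mul,
      Algebra.TensorProduct.tmul_mul_tmul, neg_mul, mul_neg, mul_one, one_mul, smul_mul_assoc,
      mul_smul_comm, mul_assoc, KAlg.c_mul_c, KAlg.c_mul_a, KAlg.c_mul_a', KAlg.a_pow, KAlg.a_pow',
      TensorProduct.zero_tmul, TensorProduct.tmul_zero, mul_zero, smul_add, TensorProduct.tmul_neg,
      smul_zero, add_zero, TensorProduct.tmul_smul, ← TensorProduct.smul_tmul', smul_smul] <;>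
    match_scalars <;> field_simp <;> grind
  have key : D r * T = T * F (coact hξ r) := by
    induction r using B21Alg.induction with
    | one =>
      ext i j
      fin_cases i <;> fin_cases j <;>
      simp [D, F, T, Matrix.mul_apply, actEntry_one, Algebra.TensorProduct.one_def,
        actRight_tmul]
    | smul c s hs =>
      have e1 : D (c • s) = c • D s := by ext i j; simp [D]
      have e2 : F (coact hξ (c • s)) = c • F (coact hξ s) := by ext i j; simp [F]
      rw [e1, e2, smul_mul_assoc, mul_smul_comm, hs]
    | add s t hs ht =>
      have e1 : D (s + t) = D s + D t := by ext i j; simp [D]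
      have e2 : F (coact hξ (s + t)) = F (coact hξ s) + F (coact hξ t) := by ext i j; simp [F]
      rw [e1, e2, add_mul, mul_add, hs, ht]
    | x_mul s hs => rw [hD, mul_assoc, hs, ← mul_assoc, hx, mul_assoc, ← hF, map_mul]
    | y_mul s hs => rw [hD, mul_assoc, hs, ← mul_assoc, hy, mul_assoc, ← hF, map_mul]
  simpa [D, T, F, Matrix.mul_apply] using congrFun₂ key i j

/-- The twofold comultiplication of `t i j` is `∑ t i l ⊗ t l m ⊗ t m j`. The outer sum isolates the
antipode leg, and the inner sum is one side of `coact_actEntry_mul`. -/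
theorem ydTwist_comul_genMatrix (i j : Fin 2) (u : KAlg hξ ⊗[k] B21Alg ξ) :
    ydTwist (act hξ) ((Coalgebra.comul (R := k) (A := KAlg hξ)).lTensor (KAlg hξ)
      (Coalgebra.comul (genMatrix hξ i j))) u =
    ∑ m, (∑ l, genMatrix hξ i l ⊗ₜ 1 * actRight hξ l m u) *
      HopfAlgebra.antipode k (genMatrix hξ m j) ⊗ₜ 1 := by
  induction u with
  | zero => simp
  | add u v hu hv =>
    simp only [map_add, mul_add, Finset.sum_add_distrib, add_mul, hu, hv]
  | tmul h r =>
    simp only [KAlg.comul_genMatrix, map_sum, LinearMap.lTensor_tmul, TensorProduct.tmul_sum,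
      LinearMap.sum_apply, ydTwist_tmul, act_genMatrix, actRight_tmul,
      Algebra.TensorProduct.tmul_mul_tmul, Finset.sum_mul, one_mul, mul_one, mul_assoc]
    rw [Finset.sum_comm]

/-- Both sides are multiplicative in `h`, so only the generators matter. There the antipode-free
identity `coact_actEntry_mul` is multiplied on the right by the inverse matrix of
`genMatrix_mul_antipode`. -/
theorem coact_act (h : KAlg hξ) (r : B21Alg ξ) :
    coact hξ (act hξ h r) =
      ydTwist (act hξ) ((Coalgebra.comul (R := k) (A := KAlg hξ)).lTensor (KAlg hξ)
        (Coalgebra.comul h)) (coact hξ r) := by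
  refine LinearMap.congr_fun (f := (coact hξ).toLinearMap ∘ₗ act hξ h)
    (g := ydTwist (act hξ) ((Coalgebra.comul (R := k) (A := KAlg hξ)).lTensor _
      (Coalgebra.comul h)) ∘ₗ (coact hξ).toLinearMap) ?_ r
  induction h using KAlg.induction_genMatrix with
  | hs r =>
    rw [AlgHom.commutes, Bialgebra.comul_algebraMap, Algebra.TensorProduct.algebraMap_apply,
      LinearMap.lTensor_tmul, Bialgebra.comul_one]
    have e : ydTwist (act hξ) (algebraMap k (KAlg hξ) r ⊗ₜ[k] (1 : KAlg hξ ⊗[k] KAlg hξ)) =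
        algebraMap k _ r := by
      ext g v
      simp [Algebra.TensorProduct.one_def, ydTwist_tmul, ← Algebra.smul_def,
        TensorProduct.smul_tmul']
    rw [e]
    ext v
    simp
  | hg i j =>
    ext r
    simp only [LinearMap.comp_apply, AlgHom.toLinearMap_apply, ydTwist_comul_genMatrix,
      ← coact_actEntry_mul, act_genMatrix, Finset.sum_mul, mul_assoc,
      Algebra.TensorProduct.tmul_mul_tmul, one_mul]
    rw [Finset.sum_comm]
    -- The sum over the last index is now `∑ m, t l m * S(t m j)`, which leaves only the term `l =
    -- j`.
    simp only [← Finset.mul_sum, ← TensorProduct.sum_tmul, KAlg.genMatrix_mul_antipode]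
    rw [Finset.sum_eq_single j (fun m _ hm => by simp [Matrix.one_apply_ne hm]) (by simp),
      Matrix.one_apply_eq, ← Algebra.TensorProduct.one_def, mul_one]
  | hm x y hx hy =>
    have e : ∀ s : KAlg hξ ⊗[k] KAlg hξ,
        (Coalgebra.comul (R := k) (A := KAlg hξ)).lTensor (KAlg hξ) s =
        Algebra.TensorProduct.map (AlgHom.id k (KAlg hξ)) (Bialgebra.comulAlgHom k _) s :=
      fun s => rfl
    simp only [e] at hx hy ⊢
    rw [map_mul, Bialgebra.comul_mul, map_mul, ydTwist_mul, Module.End.mul_eq_comp,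
      Module.End.mul_eq_comp, ← LinearMap.comp_assoc, hx, LinearMap.comp_assoc, hy,
      LinearMap.comp_assoc]
  | ha x y hx hy =>
    rw [map_add, LinearMap.comp_add, hx, hy, map_add, map_add, map_add, LinearMap.add_comp]

/-- The Yetter-Drinfeld module structure on `B21`. -/
noncomputable def ydModule : YDModule k (KAlg hξ) (B21Alg ξ) where
  act := act hξ
  coact := (coact hξ).toLinearMap
  coact_coassoc := coact_coassoc hξ
  coact_counit := coact_counit hξ
  compat := coact_act hξ

end B21Alg

/-! ### Diagonal actions and the braided product in general. -/

section YetterDrinfeld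

variable {k : Type u} {H : Type v} [CommRing k] [Ring H] [HopfAlgebra k H]
  {M : Type w} {N : Type x} [AddCommGroup M] [Module k M] [AddCommGroup N] [Module k N]

theorem ydTensorAct_mul (X : YDModule k H M) (Y : YDModule k H N) (g h : H) :
    ydTensorAct X Y (g * h) = ydTensorAct X Y g * ydTensorAct X Y h := by
  have key : ∀ s t : H ⊗[k] H,
      TensorProduct.homTensorHomMap (RingHom.id k) M N M N
        (TensorProduct.map X.act.toLinearMap Y.act.toLinearMap (s * t)) =
      TensorProduct.homTensorHomMap (RingHom.id k) M N M N
        (TensorProduct.map X.act.toLinearMap Y.act.toLinearMap s) *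
      TensorProduct.homTensorHomMap (RingHom.id k) M N M N
        (TensorProduct.map X.act.toLinearMap Y.act.toLinearMap t) := by
    intro s t
    induction s with
    | zero => simp
    | add s s' hs hs' => simp only [add_mul, map_add, hs, hs']
    | tmul a b =>
      induction t with
      | zero => simp
      | add t t' ht ht' => simp only [mul_add, map_add, ht, ht']
      | tmul c d =>
        ext m n
        simp
  simp only [ydTensorAct, LinearMap.comp_apply, Bialgebra.comul_mul, key]

theorem ydTensorAct_algebraMap (X : YDModule k H M) (Y : YDModule k H N) (r : k) :
    ydTensorAct X Y (algebraMap k H r) = algebraMap k _ r := by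
  ext m n
  simp [ydTensorAct, Algebra.TensorProduct.one_def, TensorProduct.smul_tmul',
    Algebra.algebraMap_eq_smul_one]

/-- The right side is linear in `X.coact q`. Later proofs exploit this by replacing the coaction
with an arbitrary tensor and then with a pure one. -/
theorem braidedTensorMul_tmul {R : Type w} [Ring R] [Algebra k R] (X : YDModule k H R)
    (p q p' q' : R) :
    braidedTensorMul X ((p ⊗ₜ q) ⊗ₜ (p' ⊗ₜ q')) =
      TensorProduct.map (LinearMap.mulLeft k p ∘ₗ X.act.toLinearMap.flip p')
        (LinearMap.mulRight k q') (X.coact q) := by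
  simp only [braidedTensorMul, ydBraiding, LinearMap.comp_apply, LinearEquiv.coe_coe,
    TensorProduct.assoc_tmul, LinearMap.lTensor_tmul, TensorProduct.assoc_symm_tmul,
    LinearMap.rTensor_tmul]
  generalize X.coact q = u
  induction u with
  | zero => simp
  | add u v hu hv => simp only [TensorProduct.add_tmul, map_add, TensorProduct.tmul_add, hu, hv]
  | tmul h t => simp

end YetterDrinfeld

section KAlg

variable {k : Type u} [Field k] {ξ : k} {hξ : IsPrimitiveRoot ξ 4}
  {M : Type w} {N : Type x} [AddCommGroup M] [Module k M] [AddCommGroup N] [Module k N]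

open KAlg (genMatrix)

theorem ydTensorAct_genMatrix (X : YDModule k (KAlg hξ) M) (Y : YDModule k (KAlg hξ) N)
    (i j : Fin 2) :
    ydTensorAct X Y (genMatrix hξ i j) =
      ∑ l, TensorProduct.map (X.act (genMatrix hξ i l)) (Y.act (genMatrix hξ l j)) := by
  simp only [ydTensorAct, LinearMap.comp_apply, KAlg.comul_genMatrix, map_sum,
    TensorProduct.map_tmul]
  rfl

end KAlg

namespace B21Alg

variable {k : Type u} [Field k] {ξ : k} (hξ : IsPrimitiveRoot ξ 4)

open KAlg (genMatrix)

/-! ### Commutation rules for the operators `x`, `y`, `a`, `c`. -/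

section Operators

variable (ξ) in
/-- Left multiplication by `x`. -/
noncomputable def opX : Module.End k (B21Alg ξ) := LinearMap.mulLeft k (x ξ)

variable (ξ) in
/-- Left multiplication by `y`. -/
noncomputable def opY : Module.End k (B21Alg ξ) := LinearMap.mulLeft k (y ξ)

/-- The action of `a`. -/
noncomputable def opA : Module.End k (B21Alg ξ) := actEntry hξ 0 0

/-- The action of `c`. -/
noncomputable def opC : Module.End k (B21Alg ξ) := actEntry hξ 1 0

theorem opX_apply (s : B21Alg ξ) : opX ξ s = x ξ * s := rfl

theorem opY_apply (s : B21Alg ξ) : opY ξ s = y ξ * s := rfl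

theorem actEntry_zero_zero : actEntry hξ 0 0 = opA hξ := rfl

theorem actEntry_one_zero : actEntry hξ 1 0 = opC hξ := rfl

/-- Since `b = a²c` and `d = a³`, the operators `a` and `c` suffice. The rules below move them to
the right of `x` and `y`, giving a normal form in which operator identities can be compared
coefficient by coefficient. -/
theorem actEntry_zero_one : actEntry hξ 0 1 = opA hξ * (opA hξ * opC hξ) :=
  LinearMap.ext fun s => (actGen_rel_apply hξ s).2.2.1

theorem actEntry_one_one : actEntry hξ 1 1 = opA hξ * (opA hξ * opA hξ) :=
  LinearMap.ext fun s => (actGen_rel_apply hξ s).2.2.2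

theorem opA_pow : opA hξ * (opA hξ * (opA hξ * opA hξ)) = 1 :=
  LinearMap.ext fun s => (actGen_rel_apply hξ s).2.1

theorem opC_mul_opC : opC hξ * opC hξ = 0 :=
  LinearMap.ext fun s => (actGen_rel_apply hξ s).1.2

theorem opC_mul_opA : opC hξ * opA hξ = (-ξ) • (opA hξ * opC hξ) :=
  LinearMap.ext fun s => (actGen_rel_apply hξ s).1.1

theorem opX_mul_opX : opX ξ * opX ξ = 0 := LinearMap.ext fun s => x_mul_x' s

theorem opY_mul_opX (hξ : IsPrimitiveRoot ξ 4) : opY ξ * opX ξ = ξ • (opX ξ * opY ξ) :=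
  LinearMap.ext fun s => y_mul_x' hξ s

theorem opY_pow : opY ξ * (opY ξ * (opY ξ * opY ξ)) = 0 := LinearMap.ext fun s => y_pow' s

theorem opA_mul_opX : opA hξ * opX ξ = (-1 : k) • (opX ξ * opA hξ) :=
  LinearMap.ext fun s => (actEntry_x_mul hξ 0 0 s).trans (neg_one_smul k _).symm

theorem opC_mul_opX : opC hξ * opX ξ = (-1 : k) • (opX ξ * opC hξ) :=
  LinearMap.ext fun s => (actEntry_x_mul hξ 1 0 s).trans (neg_one_smul k _).symm

theorem opA_mul_opY : opA hξ * opY ξ = ξ • (opY ξ * opA hξ) + opX ξ * opC hξ :=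
  LinearMap.ext fun s => actEntry_zero_y_mul hξ 0 s

theorem opC_mul_opY : opC hξ * opY ξ = opX ξ * opA hξ + (-ξ) • (opY ξ * opC hξ) :=
  LinearMap.ext fun s => (actEntry_one_y_mul hξ 0 s).trans
    (by rw [sub_eq_add_neg, ← neg_smul]; rfl)

variable (T : Module.End k (B21Alg ξ))

theorem opA_pow' : opA hξ * (opA hξ * (opA hξ * (opA hξ * T))) = T := by
  simpa only [mul_assoc, one_mul] using congrArg (· * T) (opA_pow hξ)

theorem opC_mul_opA' : opC hξ * (opA hξ * T) = (-ξ) • (opA hξ * (opC hξ * T)) := by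
  rw [← mul_assoc, opC_mul_opA, smul_mul_assoc, mul_assoc]

theorem opX_mul_opX' : opX ξ * (opX ξ * T) = 0 := by
  rw [← mul_assoc, opX_mul_opX, zero_mul]

theorem opY_mul_opX' (hξ : IsPrimitiveRoot ξ 4) (T : Module.End k (B21Alg ξ)) :
    opY ξ * (opX ξ * T) = ξ • (opX ξ * (opY ξ * T)) := by
  rw [← mul_assoc, opY_mul_opX hξ, smul_mul_assoc, mul_assoc]

theorem opA_mul_opX' : opA hξ * (opX ξ * T) = (-1 : k) • (opX ξ * (opA hξ * T)) := by
  rw [← mul_assoc, opA_mul_opX, smul_mul_assoc, mul_assoc]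

theorem opC_mul_opX' : opC hξ * (opX ξ * T) = (-1 : k) • (opX ξ * (opC hξ * T)) := by
  rw [← mul_assoc, opC_mul_opX, smul_mul_assoc, mul_assoc]

theorem opA_mul_opY' :
    opA hξ * (opY ξ * T) = ξ • (opY ξ * (opA hξ * T)) + opX ξ * (opC hξ * T) := by
  rw [← mul_assoc, opA_mul_opY, add_mul, smul_mul_assoc, mul_assoc, mul_assoc]

theorem opC_mul_opY' :
    opC hξ * (opY ξ * T) = opX ξ * (opA hξ * T) + (-ξ) • (opY ξ * (opC hξ * T)) := by
  rw [← mul_assoc, opC_mul_opY, add_mul, smul_mul_assoc, mul_assoc, mul_assoc]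

end Operators

/-! ### Definition of the comultiplication. -/

section Comul

/-- Multiplication by `Δ(x)` in the braided tensor product. -/
noncomputable def comulX : Module.End k (B21Alg ξ) ⊗[k] Module.End k (B21Alg ξ) :=
  opX ξ ⊗ₜ 1 + actEntry hξ 1 1 ⊗ₜ opX ξ + (ξ - 1) • actEntry hξ 1 0 ⊗ₜ opY ξ

/-- Multiplication by `Δ(y)` in the braided tensor product. -/
noncomputable def comulY : Module.End k (B21Alg ξ) ⊗[k] Module.End k (B21Alg ξ) :=
  opY ξ ⊗ₜ 1 + actEntry hξ 0 0 ⊗ₜ opY ξ + (-(1 + ξ) / 2) • actEntry hξ 0 1 ⊗ₜ opX ξ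

/-- This identity, `comulX_mul_comulY` and `comulY_pow` are the relations of the algebra for
multiplication by `Δ(x)` and `Δ(y)`. They are proved in an algebra of operators, where associativity
is free. -/
theorem comulX_mul_comulX : comulX hξ * comulX hξ = 0 := by
  have h1 := KAlg.xi_sq hξ
  simp only [comulX, actEntry_one_zero, actEntry_one_one, mul_add, add_mul,
    Algebra.TensorProduct.tmul_mul_tmul, smul_mul_assoc, mul_smul_comm, mul_assoc, mul_one, one_mul,
    opA_pow, opC_mul_opC, opC_mul_opA, opC_mul_opA', opX_mul_opX, opY_mul_opX hξ, opA_mul_opX,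
    opA_mul_opX', opC_mul_opX, TensorProduct.zero_tmul, TensorProduct.tmul_zero, smul_add,
    smul_zero, add_zero, zero_add, TensorProduct.tmul_smul, ← TensorProduct.smul_tmul', smul_smul]
  match_scalars <;> grind

theorem comulX_mul_comulY : comulX hξ * comulY hξ + ξ • (comulY hξ * comulX hξ) = 0 := by
  have h1 := KAlg.xi_sq hξ
  have h2 := two_ne_zero_of_xi hξ
  simp only [comulX, comulY, actEntry_zero_zero, actEntry_zero_one, actEntry_one_zero,
    actEntry_one_one, mul_add, add_mul, Algebra.TensorProduct.tmul_mul_tmul, smul_mul_assoc,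
    mul_smul_comm, mul_assoc, mul_one, one_mul, opA_pow, opA_pow', opC_mul_opC, opC_mul_opA,
    opC_mul_opA', opX_mul_opX, opY_mul_opX hξ, opA_mul_opX, opA_mul_opX', opA_mul_opY, opA_mul_opY',
    opC_mul_opX, opC_mul_opY, TensorProduct.zero_tmul, TensorProduct.tmul_zero,
    TensorProduct.add_tmul, mul_zero, smul_add, smul_zero, add_zero, TensorProduct.tmul_smul,
    ← TensorProduct.smul_tmul', smul_smul]
  match_scalars <;> field_simp <;> grind

/-- Normalizing the square first keeps the expansion of the fourth power manageable. -/
theorem comulY_mul_comulY : comulY hξ * comulY hξ =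
    (opY ξ * opY ξ) ⊗ₜ 1 + (opA hξ * opA hξ) ⊗ₜ (opY ξ * opY ξ) +
    ((1 + ξ) • opY ξ * opA hξ + opX ξ * opC hξ) ⊗ₜ opY ξ +
    (-(1 + ξ) / 2) • ((1 + ξ) • opY ξ * (opA hξ * (opA hξ * opC hξ)) +
      opX ξ * (opA hξ * (opA hξ * opA hξ))) ⊗ₜ opX ξ := by
  have h1 := KAlg.xi_sq hξ
  have h2 := two_ne_zero_of_xi hξ
  simp only [comulY, actEntry_zero_zero, actEntry_zero_one, mul_add, add_mul,
    Algebra.TensorProduct.tmul_mul_tmul, smul_mul_assoc, mul_smul_comm, mul_assoc, mul_one, one_mul,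
    opC_mul_opC, opC_mul_opA, opC_mul_opA', opX_mul_opX, opY_mul_opX hξ, opA_mul_opX', opA_mul_opY,
    opA_mul_opY', opC_mul_opY, TensorProduct.tmul_zero, TensorProduct.add_tmul, mul_zero, smul_add,
    smul_zero, add_zero, TensorProduct.tmul_smul, ← TensorProduct.smul_tmul', smul_smul]
  match_scalars <;> field_simp <;> grind

set_option maxHeartbeats 1000000 in
theorem comulY_pow : comulY hξ ^ 4 = 0 := by
  have h1 := KAlg.xi_sq hξ
  have h2 := two_ne_zero_of_xi hξ
  have e4 : comulY hξ ^ 4 = comulY hξ * comulY hξ * (comulY hξ * comulY hξ) := by noncomm_ring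
  rw [e4, comulY_mul_comulY]
  simp only [mul_add, add_mul, Algebra.TensorProduct.tmul_mul_tmul, smul_mul_assoc, mul_smul_comm,
    mul_assoc, mul_one, one_mul, opA_pow, opA_pow', opC_mul_opC, opC_mul_opA, opC_mul_opA',
    opX_mul_opX, opX_mul_opX', opY_mul_opX hξ, opY_mul_opX' hξ, opA_mul_opX, opA_mul_opX',
    opA_mul_opY, opA_mul_opY', opC_mul_opX', opC_mul_opY, opC_mul_opY', opY_pow,
    TensorProduct.zero_tmul, TensorProduct.tmul_zero, TensorProduct.add_tmul, mul_zero, smul_add,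
    smul_zero, add_zero, zero_add, TensorProduct.tmul_smul, ← TensorProduct.smul_tmul', smul_smul]
  match_scalars <;> field_simp <;> grind

/-- The algebra map sending `r` to the multiplication by `Δ(r)` in the braided tensor product. -/
noncomputable def comulMul : B21Alg ξ →ₐ[k] Module.End k (B21Alg ξ ⊗[k] B21Alg ξ) :=
  Module.endTensorEndAlgHom.comp
    (lift (comulX hξ) (comulY hξ) (comulX_mul_comulX hξ) (comulX_mul_comulY hξ) (comulY_pow hξ))

/-- The comultiplication of `B21`. -/
noncomputable def comul : B21Alg ξ →ₗ[k] B21Alg ξ ⊗[k] B21Alg ξ :=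
  (comulMul hξ).toLinearMap.flip (1 ⊗ₜ 1)

theorem comulMul_x : comulMul hξ (x ξ) = TensorProduct.map (opX ξ) LinearMap.id +
    TensorProduct.map (actEntry hξ 1 1) (opX ξ) +
    (ξ - 1) • TensorProduct.map (actEntry hξ 1 0) (opY ξ) := by
  simp [comulMul, comulX, Module.endTensorEndAlgHom_apply,
    TensorProduct.AlgebraTensorModule.map_eq, Module.End.one_eq_id]

theorem comulMul_y : comulMul hξ (y ξ) = TensorProduct.map (opY ξ) LinearMap.id +
    TensorProduct.map (actEntry hξ 0 0) (opY ξ) +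
    (-(1 + ξ) / 2) • TensorProduct.map (actEntry hξ 0 1) (opX ξ) := by
  simp [comulMul, comulY, Module.endTensorEndAlgHom_apply,
    TensorProduct.AlgebraTensorModule.map_eq, Module.End.one_eq_id]

theorem comul_one : comul hξ 1 = 1 ⊗ₜ 1 := by simp [comul]

theorem comul_x_mul (s : B21Alg ξ) : comul hξ (x ξ * s) = comulMul hξ (x ξ) (comul hξ s) := by
  simp [comul]

theorem comul_y_mul (s : B21Alg ξ) : comul hξ (y ξ * s) = comulMul hξ (y ξ) (comul hξ s) := by
  simp [comul]

end Comul

end B21Alg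

/-! ### Tools for linearity and colinearity. -/

section YetterDrinfeld

variable {k : Type u} {H : Type v} [CommRing k] [Ring H] [HopfAlgebra k H]
  {M : Type w} {N : Type x} [AddCommGroup M] [Module k M] [AddCommGroup N] [Module k N]

/-- The diagonal action as an algebra map. -/
noncomputable def ydTensorActHom (X : YDModule k H M) (Y : YDModule k H N) :
    H →ₐ[k] Module.End k (M ⊗[k] N) :=
  AlgHom.ofLinearMap (ydTensorAct X Y)
    (by simpa using ydTensorAct_algebraMap X Y 1) (ydTensorAct_mul X Y)

variable (k H) in
/-- The trivial action, through the counit. -/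
noncomputable def counitAct : H →ₐ[k] Module.End k k :=
  (Algebra.ofId k _).comp (Bialgebra.counitAlgHom k H)

theorem counitAct_apply (h : H) (r : k) :
    counitAct k H h r = Coalgebra.counit (R := k) h * r := by
  simp [counitAct, Algebra.ofId_apply]

/-- The map `(h ⊗ m) ⊗ (g ⊗ n) ↦ h g ⊗ (m ⊗ n)`. -/
noncomputable def codiagonal : (H ⊗[k] M) ⊗[k] (H ⊗[k] N) →ₗ[k] H ⊗[k] (M ⊗[k] N) :=
  (LinearMap.mul' k H).rTensor (M ⊗[k] N)
    ∘ₗ (TensorProduct.tensorTensorTensorComm k H M H N).toLinearMap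

theorem codiagonal_tmul (h g : H) (m : M) (n : N) :
    codiagonal ((h ⊗ₜ[k] m) ⊗ₜ[k] (g ⊗ₜ[k] n)) = (h * g) ⊗ₜ (m ⊗ₜ n) := by
  simp [codiagonal]

theorem ydTensorCoact_tmul (X : YDModule k H M) (Y : YDModule k H N) (m : M) (n : N) :
    ydTensorCoact X Y (m ⊗ₜ n) = codiagonal (X.coact m ⊗ₜ Y.coact n) := rfl

/-- Associativity in `H`: the leg `g` may be counted with either factor. Moved to the first one, it
produces the products `δ(t i l · p) * t l j` to which `coact_actEntry_mul` applies. -/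
theorem codiagonal_mul_tmul {A B : Type*} [Ring A] [Algebra k A] [Ring B] [Algebra k B]
    (P : H ⊗[k] A) (g : H) (s : B) (W : H ⊗[k] B) :
    codiagonal (P ⊗ₜ[k] (g ⊗ₜ s * W)) = codiagonal ((P * g ⊗ₜ 1) ⊗ₜ[k] (1 ⊗ₜ s * W)) := by
  induction P with
  | zero => simp
  | add P Q hP hQ => simp only [TensorProduct.add_tmul, map_add, add_mul, hP, hQ]
  | tmul h t =>
    induction W with
    | zero => simp
    | add P Q hP hQ => simp only [TensorProduct.tmul_add, map_add, mul_add, hP, hQ]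
    | tmul h' t' => simp [codiagonal_tmul, mul_assoc]

end YetterDrinfeld

section KAlg

variable {k : Type u} [Field k] {ξ : k} {hξ : IsPrimitiveRoot ξ 4}
  {M : Type w} {N : Type x} [AddCommGroup M] [Module k M] [AddCommGroup N] [Module k N]

open KAlg (genMatrix)

/-- A linear map that commutes with the action of the generators of `K` is `K`-linear. -/
theorem KAlg.map_act (ρ : KAlg hξ →ₐ[k] Module.End k M) (σ : KAlg hξ →ₐ[k] Module.End k N)
    (f : M →ₗ[k] N)
    (hf : ∀ i j m, f (ρ (genMatrix hξ i j) m) = σ (genMatrix hξ i j) (f m))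
    (h : KAlg hξ) (m : M) : f (ρ h m) = σ h (f m) := by
  induction h using KAlg.induction_genMatrix generalizing m with
  | hs r => simp
  | hg i j => exact hf i j m
  | hm x y hx hy => simp only [map_mul, Module.End.mul_apply, hx, hy]
  | ha x y hx hy => simp only [map_add, LinearMap.add_apply, hx, hy]

end KAlg

/-! ### The counit, and compatibility of unit and product with `K`. -/

namespace B21Alg

variable {k : Type u} [Field k] {ξ : k} (hξ : IsPrimitiveRoot ξ 4)

open KAlg (genMatrix)

/-- The counit of `B21`. -/
noncomputable def counit (ξ : k) : B21Alg ξ →ₐ[k] k := lift 0 0 (by simp) (by simp) (by simp)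

theorem counit_x : counit ξ (x ξ) = 0 := lift_x ..

theorem counit_y : counit ξ (y ξ) = 0 := lift_y ..

theorem counit_actEntry (i j : Fin 2) (r : B21Alg ξ) :
    counit ξ (actEntry hξ i j r) = (1 : Matrix (Fin 2) (Fin 2) k) i j * counit ξ r := by
  induction r using B21Alg.induction generalizing i j with
  | one => fin_cases i <;> fin_cases j <;> simp [actEntry_one]
  | smul c s hs => simp only [map_smul, hs, smul_eq_mul, mul_left_comm]
  | add s t hs ht => simp only [map_add, hs, ht, mul_add]
  | x_mul s hs => simp [actEntry_x_mul, counit_x]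
  | y_mul s hs =>
    fin_cases i <;> simp [actEntry_zero_y_mul, actEntry_one_y_mul, counit_x, counit_y]

theorem counit_act (h : KAlg hξ) (r : B21Alg ξ) :
    counit ξ (act hξ h r) = Coalgebra.counit (R := k) h * counit ξ r := by
  rw [← counitAct_apply]
  refine KAlg.map_act (act hξ) (counitAct k _) (counit ξ).toLinearMap (fun i j m => ?_) h r
  rw [counitAct_apply, KAlg.counit_genMatrix, act_genMatrix]
  exact counit_actEntry hξ i j m

theorem counit_coact (r : B21Alg ξ) :
    (counit ξ).toLinearMap.lTensor (KAlg hξ) (coact hξ r) = 1 ⊗ₜ[k] counit ξ r := by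
  let f : B21Alg ξ →ₐ[k] KAlg hξ ⊗[k] k :=
    (Algebra.TensorProduct.map (AlgHom.id k _) (counit ξ)).comp (coact hξ)
  let g : B21Alg ξ →ₐ[k] KAlg hξ ⊗[k] k :=
    Algebra.TensorProduct.includeRight.comp (counit ξ)
  have hfg : f = g := by
    apply algHom_ext <;>
      simp [f, g, coact_x, coact_y, coactX, coactY, counit_x, counit_y]
  exact AlgHom.congr_fun hfg r

theorem act_one (h : KAlg hξ) :
    act hξ h 1 = Coalgebra.counit (R := k) h • (1 : B21Alg ξ) := by
  -- This is `K`-linearity of the unit map `k → B`, evaluated at `1`.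
  have key := KAlg.map_act (counitAct k _) (act hξ) (Algebra.linearMap k (B21Alg ξ))
    (fun i j m => by
      rw [counitAct_apply, KAlg.counit_genMatrix, act_genMatrix]
      fin_cases i <;> fin_cases j <;>
        simp [Algebra.algebraMap_eq_smul_one, actEntry_one]) h 1
  rw [counitAct_apply] at key
  simpa [Algebra.algebraMap_eq_smul_one] using key.symm

theorem act_mul (h : KAlg hξ) (z : B21Alg ξ ⊗[k] B21Alg ξ) :
    act hξ h (LinearMap.mul' k _ z) =
      LinearMap.mul' k _ (ydTensorAct (ydModule hξ) (ydModule hξ) h z) := by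
  refine (KAlg.map_act (ydTensorActHom (ydModule hξ) (ydModule hξ)) (act hξ)
    (LinearMap.mul' k _) (fun i j z => ?_) h z).symm
  change LinearMap.mul' k _ (ydTensorAct (ydModule hξ) (ydModule hξ) _ z) = _
  rw [ydTensorAct_genMatrix, act_genMatrix]
  induction z with
  | zero => simp
  | add z w hz hw => simp only [map_add, hz, hw]
  | tmul r s =>
    simp [actEntry_mul, ydModule, act_genMatrix]

theorem coact_mul (z : B21Alg ξ ⊗[k] B21Alg ξ) :
    coact hξ (LinearMap.mul' k _ z) =
      (LinearMap.mul' k _).lTensor _ (ydTensorCoact (ydModule hξ) (ydModule hξ) z) := by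
  induction z with
  | zero => simp
  | add z w hz hw => simp only [map_add, hz, hw]
  | tmul r s =>
    rw [ydTensorCoact_tmul, LinearMap.mul'_apply, map_mul]
    change coact hξ r * coact hξ s = LinearMap.lTensor _ _ (codiagonal (coact hξ r ⊗ₜ coact hξ s))
    generalize coact hξ r = u
    generalize coact hξ s = v
    induction u with
    | zero => simp
    | add z w hz hw => simp only [map_add, add_mul, TensorProduct.add_tmul, hz, hw]
    | tmul h t =>
      induction v with
      | zero => simp
      | add z w hz hw => simp only [map_add, mul_add, TensorProduct.tmul_add, hz, hw]
      | tmul h' t' => simp [codiagonal_tmul]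

/-! ### The comultiplication is `K`-linear and multiplicative. -/

section Comul

variable (ξ) in
/-- The algebra map from `End B21 ⊗ End B21` to `End (B21 ⊗ B21)`. -/
noncomputable def endHom : Module.End k (B21Alg ξ) ⊗[k] Module.End k (B21Alg ξ) →ₐ[k]
    Module.End k (B21Alg ξ ⊗[k] B21Alg ξ) :=
  Module.endTensorEndAlgHom

theorem comulMul_x_eq : comulMul hξ (x ξ) = endHom ξ (comulX hξ) := by
  simp [comulMul, endHom]

theorem comulMul_y_eq : comulMul hξ (y ξ) = endHom ξ (comulY hξ) := by
  simp [comulMul, endHom]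

/-- The action of the entries of `genMatrix` on `B21 ⊗ B21`. -/
noncomputable def diagEntry (i j : Fin 2) :
    Module.End k (B21Alg ξ) ⊗[k] Module.End k (B21Alg ξ) :=
  actEntry hξ i 0 ⊗ₜ actEntry hξ 0 j + actEntry hξ i 1 ⊗ₜ actEntry hξ 1 j

theorem endTensorEnd_diagEntry (i j : Fin 2) :
    endHom ξ (diagEntry hξ i j) =
      ydTensorAct (ydModule hξ) (ydModule hξ) (genMatrix hξ i j) := by
  rw [ydTensorAct_genMatrix, Fin.sum_univ_two]
  simp [endHom, diagEntry, Module.endTensorEndAlgHom_apply,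
    TensorProduct.AlgebraTensorModule.map_eq, ydModule, act_genMatrix]

-- Multiplication by `Δ(x)` commutes with the diagonal action by the rule `actEntry_x_mul` that left
-- multiplication by `x` obeys for the action. The next two lemmas do the same for `Δ(y)`. With
-- matching rules on both sides, linearity of the comultiplication is an induction.
set_option maxHeartbeats 1000000 in
theorem diagEntry_mul_comulX (i j : Fin 2) :
    diagEntry hξ i j * comulX hξ = (-1 : k) • (comulX hξ * diagEntry hξ i j) := by
  have h1 := KAlg.xi_sq hξ
  fin_cases i <;> fin_cases j <;>
  simp only [diagEntry, Fin.zero_eta, Fin.mk_one, Fin.isValue, comulX, actEntry_zero_zero,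
    actEntry_zero_one, actEntry_one_zero, actEntry_one_one, mul_add, add_mul,
    Algebra.TensorProduct.tmul_mul_tmul, smul_mul_assoc, mul_smul_comm, mul_assoc, mul_one, one_mul,
    opA_pow, opA_pow', opC_mul_opC, opC_mul_opA, opC_mul_opA', opA_mul_opX, opA_mul_opX',
    opA_mul_opY, opA_mul_opY', opC_mul_opX, opC_mul_opY, TensorProduct.zero_tmul,
    TensorProduct.tmul_add, mul_zero, smul_add, smul_zero, add_zero, zero_add,
    TensorProduct.tmul_smul, ← TensorProduct.smul_tmul', smul_smul] <;>
  match_scalars <;> grind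

set_option maxHeartbeats 1000000 in
theorem diagEntry_zero_mul_comulY (j : Fin 2) :
    diagEntry hξ 0 j * comulY hξ =
      ξ • (comulY hξ * diagEntry hξ 0 j) + comulX hξ * diagEntry hξ 1 j := by
  have h1 := KAlg.xi_sq hξ
  have h2 := two_ne_zero_of_xi hξ
  fin_cases j <;>
  simp only [diagEntry, Fin.zero_eta, Fin.mk_one, Fin.isValue, comulX, comulY, actEntry_zero_zero,
    actEntry_zero_one, actEntry_one_zero, actEntry_one_one, mul_add, add_mul,
    Algebra.TensorProduct.tmul_mul_tmul, smul_mul_assoc, mul_smul_comm, mul_assoc, mul_one, one_mul,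
    opA_pow, opC_mul_opC, opC_mul_opA, opC_mul_opA', opA_mul_opX, opA_mul_opX', opA_mul_opY,
    opA_mul_opY', opC_mul_opX, opC_mul_opY, TensorProduct.zero_tmul, TensorProduct.add_tmul,
    TensorProduct.tmul_add, mul_zero, smul_add, smul_zero, add_zero, TensorProduct.tmul_smul,
    ← TensorProduct.smul_tmul', smul_smul] <;>
  match_scalars <;> field_simp <;> grind

set_option maxHeartbeats 1000000 in
theorem diagEntry_one_mul_comulY (j : Fin 2) :
    diagEntry hξ 1 j * comulY hξ =
      comulX hξ * diagEntry hξ 0 j + (-ξ) • (comulY hξ * diagEntry hξ 1 j) := by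
  have h1 := KAlg.xi_sq hξ
  have h2 := two_ne_zero_of_xi hξ
  fin_cases j <;>
  simp only [diagEntry, Fin.zero_eta, Fin.mk_one, Fin.isValue, comulX, comulY, actEntry_zero_zero,
    actEntry_zero_one, actEntry_one_zero, actEntry_one_one, mul_add, add_mul,
    Algebra.TensorProduct.tmul_mul_tmul, smul_mul_assoc, mul_smul_comm, mul_assoc, mul_one, one_mul,
    opA_pow, opA_pow', opC_mul_opC, opC_mul_opA, opC_mul_opA', opA_mul_opX, opA_mul_opX',
    opA_mul_opY, opA_mul_opY', opC_mul_opX, opC_mul_opY, TensorProduct.zero_tmul,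
    TensorProduct.add_tmul, TensorProduct.tmul_add, mul_zero, smul_add, smul_zero, add_zero,
    zero_add, TensorProduct.tmul_smul, ← TensorProduct.smul_tmul', smul_smul] <;>
  match_scalars <;> field_simp <;> grind

theorem comul_actEntry (i j : Fin 2) (r : B21Alg ξ) :
    comul hξ (actEntry hξ i j r) = endHom ξ (diagEntry hξ i j) (comul hξ r) := by
  induction r using B21Alg.induction generalizing i j with
  | one =>
    fin_cases i <;> fin_cases j <;>
      simp [actEntry_one, comul_one, diagEntry, endHom, Module.endTensorEndAlgHom_apply]
  | smul c s hs => simp only [map_smul, hs]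
  | add s t hs ht => simp only [map_add, hs, ht]
  | x_mul s hs =>
    rw [actEntry_x_mul, map_neg, comul_x_mul, comul_x_mul, hs, comulMul_x_eq,
      ← Module.End.mul_apply, ← Module.End.mul_apply, ← map_mul, ← map_mul, diagEntry_mul_comulX,
      map_smul, LinearMap.smul_apply, neg_one_smul]
  | y_mul s hs =>
    fin_cases i
    · change comul hξ (actEntry hξ 0 j _) = endHom ξ (diagEntry hξ 0 j) _
      rw [actEntry_zero_y_mul, map_add, map_smul, comul_x_mul, comul_y_mul, comul_y_mul, hs, hs,
        comulMul_x_eq, comulMul_y_eq, ← Module.End.mul_apply, ← Module.End.mul_apply,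
        ← Module.End.mul_apply, ← map_mul, ← map_mul, ← map_mul, diagEntry_zero_mul_comulY,
        map_add, map_smul, LinearMap.add_apply, LinearMap.smul_apply]
    · change comul hξ (actEntry hξ 1 j _) = endHom ξ (diagEntry hξ 1 j) _
      rw [actEntry_one_y_mul, map_sub, map_smul, comul_x_mul, comul_y_mul, comul_y_mul, hs, hs,
        comulMul_x_eq, comulMul_y_eq, ← Module.End.mul_apply, ← Module.End.mul_apply,
        ← Module.End.mul_apply, ← map_mul, ← map_mul, ← map_mul, diagEntry_one_mul_comulY,
        map_add, map_smul, LinearMap.add_apply, LinearMap.smul_apply, neg_smul, sub_eq_add_neg]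

theorem comul_act (h : KAlg hξ) (r : B21Alg ξ) :
    comul hξ (act hξ h r) = ydTensorAct (ydModule hξ) (ydModule hξ) h (comul hξ r) := by
  refine KAlg.map_act (act hξ) (ydTensorActHom (ydModule hξ) (ydModule hξ)) (comul hξ)
    (fun i j m => ?_) h r
  rw [act_genMatrix, comul_actEntry, endTensorEnd_diagEntry]
  rfl

/-- The two scalars in the coaction of `V_{2,1}` are inverse to each other. Coassociativity forces
this: in `δ(e₁)` the term `c ⊗ b ⊗ e₁` must have coefficient 1, as in `Δ(d)`. -/
theorem xi_sub_one_mul {ξ : k} (hξ : IsPrimitiveRoot ξ 4) : (ξ - 1) * (-(1 + ξ) / 2) = 1 := by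
  have h1 := KAlg.xi_sq hξ
  have h2 := two_ne_zero_of_xi hξ
  field_simp
  linear_combination -h1

/-- This is the only part of associativity of the braided product that is needed: the leftmost
factor is `Δ(x)`. It rests on the coaction being multiplicative and on the module algebra axiom. -/
theorem braidedTensorMul_comulMul_x (u v : B21Alg ξ ⊗[k] B21Alg ξ) :
    braidedTensorMul (ydModule hξ) (comulMul hξ (x ξ) u ⊗ₜ v) =
      comulMul hξ (x ξ) (braidedTensorMul (ydModule hξ) (u ⊗ₜ v)) := by
  have h3 := xi_sub_one_mul hξ
  induction v with
  | zero => simp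
  | add z w hz hw => simp only [map_add, TensorProduct.tmul_add, hz, hw]
  | tmul p' q' =>
  induction u with
  | zero => simp
  | add z w hz hw => simp only [map_add, TensorProduct.add_tmul, hz, hw]
  | tmul p q =>
    simp only [comulMul_x, LinearMap.add_apply, LinearMap.smul_apply, TensorProduct.map_tmul,
      opX_apply, opY_apply, LinearMap.id_apply, TensorProduct.add_tmul, map_add, map_smul,
      ← TensorProduct.smul_tmul', braidedTensorMul_tmul]
    simp only [ydModule, AlgHom.toLinearMap_apply, map_mul, coact_x, coact_y]
    -- Both sides are linear in the coaction of `q`, so it may be replaced by a pure tensor.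
    generalize coact hξ q = w
    induction w with
    | zero => simp
    | add z w hz hw =>
      simp only [mul_add, map_add, smul_add] at hz hw ⊢
      linear_combination (norm := module) hz + hw
    | tmul h t =>
      have eij : ∀ g, act hξ (KAlg.gen hξ g * h) = actGen hξ g * act hξ h := fun g => by
        rw [map_mul, act_gen]
      simp only [coactX, coactY, add_mul, smul_mul_assoc, Algebra.TensorProduct.tmul_mul_tmul,
        map_add, map_smul, TensorProduct.map_tmul, LinearMap.comp_apply, LinearMap.flip_apply,
        AlgHom.toLinearMap_apply, eij, actGen, Module.End.mul_apply, LinearMap.mulLeft_apply,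
        LinearMap.mulRight_apply, opX_apply, opY_apply, LinearMap.id_apply, actEntry_mul,
        Fin.sum_univ_two, mul_assoc, TensorProduct.add_tmul, smul_add, smul_smul,
        h3]
      module

theorem braidedTensorMul_comulMul_y (u v : B21Alg ξ ⊗[k] B21Alg ξ) :
    braidedTensorMul (ydModule hξ) (comulMul hξ (y ξ) u ⊗ₜ v) =
      comulMul hξ (y ξ) (braidedTensorMul (ydModule hξ) (u ⊗ₜ v)) := by
  have h3 := (mul_comm _ _).trans (xi_sub_one_mul hξ)
  induction v with
  | zero => simp
  | add z w hz hw => simp only [map_add, TensorProduct.tmul_add, hz, hw]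
  | tmul p' q' =>
  induction u with
  | zero => simp
  | add z w hz hw => simp only [map_add, TensorProduct.add_tmul, hz, hw]
  | tmul p q =>
    simp only [comulMul_y, LinearMap.add_apply, LinearMap.smul_apply, TensorProduct.map_tmul,
      opX_apply, opY_apply, LinearMap.id_apply, TensorProduct.add_tmul, map_add, map_smul,
      ← TensorProduct.smul_tmul', braidedTensorMul_tmul]
    simp only [ydModule, AlgHom.toLinearMap_apply, map_mul, coact_x, coact_y]
    generalize coact hξ q = w
    induction w with
    | zero => simp
    | add z w hz hw =>
      simp only [mul_add, map_add, smul_add] at hz hw ⊢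
      linear_combination (norm := module) hz + hw
    | tmul h t =>
      have eij : ∀ g, act hξ (KAlg.gen hξ g * h) = actGen hξ g * act hξ h := fun g => by
        rw [map_mul, act_gen]
      simp only [coactX, coactY, add_mul, smul_mul_assoc, Algebra.TensorProduct.tmul_mul_tmul,
        map_add, map_smul, TensorProduct.map_tmul, LinearMap.comp_apply, LinearMap.flip_apply,
        AlgHom.toLinearMap_apply, eij, actGen, Module.End.mul_apply, LinearMap.mulLeft_apply,
        LinearMap.mulRight_apply, opX_apply, opY_apply, LinearMap.id_apply, actEntry_mul,
        Fin.sum_univ_two, mul_assoc, TensorProduct.add_tmul, smul_add, smul_smul,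
        h3]
      module

theorem braidedTensorMul_one_tmul (v : B21Alg ξ ⊗[k] B21Alg ξ) :
    braidedTensorMul (ydModule hξ) ((1 ⊗ₜ 1) ⊗ₜ v) = v := by
  induction v with
  | zero => simp
  | add z w hz hw => simp only [map_add, TensorProduct.tmul_add, hz, hw]
  | tmul p q =>
    simp [braidedTensorMul_tmul, ydModule, Algebra.TensorProduct.one_def]

theorem comul_mul (r s : B21Alg ξ) :
    comul hξ (r * s) = braidedTensorMul (ydModule hξ) (comul hξ r ⊗ₜ comul hξ s) := by
  induction r using B21Alg.induction with
  | one => rw [one_mul, comul_one, braidedTensorMul_one_tmul]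
  | smul c s hs => simp only [smul_mul_assoc, map_smul, hs, ← TensorProduct.smul_tmul']
  | add s t hs ht => simp only [add_mul, map_add, hs, ht, TensorProduct.add_tmul]
  | x_mul s hs => rw [mul_assoc, comul_x_mul, hs, comul_x_mul, braidedTensorMul_comulMul_x]
  | y_mul s hs => rw [mul_assoc, comul_y_mul, hs, comul_y_mul, braidedTensorMul_comulMul_y]

end Comul

end B21Alg

namespace B21Alg

variable {k : Type u} [Field k] {ξ : k} (hξ : IsPrimitiveRoot ξ 4)

open KAlg (genMatrix)

/-! ### Coassociativity, counit laws and colinearity of the comultiplication. -/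

section Comul

/-- The operator on the right is multiplication by the iterated comultiplication of `x`.
`lTensor_comul_comulMul_x` finds the same operator for the other bracketing, so coassociativity
propagates from `1`. Here linearity of `comul` (`comul_actEntry`) is used; there it is not. -/
theorem coassoc_comulMul_x (u : B21Alg ξ ⊗[k] B21Alg ξ) :
    TensorProduct.assoc k _ _ _ ((comul hξ).rTensor _ (comulMul hξ (x ξ) u)) =
      ((TensorProduct.map (opX ξ) LinearMap.id +
        TensorProduct.map (actEntry hξ 1 1) (comulMul hξ (x ξ)) +
        (ξ - 1) • TensorProduct.map (actEntry hξ 1 0) (comulMul hξ (y ξ)))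
          : Module.End k (B21Alg ξ ⊗[k] (B21Alg ξ ⊗[k] B21Alg ξ)))
        (TensorProduct.assoc k _ _ _ ((comul hξ).rTensor _ u)) := by
  have h3 := xi_sub_one_mul hξ
  induction u with
  | zero => simp
  | add z w hz hw => simp only [map_add, hz, hw]
  | tmul p q =>
    rw [comulMul_x]
    simp only [LinearMap.add_apply, LinearMap.smul_apply, TensorProduct.map_tmul,
      LinearMap.id_apply, map_add, map_smul, LinearMap.rTensor_tmul, comul_actEntry]
    rw [opX_apply p, comul_x_mul]
    generalize comul hξ p = w
    induction w with
    | zero => simp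
    | add z w hz hw =>
      simp only [map_add, smul_add, TensorProduct.add_tmul] at hz hw ⊢
      linear_combination (norm := module) hz + hw
    | tmul h t =>
      simp only [comulMul_x, comulMul_y, endHom, diagEntry, LinearMap.add_apply,
        LinearMap.smul_apply, TensorProduct.map_tmul, map_add, map_smul,
        Module.endTensorEndAlgHom_apply, TensorProduct.AlgebraTensorModule.map_eq,
        LinearMap.id_apply, TensorProduct.assoc_tmul, TensorProduct.add_tmul,
        TensorProduct.tmul_add, TensorProduct.tmul_smul, ← TensorProduct.smul_tmul', smul_add,
        smul_smul, h3]
      module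

theorem coassoc_comulMul_y (u : B21Alg ξ ⊗[k] B21Alg ξ) :
    TensorProduct.assoc k _ _ _ ((comul hξ).rTensor _ (comulMul hξ (y ξ) u)) =
      ((TensorProduct.map (opY ξ) LinearMap.id +
        TensorProduct.map (actEntry hξ 0 0) (comulMul hξ (y ξ)) +
        (-(1 + ξ) / 2) • TensorProduct.map (actEntry hξ 0 1) (comulMul hξ (x ξ)))
          : Module.End k (B21Alg ξ ⊗[k] (B21Alg ξ ⊗[k] B21Alg ξ)))
        (TensorProduct.assoc k _ _ _ ((comul hξ).rTensor _ u)) := by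
  have h3 := (mul_comm _ _).trans (xi_sub_one_mul hξ)
  induction u with
  | zero => simp
  | add z w hz hw => simp only [map_add, hz, hw]
  | tmul p q =>
    rw [comulMul_y]
    simp only [LinearMap.add_apply, LinearMap.smul_apply, TensorProduct.map_tmul,
      LinearMap.id_apply, map_add, map_smul, LinearMap.rTensor_tmul, comul_actEntry]
    rw [opY_apply p, comul_y_mul]
    generalize comul hξ p = w
    induction w with
    | zero => simp
    | add z w hz hw =>
      simp only [map_add, smul_add, TensorProduct.add_tmul] at hz hw ⊢
      linear_combination (norm := module) hz + hw
    | tmul h t =>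
      simp only [comulMul_x, comulMul_y, endHom, diagEntry, LinearMap.add_apply,
        LinearMap.smul_apply, TensorProduct.map_tmul, map_add, map_smul,
        Module.endTensorEndAlgHom_apply, TensorProduct.AlgebraTensorModule.map_eq,
        LinearMap.id_apply, TensorProduct.assoc_tmul, TensorProduct.add_tmul,
        TensorProduct.tmul_add, TensorProduct.tmul_smul, ← TensorProduct.smul_tmul', smul_add,
        smul_smul, h3]
      module

theorem lTensor_comul_comulMul_x (u : B21Alg ξ ⊗[k] B21Alg ξ) :
    (comul hξ).lTensor _ (comulMul hξ (x ξ) u) =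
      ((TensorProduct.map (opX ξ) LinearMap.id +
        TensorProduct.map (actEntry hξ 1 1) (comulMul hξ (x ξ)) +
        (ξ - 1) • TensorProduct.map (actEntry hξ 1 0) (comulMul hξ (y ξ)))
          : Module.End k (B21Alg ξ ⊗[k] (B21Alg ξ ⊗[k] B21Alg ξ)))
        ((comul hξ).lTensor _ u) := by
  induction u with
  | zero => simp
  | add z w hz hw => simp only [map_add, hz, hw]
  | tmul p q =>
    rw [comulMul_x]
    simp [opX_apply q, opY_apply q, comul_x_mul, comul_y_mul, comulMul_x]

theorem lTensor_comul_comulMul_y (u : B21Alg ξ ⊗[k] B21Alg ξ) :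
    (comul hξ).lTensor _ (comulMul hξ (y ξ) u) =
      ((TensorProduct.map (opY ξ) LinearMap.id +
        TensorProduct.map (actEntry hξ 0 0) (comulMul hξ (y ξ)) +
        (-(1 + ξ) / 2) • TensorProduct.map (actEntry hξ 0 1) (comulMul hξ (x ξ)))
          : Module.End k (B21Alg ξ ⊗[k] (B21Alg ξ ⊗[k] B21Alg ξ)))
        ((comul hξ).lTensor _ u) := by
  induction u with
  | zero => simp
  | add z w hz hw => simp only [map_add, hz, hw]
  | tmul p q =>
    rw [comulMul_y]
    simp [opX_apply q, opY_apply q, comul_x_mul, comul_y_mul, comulMul_y]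

theorem comul_coassoc :
    (TensorProduct.assoc k _ _ _).toLinearMap ∘ₗ (comul hξ).rTensor _ ∘ₗ comul hξ =
      (comul hξ).lTensor (B21Alg ξ) ∘ₗ comul hξ := by
  apply linearMap_ext
  · simp [comul_one]
  · intro s hs
    simp only [LinearMap.comp_apply, LinearEquiv.coe_coe] at hs ⊢
    rw [comul_x_mul, coassoc_comulMul_x, lTensor_comul_comulMul_x, hs]
  · intro s hs
    simp only [LinearMap.comp_apply, LinearEquiv.coe_coe] at hs ⊢
    rw [comul_y_mul, coassoc_comulMul_y, lTensor_comul_comulMul_y, hs]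

/-- The counit kills `x p` and `c · p` and does not see the action of `d`, so only the summand with
`x` on the right factor survives. -/
theorem rTensor_counit_comulMul_x (u : B21Alg ξ ⊗[k] B21Alg ξ) :
    (counit ξ).toLinearMap.rTensor _ (comulMul hξ (x ξ) u) =
      (opX ξ).lTensor _ ((counit ξ).toLinearMap.rTensor _ u) := by
  induction u with
  | zero => simp
  | add z w hz hw => simp only [map_add, hz, hw]
  | tmul p q => simp [comulMul_x, opX_apply p, counit_x, counit_actEntry]

theorem rTensor_counit_comulMul_y (u : B21Alg ξ ⊗[k] B21Alg ξ) :
    (counit ξ).toLinearMap.rTensor _ (comulMul hξ (y ξ) u) =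
      (opY ξ).lTensor _ ((counit ξ).toLinearMap.rTensor _ u) := by
  induction u with
  | zero => simp
  | add z w hz hw => simp only [map_add, hz, hw]
  | tmul p q => simp [comulMul_y, opY_apply p, counit_y, counit_actEntry]

theorem lTensor_counit_comulMul_x (u : B21Alg ξ ⊗[k] B21Alg ξ) :
    (counit ξ).toLinearMap.lTensor _ (comulMul hξ (x ξ) u) =
      (opX ξ).rTensor _ ((counit ξ).toLinearMap.lTensor _ u) := by
  induction u with
  | zero => simp
  | add z w hz hw => simp only [map_add, hz, hw]
  | tmul p q => simp [comulMul_x, opX_apply q, opY_apply q, counit_x, counit_y]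

theorem lTensor_counit_comulMul_y (u : B21Alg ξ ⊗[k] B21Alg ξ) :
    (counit ξ).toLinearMap.lTensor _ (comulMul hξ (y ξ) u) =
      (opY ξ).rTensor _ ((counit ξ).toLinearMap.lTensor _ u) := by
  induction u with
  | zero => simp
  | add z w hz hw => simp only [map_add, hz, hw]
  | tmul p q => simp [comulMul_y, opX_apply q, opY_apply q, counit_x, counit_y]

theorem rTensor_counit_comul :
    (counit ξ).toLinearMap.rTensor (B21Alg ξ) ∘ₗ comul hξ = TensorProduct.mk k _ _ 1 := by
  apply linearMap_ext
  · simp [comul_one]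
  · intro s hs
    simp only [LinearMap.comp_apply] at hs ⊢
    rw [comul_x_mul, rTensor_counit_comulMul_x, hs]
    simp [opX_apply]
  · intro s hs
    simp only [LinearMap.comp_apply] at hs ⊢
    rw [comul_y_mul, rTensor_counit_comulMul_y, hs]
    simp [opY_apply]

theorem lTensor_counit_comul :
    (counit ξ).toLinearMap.lTensor (B21Alg ξ) ∘ₗ comul hξ = (TensorProduct.mk k _ _).flip 1 := by
  apply linearMap_ext
  · simp [comul_one]
  · intro s hs
    simp only [LinearMap.comp_apply] at hs ⊢
    rw [comul_x_mul, lTensor_counit_comulMul_x, hs]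
    simp [opX_apply]
  · intro s hs
    simp only [LinearMap.comp_apply] at hs ⊢
    rw [comul_y_mul, lTensor_counit_comulMul_y, hs]
    simp [opY_apply]

theorem lTensor_comul_coactX_mul (w : KAlg hξ ⊗[k] B21Alg ξ) :
    (comul hξ).lTensor _ (coactX hξ * w) =
      (TensorProduct.map (LinearMap.mulLeft k (KAlg.d hξ)) (comulMul hξ (x ξ)) +
        (ξ - 1) • TensorProduct.map (LinearMap.mulLeft k (KAlg.c hξ)) (comulMul hξ (y ξ)))
        ((comul hξ).lTensor _ w) := by
  induction w with
  | zero => simp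
  | add z w hz hw => simp only [map_add, mul_add, hz, hw]
  | tmul h t => simp [coactX, add_mul, comul_x_mul, comul_y_mul]

theorem lTensor_comul_coactY_mul (w : KAlg hξ ⊗[k] B21Alg ξ) :
    (comul hξ).lTensor _ (coactY hξ * w) =
      (TensorProduct.map (LinearMap.mulLeft k (KAlg.a hξ)) (comulMul hξ (y ξ)) +
        (-(1 + ξ) / 2) • TensorProduct.map (LinearMap.mulLeft k (KAlg.b hξ)) (comulMul hξ (x ξ)))
        ((comul hξ).lTensor _ w) := by
  induction w with
  | zero => simp
  | add z w hz hw => simp only [map_add, mul_add, hz, hw]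
  | tmul h t => simp [coactY, add_mul, comul_x_mul, comul_y_mul]

/-- Together with `lTensor_comul_coactX_mul` it gives both sides of `comul_coact` the same
recursion. The coactions of `d · p` and `c · p` are not known separately, but they occur only in the
combinations controlled by `coact_actEntry_mul`. -/
theorem ydTensorCoact_comulMul_x (u : B21Alg ξ ⊗[k] B21Alg ξ) :
    ydTensorCoact (ydModule hξ) (ydModule hξ) (comulMul hξ (x ξ) u) =
      (TensorProduct.map (LinearMap.mulLeft k (KAlg.d hξ)) (comulMul hξ (x ξ)) +
        (ξ - 1) • TensorProduct.map (LinearMap.mulLeft k (KAlg.c hξ)) (comulMul hξ (y ξ)))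
        (ydTensorCoact (ydModule hξ) (ydModule hξ) u) := by
  have h3 := xi_sub_one_mul hξ
  induction u with
  | zero => simp
  | add z w hz hw => simp only [map_add, hz, hw]
  | tmul p q =>
    rw [comulMul_x]
    simp only [LinearMap.add_apply, LinearMap.smul_apply, TensorProduct.map_tmul, map_add,
      map_smul, ydTensorCoact_tmul, LinearMap.id_apply, opX_apply, opY_apply, ydModule,
      AlgHom.toLinearMap_apply, map_mul, coact_x, coact_y]
    have c0 := coact_actEntry_mul hξ 1 0 p
    have c1 := coact_actEntry_mul hξ 1 1 p
    simp only [Fin.sum_univ_two] at c0 c1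
    -- The terms are sorted by their last leg, `x` or `y`. By `h3` the coefficients fit, and the two
    -- groups are exactly the left sides of `c1` and `c0`.
    have e : ∀ W : KAlg hξ ⊗[k] B21Alg ξ,
        codiagonal (coact hξ (actEntry hξ 1 1 p) ⊗ₜ (coactX hξ * W)) +
          (ξ - 1) • codiagonal (coact hξ (actEntry hξ 1 0 p) ⊗ₜ (coactY hξ * W)) =
        codiagonal ((coact hξ (actEntry hξ 1 0 p) * genMatrix hξ 0 1 ⊗ₜ 1 +
          coact hξ (actEntry hξ 1 1 p) * genMatrix hξ 1 1 ⊗ₜ 1) ⊗ₜ (1 ⊗ₜ x ξ * W)) +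
        (ξ - 1) • codiagonal ((coact hξ (actEntry hξ 1 0 p) * genMatrix hξ 0 0 ⊗ₜ 1 +
          coact hξ (actEntry hξ 1 1 p) * genMatrix hξ 1 0 ⊗ₜ 1) ⊗ₜ (1 ⊗ₜ y ξ * W)) := by
      intro W
      simp only [coactX, coactY, add_mul, smul_mul_assoc, TensorProduct.tmul_add,
        TensorProduct.tmul_smul, map_add, map_smul, TensorProduct.add_tmul,
        codiagonal_mul_tmul _ (KAlg.a hξ), codiagonal_mul_tmul _ (KAlg.b hξ),
        codiagonal_mul_tmul _ (KAlg.c hξ), codiagonal_mul_tmul _ (KAlg.d hξ), smul_add, smul_smul,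
        h3]
      simp only [genMatrix, Matrix.of_apply, Matrix.cons_val', Matrix.cons_val_zero,
        Matrix.cons_val_one, Matrix.cons_val_fin_one]
      module
    rw [add_assoc, e, c0, c1]
    generalize coact hξ p = P
    generalize coact hξ q = W
    induction P with
    | zero => simp
    | add z w hz hw =>
      simp only [map_add, smul_add, TensorProduct.add_tmul, mul_add] at hz hw ⊢
      linear_combination (norm := module) hz + hw
    | tmul h t =>
      induction W with
      | zero => simp
      | add z w hz hw =>
        simp only [map_add, smul_add, TensorProduct.tmul_add, mul_add] at hz hw ⊢
        linear_combination (norm := module) hz + hw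
      | tmul g s =>
        simp only [coactX, comulMul_y, actRight_tmul, add_mul, smul_mul_assoc,
          Algebra.TensorProduct.tmul_mul_tmul, one_mul, codiagonal_tmul, TensorProduct.add_tmul,
          ← TensorProduct.smul_tmul', map_add, map_smul, LinearMap.add_apply, LinearMap.smul_apply,
          TensorProduct.map_tmul, LinearMap.mulLeft_apply, opX_apply, opY_apply, LinearMap.id_apply,
          TensorProduct.tmul_add, TensorProduct.tmul_smul, smul_add, smul_smul, mul_assoc, h3]
        simp only [genMatrix, Matrix.of_apply, Matrix.cons_val', Matrix.cons_val_zero,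
          Matrix.cons_val_one, Matrix.cons_val_fin_one]
        module

theorem ydTensorCoact_comulMul_y (u : B21Alg ξ ⊗[k] B21Alg ξ) :
    ydTensorCoact (ydModule hξ) (ydModule hξ) (comulMul hξ (y ξ) u) =
      (TensorProduct.map (LinearMap.mulLeft k (KAlg.a hξ)) (comulMul hξ (y ξ)) +
        (-(1 + ξ) / 2) • TensorProduct.map (LinearMap.mulLeft k (KAlg.b hξ)) (comulMul hξ (x ξ)))
        (ydTensorCoact (ydModule hξ) (ydModule hξ) u) := by
  have h3 := (mul_comm _ _).trans (xi_sub_one_mul hξ)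
  induction u with
  | zero => simp
  | add z w hz hw => simp only [map_add, hz, hw]
  | tmul p q =>
    rw [comulMul_y]
    simp only [LinearMap.add_apply, LinearMap.smul_apply, TensorProduct.map_tmul, map_add,
      map_smul, ydTensorCoact_tmul, LinearMap.id_apply, opX_apply, opY_apply, ydModule,
      AlgHom.toLinearMap_apply, map_mul, coact_x, coact_y]
    have c0 := coact_actEntry_mul hξ 0 0 p
    have c1 := coact_actEntry_mul hξ 0 1 p
    simp only [Fin.sum_univ_two] at c0 c1
    have e : ∀ W : KAlg hξ ⊗[k] B21Alg ξ,
        codiagonal (coact hξ (actEntry hξ 0 0 p) ⊗ₜ (coactY hξ * W)) +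
          (-(1 + ξ) / 2) • codiagonal (coact hξ (actEntry hξ 0 1 p) ⊗ₜ (coactX hξ * W)) =
        codiagonal ((coact hξ (actEntry hξ 0 0 p) * genMatrix hξ 0 0 ⊗ₜ 1 +
          coact hξ (actEntry hξ 0 1 p) * genMatrix hξ 1 0 ⊗ₜ 1) ⊗ₜ (1 ⊗ₜ y ξ * W)) +
        (-(1 + ξ) / 2) • codiagonal ((coact hξ (actEntry hξ 0 0 p) * genMatrix hξ 0 1 ⊗ₜ 1 +
          coact hξ (actEntry hξ 0 1 p) * genMatrix hξ 1 1 ⊗ₜ 1) ⊗ₜ (1 ⊗ₜ x ξ * W)) := by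
      intro W
      simp only [coactX, coactY, add_mul, smul_mul_assoc, TensorProduct.tmul_add,
        TensorProduct.tmul_smul, map_add, map_smul, TensorProduct.add_tmul,
        codiagonal_mul_tmul _ (KAlg.a hξ), codiagonal_mul_tmul _ (KAlg.b hξ),
        codiagonal_mul_tmul _ (KAlg.c hξ), codiagonal_mul_tmul _ (KAlg.d hξ), smul_add, smul_smul,
        h3]
      simp only [genMatrix, Matrix.of_apply, Matrix.cons_val', Matrix.cons_val_zero,
        Matrix.cons_val_one, Matrix.cons_val_fin_one]
      module
    rw [add_assoc, e, c0, c1]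
    generalize coact hξ p = P
    generalize coact hξ q = W
    induction P with
    | zero => simp
    | add z w hz hw =>
      simp only [map_add, smul_add, TensorProduct.add_tmul, mul_add] at hz hw ⊢
      linear_combination (norm := module) hz + hw
    | tmul h t =>
      induction W with
      | zero => simp
      | add z w hz hw =>
        simp only [map_add, smul_add, TensorProduct.tmul_add, mul_add] at hz hw ⊢
        linear_combination (norm := module) hz + hw
      | tmul g s =>
        simp only [coactY, comulMul_x, actRight_tmul, add_mul, smul_mul_assoc,
          Algebra.TensorProduct.tmul_mul_tmul, one_mul, codiagonal_tmul, TensorProduct.add_tmul,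
          ← TensorProduct.smul_tmul', map_add, map_smul, LinearMap.add_apply, LinearMap.smul_apply,
          TensorProduct.map_tmul, LinearMap.mulLeft_apply, opX_apply, opY_apply, LinearMap.id_apply,
          TensorProduct.tmul_add, TensorProduct.tmul_smul, smul_add, smul_smul, mul_assoc, h3]
        simp only [genMatrix, Matrix.of_apply, Matrix.cons_val', Matrix.cons_val_zero,
          Matrix.cons_val_one, Matrix.cons_val_fin_one]
        module

theorem comul_coact (r : B21Alg ξ) :
    (comul hξ).lTensor (KAlg hξ) (coact hξ r) =
      ydTensorCoact (ydModule hξ) (ydModule hξ) (comul hξ r) := by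
  refine LinearMap.congr_fun (f := (comul hξ).lTensor (KAlg hξ) ∘ₗ (coact hξ).toLinearMap)
    (g := ydTensorCoact (ydModule hξ) (ydModule hξ) ∘ₗ comul hξ) (linearMap_ext ?_ ?_ ?_) r
  · simp [comul_one, ydTensorCoact_tmul, ydModule, Algebra.TensorProduct.one_def, codiagonal_tmul]
  · intro s hs
    simp only [LinearMap.comp_apply, AlgHom.toLinearMap_apply] at hs ⊢
    rw [comul_x_mul, ydTensorCoact_comulMul_x, ← hs, map_mul, coact_x, lTensor_comul_coactX_mul]
  · intro s hs
    simp only [LinearMap.comp_apply, AlgHom.toLinearMap_apply] at hs ⊢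
    rw [comul_y_mul, ydTensorCoact_comulMul_y, ← hs, map_mul, coact_y, lTensor_comul_coactY_mul]

end Comul

end B21Alg

namespace B21Alg

variable {k : Type u} [Field k] {ξ : k} (hξ : IsPrimitiveRoot ξ 4)

open KAlg (genMatrix)

/-! ### The antipode. -/

section Antipode

variable (ξ) in
/-- Right multiplication by `x`. -/
noncomputable def opRX : Module.End k (B21Alg ξ) := LinearMap.mulRight k (x ξ)

variable (ξ) in
/-- Right multiplication by `y`. -/
noncomputable def opRY : Module.End k (B21Alg ξ) := LinearMap.mulRight k (y ξ)

theorem opRX_apply (s : B21Alg ξ) : opRX ξ s = s * x ξ := rfl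

theorem opRY_apply (s : B21Alg ξ) : opRY ξ s = s * y ξ := rfl

/-- In the antipode recursion the generator ends up on the right, so the normal form now uses right
multiplications, with `a` and `c` again moved to the right of the words. -/
theorem opRX_mul_opRX : opRX ξ * opRX ξ = 0 :=
  LinearMap.ext fun s => by
    simp only [Module.End.mul_apply, opRX_apply, mul_assoc, x_mul_x, mul_zero,
      LinearMap.zero_apply]

theorem opRX_mul_opRY (hξ : IsPrimitiveRoot ξ 4) :
    opRX ξ * opRY ξ = ξ • (opRY ξ * opRX ξ) :=
  LinearMap.ext fun s => by
    simp only [Module.End.mul_apply, opRX_apply, opRY_apply, mul_assoc, LinearMap.smul_apply,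
      y_mul_x hξ, mul_smul_comm]

theorem opRY_pow : opRY ξ * (opRY ξ * (opRY ξ * opRY ξ)) = 0 :=
  LinearMap.ext fun s => by
    simp only [Module.End.mul_apply, opRY_apply, mul_assoc, LinearMap.zero_apply, y_pow, mul_zero]

theorem opA_mul_opRX : opA hξ * opRX ξ = (-1 : k) • (opRX ξ * opA hξ) :=
  LinearMap.ext fun s => by
    simp only [Module.End.mul_apply, opRX_apply, LinearMap.smul_apply, opA, actEntry_mul,
      Fin.sum_univ_two, actEntry_x]
    simp

theorem opC_mul_opRX : opC hξ * opRX ξ = (-1 : k) • (opRX ξ * opC hξ) :=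
  LinearMap.ext fun s => by
    simp only [Module.End.mul_apply, opRX_apply, LinearMap.smul_apply, opC, actEntry_mul,
      Fin.sum_univ_two, actEntry_x]
    simp

theorem opA_mul_opRY :
    opA hξ * opRY ξ = ξ • (opRY ξ * opA hξ) + opRX ξ * (opA hξ * (opA hξ * opC hξ)) := by
  rw [← actEntry_zero_one]
  exact LinearMap.ext fun s => by
    simp only [Module.End.mul_apply, opRX_apply, opRY_apply, LinearMap.add_apply,
      LinearMap.smul_apply, opA, actEntry_mul, Fin.sum_univ_two, actEntry_y]
    simp

theorem opC_mul_opRY :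
    opC hξ * opRY ξ = ξ • (opRY ξ * opC hξ) + opRX ξ * (opA hξ * (opA hξ * opA hξ)) := by
  rw [← actEntry_one_one]
  exact LinearMap.ext fun s => by
    simp only [Module.End.mul_apply, opRX_apply, opRY_apply, LinearMap.add_apply,
      LinearMap.smul_apply, opC, actEntry_mul, Fin.sum_univ_two, actEntry_y]
    simp

variable (T : Module.End k (B21Alg ξ))

theorem opRX_mul_opRX' : opRX ξ * (opRX ξ * T) = 0 := by
  rw [← mul_assoc, opRX_mul_opRX, zero_mul]

theorem opRX_mul_opRY' (hξ : IsPrimitiveRoot ξ 4) (T : Module.End k (B21Alg ξ)) :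
    opRX ξ * (opRY ξ * T) = ξ • (opRY ξ * (opRX ξ * T)) := by
  rw [← mul_assoc, opRX_mul_opRY hξ, smul_mul_assoc, mul_assoc]

theorem opA_mul_opRX' : opA hξ * (opRX ξ * T) = (-1 : k) • (opRX ξ * (opA hξ * T)) := by
  rw [← mul_assoc, opA_mul_opRX, smul_mul_assoc, mul_assoc]

theorem opC_mul_opRX' : opC hξ * (opRX ξ * T) = (-1 : k) • (opRX ξ * (opC hξ * T)) := by
  rw [← mul_assoc, opC_mul_opRX, smul_mul_assoc, mul_assoc]

theorem opA_mul_opRY' : opA hξ * (opRY ξ * T) =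
    ξ • (opRY ξ * (opA hξ * T)) + opRX ξ * (opA hξ * (opA hξ * (opC hξ * T))) := by
  rw [← mul_assoc, opA_mul_opRY, add_mul, smul_mul_assoc]
  simp only [mul_assoc]

theorem opC_mul_opRY' : opC hξ * (opRY ξ * T) =
    ξ • (opRY ξ * (opC hξ * T)) + opRX ξ * (opA hξ * (opA hξ * (opA hξ * T))) := by
  rw [← mul_assoc, opC_mul_opRY, add_mul, smul_mul_assoc]
  simp only [mul_assoc]

/-- The operator `S(r) ↦ S(x r)`. -/
noncomputable def antipodeX : Module.End k (B21Alg ξ) :=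
  (-1 : k) • (opRX ξ * actEntry hξ 1 1 + (ξ - 1) • (opRY ξ * actEntry hξ 1 0))

/-- The operator `S(r) ↦ S(y r)`. -/
noncomputable def antipodeY : Module.End k (B21Alg ξ) :=
  (-1 : k) • (opRY ξ * actEntry hξ 0 0 + (-(1 + ξ) / 2) • (opRX ξ * actEntry hξ 0 1))

/-- A braided antipode reverses products through the braiding, whence `S(x r) = -(x₍₋₁₎ · S(r))
x₍₀₎`. The relations for these operators allow `S` to be defined by this recursion. -/
theorem antipodeX_mul_antipodeX : antipodeX hξ * antipodeX hξ = 0 := by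
  have h1 := KAlg.xi_sq hξ
  simp only [antipodeX, actEntry_one_zero, actEntry_one_one, mul_add, add_mul, smul_mul_assoc,
    mul_smul_comm, mul_assoc, mul_one, opA_pow, opC_mul_opC, opC_mul_opA, opC_mul_opA',
    opRX_mul_opRX', opRX_mul_opRY' hξ, opA_mul_opRX, opA_mul_opRX', opA_mul_opRY', opC_mul_opRX',
    opC_mul_opRY', mul_zero, smul_add, smul_zero, add_zero, zero_add, smul_smul]
  match_scalars <;> grind

theorem antipodeX_mul_antipodeY :
    antipodeX hξ * antipodeY hξ + ξ • (antipodeY hξ * antipodeX hξ) = 0 := by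
  have h1 := KAlg.xi_sq hξ
  have h2 := two_ne_zero_of_xi hξ
  simp only [antipodeX, antipodeY, actEntry_zero_zero, actEntry_zero_one, actEntry_one_zero,
    actEntry_one_one, mul_add, add_mul, smul_mul_assoc, mul_smul_comm, mul_assoc, mul_one, opA_pow,
    opA_pow', opC_mul_opC, opC_mul_opA, opC_mul_opA', opRX_mul_opRX', opRX_mul_opRY hξ,
    opA_mul_opRX', opA_mul_opRY', opC_mul_opRX', opC_mul_opRY', mul_zero, smul_add, smul_zero,
    add_zero, zero_add, smul_smul]
  match_scalars <;> field_simp <;> grind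

theorem antipodeY_pow : antipodeY hξ ^ 4 = 0 := by
  have h1 := KAlg.xi_sq hξ
  have h2 := two_ne_zero_of_xi hξ
  -- All terms containing `x` cancel in the square, which reduces the fourth power to `y⁴ = 0`.
  have e : antipodeY hξ * antipodeY hξ = ξ • (opRY ξ * (opRY ξ * (opA hξ * opA hξ))) := by
    simp only [antipodeY, actEntry_zero_zero, actEntry_zero_one, mul_add, add_mul, smul_mul_assoc,
      mul_smul_comm, mul_assoc, mul_one, opA_pow, opC_mul_opC, opC_mul_opA, opC_mul_opA',
      opRX_mul_opRX', opRX_mul_opRY' hξ, opA_mul_opRX, opA_mul_opRX', opA_mul_opRY', opC_mul_opRX',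
      opC_mul_opRY', mul_zero, smul_add, smul_zero, add_zero, smul_smul]
    match_scalars <;> field_simp <;> grind
  have e4 : antipodeY hξ ^ 4 = antipodeY hξ * antipodeY hξ * (antipodeY hξ * antipodeY hξ) := by
    noncomm_ring
  rw [e4, e]
  simp only [mul_add, smul_mul_assoc, mul_smul_comm, mul_assoc, mul_one, opA_pow, opA_pow',
    opC_mul_opC, opC_mul_opA, opC_mul_opA', opRX_mul_opRX, opRX_mul_opRX', opRX_mul_opRY' hξ,
    opA_mul_opRX', opA_mul_opRY', opC_mul_opRX', opC_mul_opRY', opRY_pow, mul_zero, smul_add,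
    smul_zero, add_zero, zero_add, smul_smul]
  match_scalars <;> grind

/-- The algebra map sending `r` to the operator `S(s) ↦ S(r s)`. -/
noncomputable def antipodeMul : B21Alg ξ →ₐ[k] Module.End k (B21Alg ξ) :=
  lift (antipodeX hξ) (antipodeY hξ) (antipodeX_mul_antipodeX hξ) (antipodeX_mul_antipodeY hξ)
    (antipodeY_pow hξ)

/-- The antipode of `B21`. -/
noncomputable def antipode : B21Alg ξ →ₗ[k] B21Alg ξ := (antipodeMul hξ).toLinearMap.flip 1

theorem antipode_one : antipode hξ 1 = 1 := by simp [antipode]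

theorem antipode_x_mul (s : B21Alg ξ) : antipode hξ (x ξ * s) = antipodeX hξ (antipode hξ s) := by
  simp [antipode, antipodeMul]

theorem antipode_y_mul (s : B21Alg ξ) : antipode hξ (y ξ * s) = antipodeY hξ (antipode hξ s) := by
  simp [antipode, antipodeMul]

theorem antipodeX_apply (s : B21Alg ξ) : antipodeX hξ s =
    -(actEntry hξ 1 1 s * x ξ + (ξ - 1) • (actEntry hξ 1 0 s * y ξ)) := by
  simp only [antipodeX, LinearMap.smul_apply, LinearMap.add_apply, Module.End.mul_apply,
    opRX_apply, opRY_apply, neg_one_smul]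

theorem antipodeY_apply (s : B21Alg ξ) : antipodeY hξ s =
    -(actEntry hξ 0 0 s * y ξ + (-(1 + ξ) / 2) • (actEntry hξ 0 1 s * x ξ)) := by
  simp only [antipodeY, LinearMap.smul_apply, LinearMap.add_apply, Module.End.mul_apply,
    opRX_apply, opRY_apply, neg_one_smul]

/-- The operators `antipodeX` and `antipodeY` commute with the action by the same rules as left
multiplication by `x` and `y`; this makes the antipode `K`-linear. -/
theorem actEntry_mul_antipodeX (i j : Fin 2) :
    actEntry hξ i j * antipodeX hξ = (-1 : k) • (antipodeX hξ * actEntry hξ i j) := by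
  have h1 := KAlg.xi_sq hξ
  fin_cases i <;> fin_cases j <;>
  simp only [Fin.zero_eta, Fin.mk_one, Fin.isValue, antipodeX, actEntry_zero_zero,
    actEntry_zero_one, actEntry_one_zero, actEntry_one_one, mul_add, add_mul, smul_mul_assoc,
    mul_smul_comm, mul_assoc, mul_one, opA_pow, opA_pow', opC_mul_opC, opC_mul_opA, opC_mul_opA',
    opA_mul_opRX, opA_mul_opRX', opA_mul_opRY', opC_mul_opRX', opC_mul_opRY', mul_zero, smul_add,
    smul_zero, add_zero, zero_add, smul_smul] <;>
  match_scalars <;> grind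

theorem actEntry_zero_mul_antipodeY (j : Fin 2) :
    actEntry hξ 0 j * antipodeY hξ =
      ξ • (antipodeY hξ * actEntry hξ 0 j) + antipodeX hξ * actEntry hξ 1 j := by
  have h1 := KAlg.xi_sq hξ
  have h2 := two_ne_zero_of_xi hξ
  fin_cases j <;>
  simp only [Fin.zero_eta, Fin.mk_one, Fin.isValue, antipodeX, antipodeY, actEntry_zero_zero,
    actEntry_zero_one, actEntry_one_zero, actEntry_one_one, mul_add, add_mul, smul_mul_assoc,
    mul_smul_comm, mul_assoc, mul_one, opA_pow, opC_mul_opC, opC_mul_opA, opC_mul_opA',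
    opA_mul_opRX, opA_mul_opRX', opA_mul_opRY', opC_mul_opRX', opC_mul_opRY', mul_zero, smul_add,
    smul_zero, add_zero, smul_smul] <;>
  match_scalars <;> field_simp <;> grind

theorem actEntry_one_mul_antipodeY (j : Fin 2) :
    actEntry hξ 1 j * antipodeY hξ =
      antipodeX hξ * actEntry hξ 0 j + (-ξ) • (antipodeY hξ * actEntry hξ 1 j) := by
  have h1 := KAlg.xi_sq hξ
  have h2 := two_ne_zero_of_xi hξ
  fin_cases j <;>
  simp only [Fin.zero_eta, Fin.mk_one, Fin.isValue, antipodeX, antipodeY, actEntry_zero_zero,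
    actEntry_zero_one, actEntry_one_zero, actEntry_one_one, mul_add, add_mul, smul_mul_assoc,
    mul_smul_comm, mul_assoc, mul_one, opA_pow, opA_pow', opC_mul_opC, opC_mul_opA, opC_mul_opA',
    opA_mul_opRX', opA_mul_opRY', opC_mul_opRX', opC_mul_opRY', mul_zero, smul_add, smul_zero,
    add_zero, smul_smul] <;>
  match_scalars <;> field_simp <;> grind

theorem antipode_actEntry (i j : Fin 2) (r : B21Alg ξ) :
    antipode hξ (actEntry hξ i j r) = actEntry hξ i j (antipode hξ r) := by
  induction r using B21Alg.induction generalizing i j with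
  | one => fin_cases i <;> fin_cases j <;> simp [actEntry_one, antipode_one]
  | smul c s hs => simp only [map_smul, hs]
  | add s t hs ht => simp only [map_add, hs, ht]
  | x_mul s hs =>
    have e := LinearMap.congr_fun (actEntry_mul_antipodeX hξ i j) (antipode hξ s)
    simp only [LinearMap.smul_apply, Module.End.mul_apply, neg_one_smul] at e
    rw [actEntry_x_mul, map_neg, antipode_x_mul, antipode_x_mul, hs, e]
  | y_mul s hs =>
    fin_cases i
    · change antipode hξ (actEntry hξ 0 j _) = actEntry hξ 0 j _
      have e := LinearMap.congr_fun (actEntry_zero_mul_antipodeY hξ j) (antipode hξ s)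
      simp only [LinearMap.smul_apply, LinearMap.add_apply, Module.End.mul_apply] at e
      rw [actEntry_zero_y_mul, map_add, map_smul, antipode_x_mul, antipode_y_mul, antipode_y_mul,
        hs, hs, e]
    · change antipode hξ (actEntry hξ 1 j _) = actEntry hξ 1 j _
      have e := LinearMap.congr_fun (actEntry_one_mul_antipodeY hξ j) (antipode hξ s)
      simp only [LinearMap.smul_apply, LinearMap.add_apply, Module.End.mul_apply] at e
      rw [actEntry_one_y_mul, map_sub, map_smul, antipode_x_mul, antipode_y_mul, antipode_y_mul,
        hs, hs, e, neg_smul, sub_eq_add_neg]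

theorem lTensor_antipode_coactX_mul (w : KAlg hξ ⊗[k] B21Alg ξ) :
    (antipode hξ).lTensor _ (coactX hξ * w) =
      (TensorProduct.map (LinearMap.mulLeft k (KAlg.d hξ)) (antipodeX hξ) +
        (ξ - 1) • TensorProduct.map (LinearMap.mulLeft k (KAlg.c hξ)) (antipodeY hξ))
        ((antipode hξ).lTensor _ w) := by
  induction w with
  | zero => simp
  | add z w hz hw => simp only [map_add, mul_add, hz, hw]
  | tmul h t => simp [coactX, add_mul, antipode_x_mul, antipode_y_mul]

theorem lTensor_antipode_coactY_mul (w : KAlg hξ ⊗[k] B21Alg ξ) :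
    (antipode hξ).lTensor _ (coactY hξ * w) =
      (TensorProduct.map (LinearMap.mulLeft k (KAlg.a hξ)) (antipodeY hξ) +
        (-(1 + ξ) / 2) • TensorProduct.map (LinearMap.mulLeft k (KAlg.b hξ)) (antipodeX hξ))
        ((antipode hξ).lTensor _ w) := by
  induction w with
  | zero => simp
  | add z w hz hw => simp only [map_add, mul_add, hz, hw]
  | tmul h t => simp [coactY, add_mul, antipode_x_mul, antipode_y_mul]

/-- Colinearity uses the regrouping of `ydTensorCoact_comulMul_x`: the coactions of `d · p` and `c ·
p` enter only through the sums in `coact_actEntry_mul`. -/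
theorem coact_antipodeX (p : B21Alg ξ) : coact hξ (antipodeX hξ p) =
    (TensorProduct.map (LinearMap.mulLeft k (KAlg.d hξ)) (antipodeX hξ) +
      (ξ - 1) • TensorProduct.map (LinearMap.mulLeft k (KAlg.c hξ)) (antipodeY hξ))
      (coact hξ p) := by
  have h3 := xi_sub_one_mul hξ
  have c0 := coact_actEntry_mul hξ 1 0 p
  have c1 := coact_actEntry_mul hξ 1 1 p
  simp only [Fin.sum_univ_two] at c0 c1
  have s1 : ∀ (h : KAlg hξ) (t : B21Alg ξ), h ⊗ₜ[k] t = h ⊗ₜ 1 * 1 ⊗ₜ t := by simp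
  have e : coact hξ (antipodeX hξ p) =
      -((coact hξ (actEntry hξ 1 0 p) * genMatrix hξ 0 1 ⊗ₜ 1 +
          coact hξ (actEntry hξ 1 1 p) * genMatrix hξ 1 1 ⊗ₜ 1) * (1 ⊗ₜ x ξ) +
        (ξ - 1) • ((coact hξ (actEntry hξ 1 0 p) * genMatrix hξ 0 0 ⊗ₜ 1 +
          coact hξ (actEntry hξ 1 1 p) * genMatrix hξ 1 0 ⊗ₜ 1) * (1 ⊗ₜ y ξ))) := by
    simp only [antipodeX_apply, map_neg, map_add, map_smul, map_mul, coact_x, coact_y, coactX,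
      coactY, s1 (KAlg.a hξ) (y ξ), s1 (KAlg.b hξ) (x ξ), s1 (KAlg.c hξ) (y ξ),
      s1 (KAlg.d hξ) (x ξ), mul_add, add_mul, mul_smul_comm, smul_add, smul_smul, h3,
      genMatrix, Matrix.of_apply, Matrix.cons_val', Matrix.cons_val_zero,
      Matrix.cons_val_one, Matrix.cons_val_fin_one, mul_assoc]
    module
  rw [e, c0, c1]
  generalize coact hξ p = P
  induction P with
  | zero => simp
  | add z w hz hw =>
    simp only [map_add, smul_add, add_mul, mul_add, neg_add] at hz hw ⊢
    linear_combination (norm := module) hz + hw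
  | tmul h t =>
    simp only [actRight_tmul, Algebra.TensorProduct.tmul_mul_tmul, add_mul, one_mul, mul_one,
      LinearMap.add_apply, LinearMap.smul_apply, TensorProduct.map_tmul, LinearMap.mulLeft_apply,
      antipodeX_apply, antipodeY_apply, TensorProduct.tmul_neg, TensorProduct.tmul_add,
      TensorProduct.tmul_smul, smul_add, smul_neg, smul_smul, h3]
    simp only [genMatrix, Matrix.of_apply, Matrix.cons_val', Matrix.cons_val_zero,
      Matrix.cons_val_one, Matrix.cons_val_fin_one]
    module

theorem coact_antipodeY (p : B21Alg ξ) : coact hξ (antipodeY hξ p) =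
    (TensorProduct.map (LinearMap.mulLeft k (KAlg.a hξ)) (antipodeY hξ) +
      (-(1 + ξ) / 2) • TensorProduct.map (LinearMap.mulLeft k (KAlg.b hξ)) (antipodeX hξ))
      (coact hξ p) := by
  have h3 := (mul_comm _ _).trans (xi_sub_one_mul hξ)
  have c0 := coact_actEntry_mul hξ 0 0 p
  have c1 := coact_actEntry_mul hξ 0 1 p
  simp only [Fin.sum_univ_two] at c0 c1
  have s1 : ∀ (h : KAlg hξ) (t : B21Alg ξ), h ⊗ₜ[k] t = h ⊗ₜ 1 * 1 ⊗ₜ t := by simp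
  have e : coact hξ (antipodeY hξ p) =
      -((coact hξ (actEntry hξ 0 0 p) * genMatrix hξ 0 0 ⊗ₜ 1 +
          coact hξ (actEntry hξ 0 1 p) * genMatrix hξ 1 0 ⊗ₜ 1) * (1 ⊗ₜ y ξ) +
        (-(1 + ξ) / 2) • ((coact hξ (actEntry hξ 0 0 p) * genMatrix hξ 0 1 ⊗ₜ 1 +
          coact hξ (actEntry hξ 0 1 p) * genMatrix hξ 1 1 ⊗ₜ 1) * (1 ⊗ₜ x ξ))) := by
    simp only [antipodeY_apply, map_neg, map_add, map_smul, map_mul, coact_x, coact_y, coactX,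
      coactY, s1 (KAlg.a hξ) (y ξ), s1 (KAlg.b hξ) (x ξ), s1 (KAlg.c hξ) (y ξ),
      s1 (KAlg.d hξ) (x ξ), mul_add, add_mul, mul_smul_comm, smul_add, smul_smul, h3,
      genMatrix, Matrix.of_apply, Matrix.cons_val', Matrix.cons_val_zero,
      Matrix.cons_val_one, Matrix.cons_val_fin_one, mul_assoc]
    module
  rw [e, c0, c1]
  generalize coact hξ p = P
  induction P with
  | zero => simp
  | add z w hz hw =>
    simp only [map_add, smul_add, add_mul, mul_add, neg_add] at hz hw ⊢
    linear_combination (norm := module) hz + hw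
  | tmul h t =>
    simp only [actRight_tmul, Algebra.TensorProduct.tmul_mul_tmul, add_mul, one_mul, mul_one,
      LinearMap.add_apply, LinearMap.smul_apply, TensorProduct.map_tmul, LinearMap.mulLeft_apply,
      antipodeX_apply, antipodeY_apply, TensorProduct.tmul_neg, TensorProduct.tmul_add,
      TensorProduct.tmul_smul, smul_add, smul_neg, smul_smul, h3]
    simp only [genMatrix, Matrix.of_apply, Matrix.cons_val', Matrix.cons_val_zero,
      Matrix.cons_val_one, Matrix.cons_val_fin_one]
    module

theorem antipode_isYDHom : IsYDHom (ydModule hξ) (ydModule hξ) (antipode hξ) where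
  map_act h m := KAlg.map_act (act hξ) (act hξ) (antipode hξ)
    (fun i j m => by rw [act_genMatrix, antipode_actEntry]) h m
  map_coact m := by
    refine LinearMap.congr_fun (f := (coact hξ).toLinearMap ∘ₗ antipode hξ)
      (g := (antipode hξ).lTensor (KAlg hξ) ∘ₗ (coact hξ).toLinearMap) (linearMap_ext ?_ ?_ ?_) m
    · simp [antipode_one, Algebra.TensorProduct.one_def]
    · intro s hs
      simp only [LinearMap.comp_apply, AlgHom.toLinearMap_apply] at hs ⊢
      rw [antipode_x_mul, coact_antipodeX, hs, map_mul, coact_x, lTensor_antipode_coactX_mul]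
    · intro s hs
      simp only [LinearMap.comp_apply, AlgHom.toLinearMap_apply] at hs ⊢
      rw [antipode_y_mul, coact_antipodeY, hs, map_mul, coact_y, lTensor_antipode_coactY_mul]

/-- By its recursion `S(x p) q` is the negative of the two other summands, so the left antipode law
holds on `x * s` without any hypothesis on `s`. -/
theorem mul_rTensor_antipode_comulMul_x (u : B21Alg ξ ⊗[k] B21Alg ξ) :
    LinearMap.mul' k _ ((antipode hξ).rTensor _ (comulMul hξ (x ξ) u)) = 0 := by
  induction u with
  | zero => simp
  | add z w hz hw => simp only [map_add, hz, hw, add_zero]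
  | tmul p q =>
    rw [comulMul_x]
    simp only [LinearMap.add_apply, LinearMap.smul_apply, TensorProduct.map_tmul, map_add,
      map_smul, LinearMap.rTensor_tmul, LinearMap.mul'_apply, LinearMap.id_apply,
      antipode_actEntry, opX_apply, opY_apply, antipode_x_mul, antipodeX_apply, neg_mul, add_mul,
      smul_mul_assoc, mul_assoc]
    module

theorem mul_rTensor_antipode_comulMul_y (u : B21Alg ξ ⊗[k] B21Alg ξ) :
    LinearMap.mul' k _ ((antipode hξ).rTensor _ (comulMul hξ (y ξ) u)) = 0 := by
  induction u with
  | zero => simp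
  | add z w hz hw => simp only [map_add, hz, hw, add_zero]
  | tmul p q =>
    rw [comulMul_y]
    simp only [LinearMap.add_apply, LinearMap.smul_apply, TensorProduct.map_tmul, map_add,
      map_smul, LinearMap.rTensor_tmul, LinearMap.mul'_apply, LinearMap.id_apply,
      antipode_actEntry, opX_apply, opY_apply, antipode_y_mul, antipodeY_apply, neg_mul, add_mul,
      smul_mul_assoc, mul_assoc]
    module

/-- On this side nothing cancels outright. By induction the product is a scalar multiple of `1` when
`u` is a comultiplication, and then `antipodeX 1 = -x` makes the two terms cancel. -/
theorem mul_lTensor_antipode_comulMul_x (u : B21Alg ξ ⊗[k] B21Alg ξ) :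
    LinearMap.mul' k _ ((antipode hξ).lTensor _ (comulMul hξ (x ξ) u)) =
      x ξ * LinearMap.mul' k _ ((antipode hξ).lTensor _ u) +
        antipodeX hξ (LinearMap.mul' k _ ((antipode hξ).lTensor _ u)) := by
  have h3 := xi_sub_one_mul hξ
  induction u with
  | zero => simp
  | add z w hz hw => simp only [map_add, hz, hw, mul_add]; abel
  | tmul p q =>
    rw [comulMul_x]
    simp only [LinearMap.add_apply, LinearMap.smul_apply, TensorProduct.map_tmul, map_add,
      map_smul, LinearMap.lTensor_tmul, LinearMap.mul'_apply, LinearMap.id_apply,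
      opX_apply, opY_apply, antipode_x_mul, antipode_y_mul, antipodeX_apply, antipodeY_apply,
      mul_neg, mul_add, add_mul, smul_add, smul_neg, smul_smul, h3, actEntry_mul,
      Fin.sum_univ_two, mul_smul_comm, mul_assoc]
    module

theorem mul_lTensor_antipode_comulMul_y (u : B21Alg ξ ⊗[k] B21Alg ξ) :
    LinearMap.mul' k _ ((antipode hξ).lTensor _ (comulMul hξ (y ξ) u)) =
      y ξ * LinearMap.mul' k _ ((antipode hξ).lTensor _ u) +
        antipodeY hξ (LinearMap.mul' k _ ((antipode hξ).lTensor _ u)) := by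
  have h3 := (mul_comm _ _).trans (xi_sub_one_mul hξ)
  induction u with
  | zero => simp
  | add z w hz hw => simp only [map_add, hz, hw, mul_add]; abel
  | tmul p q =>
    rw [comulMul_y]
    simp only [LinearMap.add_apply, LinearMap.smul_apply, TensorProduct.map_tmul, map_add,
      map_smul, LinearMap.lTensor_tmul, LinearMap.mul'_apply, LinearMap.id_apply,
      opX_apply, opY_apply, antipode_x_mul, antipode_y_mul, antipodeX_apply, antipodeY_apply,
      mul_neg, mul_add, add_mul, smul_add, smul_neg, smul_smul, h3, actEntry_mul,
      Fin.sum_univ_two, mul_smul_comm, mul_assoc]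
    module

theorem mul_antipode_rTensor_comul (r : B21Alg ξ) :
    LinearMap.mul' k _ ((antipode hξ).rTensor _ (comul hξ r)) =
      algebraMap k _ (counit ξ r) := by
  refine LinearMap.congr_fun (f := LinearMap.mul' k _ ∘ₗ (antipode hξ).rTensor _ ∘ₗ comul hξ)
    (g := Algebra.linearMap k _ ∘ₗ (counit ξ).toLinearMap) (linearMap_ext ?_ ?_ ?_) r
  · simp [comul_one, antipode_one]
  · intro s hs
    simp only [LinearMap.comp_apply, comul_x_mul, mul_rTensor_antipode_comulMul_x]
    simp [counit_x]
  · intro s hs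
    simp only [LinearMap.comp_apply, comul_y_mul, mul_rTensor_antipode_comulMul_y]
    simp [counit_y]

theorem mul_antipode_lTensor_comul (r : B21Alg ξ) :
    LinearMap.mul' k _ ((antipode hξ).lTensor _ (comul hξ r)) =
      algebraMap k _ (counit ξ r) := by
  refine LinearMap.congr_fun (f := LinearMap.mul' k _ ∘ₗ (antipode hξ).lTensor _ ∘ₗ comul hξ)
    (g := Algebra.linearMap k _ ∘ₗ (counit ξ).toLinearMap) (linearMap_ext ?_ ?_ ?_) r
  · simp [comul_one, antipode_one]
  · intro s hs
    simp only [LinearMap.comp_apply] at hs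
    simp only [LinearMap.comp_apply, comul_x_mul, mul_lTensor_antipode_comulMul_x, hs]
    simp [counit_x, antipodeX_apply, Algebra.algebraMap_eq_smul_one, actEntry_one]
  · intro s hs
    simp only [LinearMap.comp_apply] at hs
    simp only [LinearMap.comp_apply, comul_y_mul, mul_lTensor_antipode_comulMul_y, hs]
    simp [counit_y, antipodeY_apply, Algebra.algebraMap_eq_smul_one, actEntry_one]

end Antipode

/-- The structure of a Hopf algebra in the category of Yetter-Drinfeld modules on `B21`. -/
noncomputable def ydHopfAlgebra : YDHopfAlgebra k (KAlg hξ) (B21Alg ξ) where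
  toYDModule := ydModule hξ
  comul := comul hξ
  counit := (counit ξ).toLinearMap
  coassoc := comul_coassoc hξ
  rTensor_counit_comp_comul := rTensor_counit_comul hξ
  lTensor_counit_comp_comul := lTensor_counit_comul hξ
  antipode := antipode hξ
  act_one := act_one hξ
  coact_one := map_one (coact hξ)
  act_mul := act_mul hξ
  coact_mul := coact_mul hξ
  counit_act := counit_act hξ
  counit_coact := counit_coact hξ
  comul_act := comul_act hξ
  comul_coact := comul_coact hξ
  antipode_hom := antipode_isYDHom hξ
  counit_one := map_one (counit ξ)
  counit_mul := map_mul (counit ξ)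
  comul_one := comul_one hξ
  comul_mul := comul_mul hξ
  antipode_left := mul_antipode_rTensor_comul hξ
  antipode_right := mul_antipode_lTensor_comul hξ

end B21Alg

namespace B21Alg

variable {k : Type u} [Field k] {ξ : k} (hξ : IsPrimitiveRoot ξ 4)

/-! ### Skew derivations. -/

section Derivations

/-- The algebra map to the dual numbers sending `x` and `y` to `α ε` and `β ε`. -/
noncomputable def toDual (ξ α β : k) : B21Alg ξ →ₐ[k] DualNumber k :=
  lift (α • DualNumber.eps) (β • DualNumber.eps) (by simp) (by simp)
    (by rw [show (4 : ℕ) = 2 + 2 from rfl, pow_add, pow_two]; simp)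

/-- The linear functional supported in degree one that sends `x` and `y` to `α` and `β`. -/
noncomputable def coord (ξ α β : k) : B21Alg ξ →ₗ[k] k :=
  TrivSqZeroExt.sndHom k k ∘ₗ (toDual ξ α β).toLinearMap

variable (α β : k)

theorem fst_toDual (s : B21Alg ξ) : (toDual ξ α β s).fst = counit ξ s := by
  have : (TrivSqZeroExt.fstHom k k k).comp (toDual ξ α β) = counit ξ := by
    apply algHom_ext <;> simp [toDual, counit_x, counit_y]
  exact AlgHom.congr_fun this s

theorem coord_one : coord ξ α β 1 = 0 := by simp [coord]

theorem coord_x_mul (s : B21Alg ξ) : coord ξ α β (x ξ * s) = α * counit ξ s := by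
  simp only [coord, LinearMap.comp_apply, AlgHom.toLinearMap_apply, map_mul,
    TrivSqZeroExt.sndHom_apply, TrivSqZeroExt.snd_mul, fst_toDual]
  simp [counit_x, toDual]

theorem coord_y_mul (s : B21Alg ξ) : coord ξ α β (y ξ * s) = β * counit ξ s := by
  simp only [coord, LinearMap.comp_apply, AlgHom.toLinearMap_apply, map_mul,
    TrivSqZeroExt.sndHom_apply, TrivSqZeroExt.snd_mul, fst_toDual]
  simp [counit_y, toDual]

/-- The skew derivation `r ↦ r₍₁₎ f(r₍₂₎)`, where `f = coord ξ α β`. -/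
noncomputable def deriv : Module.End k (B21Alg ξ) :=
  (TensorProduct.rid k _).toLinearMap ∘ₗ (coord ξ α β).lTensor _ ∘ₗ comul hξ

theorem deriv_apply (r : B21Alg ξ) : deriv hξ α β r =
    TensorProduct.rid k _ ((coord ξ α β).lTensor _ (comul hξ r)) := rfl

theorem deriv_one : deriv hξ α β 1 = 0 := by
  simp [deriv_apply, comul_one, coord_one]

theorem rid_lTensor_counit_comul (r : B21Alg ξ) :
    TensorProduct.rid k _ ((counit ξ).toLinearMap.lTensor _ (comul hξ r)) = r := by
  have h := LinearMap.congr_fun (lTensor_counit_comul hξ) r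
  rw [LinearMap.comp_apply] at h
  rw [h]
  simp

/-- A skew Leibniz rule. The functional sees `x * q` and `y * q` only through the counit of `q`, so
the last two summands of `Δ(x) Δ(s)` contract, by the counit law, to the actions of `d` and `c` on
`s`. -/
theorem deriv_x_mul (s : B21Alg ξ) : deriv hξ α β (x ξ * s) =
    x ξ * deriv hξ α β s + (α • actEntry hξ 1 1 s + ((ξ - 1) * β) • actEntry hξ 1 0 s) := by
  have key : ∀ u, TensorProduct.rid k _ ((coord ξ α β).lTensor _ (comulMul hξ (x ξ) u)) =
      x ξ * TensorProduct.rid k _ ((coord ξ α β).lTensor _ u) +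
      (α • actEntry hξ 1 1 (TensorProduct.rid k _ ((counit ξ).toLinearMap.lTensor _ u)) +
        ((ξ - 1) * β) •
          actEntry hξ 1 0 (TensorProduct.rid k _ ((counit ξ).toLinearMap.lTensor _ u))) := by
    intro u
    induction u with
    | zero => simp
    | add z w hz hw =>
      simp only [map_add, mul_add, smul_add] at hz hw ⊢
      linear_combination (norm := module) hz + hw
    | tmul p q =>
      simp only [comulMul_x, LinearMap.add_apply, LinearMap.smul_apply, TensorProduct.map_tmul,
        map_add, map_smul, LinearMap.lTensor_tmul, TensorProduct.rid_tmul, opX_apply, opY_apply,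
        LinearMap.id_apply, coord_x_mul, coord_y_mul, AlgHom.toLinearMap_apply, mul_smul_comm,
        smul_smul]
      module
  rw [deriv_apply, deriv_apply, comul_x_mul, key, rid_lTensor_counit_comul]

theorem deriv_y_mul (s : B21Alg ξ) : deriv hξ α β (y ξ * s) =
    y ξ * deriv hξ α β s + (β • actEntry hξ 0 0 s + ((-(1 + ξ) / 2) * α) • actEntry hξ 0 1 s) := by
  have key : ∀ u, TensorProduct.rid k _ ((coord ξ α β).lTensor _ (comulMul hξ (y ξ) u)) =
      y ξ * TensorProduct.rid k _ ((coord ξ α β).lTensor _ u) +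
      (β • actEntry hξ 0 0 (TensorProduct.rid k _ ((counit ξ).toLinearMap.lTensor _ u)) +
        ((-(1 + ξ) / 2) * α) •
          actEntry hξ 0 1 (TensorProduct.rid k _ ((counit ξ).toLinearMap.lTensor _ u))) := by
    intro u
    induction u with
    | zero => simp
    | add z w hz hw =>
      simp only [map_add, mul_add, smul_add] at hz hw ⊢
      linear_combination (norm := module) hz + hw
    | tmul p q =>
      simp only [comulMul_y, LinearMap.add_apply, LinearMap.smul_apply, TensorProduct.map_tmul,
        map_add, map_smul, LinearMap.lTensor_tmul, TensorProduct.rid_tmul, opX_apply, opY_apply,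
        LinearMap.id_apply, coord_x_mul, coord_y_mul, AlgHom.toLinearMap_apply, mul_smul_comm,
        smul_smul]
      module
  rw [deriv_apply, deriv_apply, comul_y_mul, key, rid_lTensor_counit_comul]

end Derivations

/-! ### The monomial basis and nondegeneracy. -/

section Basis

variable (ξ) in
/-- The monomials `x ^ i y ^ j` with `i < 2` and `j < 4`. -/
noncomputable def monomial : Fin 8 → B21Alg ξ :=
  ![1, y ξ, y ξ * y ξ, y ξ * (y ξ * y ξ), x ξ, x ξ * y ξ, x ξ * (y ξ * y ξ),
    x ξ * (y ξ * (y ξ * y ξ))]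

theorem span_monomial (hξ : IsPrimitiveRoot ξ 4) :
    Submodule.span k (Set.range (monomial ξ)) = ⊤ := by
  refine eq_top_iff.2 fun s _ => ?_
  have hm : ∀ i, monomial ξ i ∈ Submodule.span k (Set.range (monomial ξ)) :=
    fun i => Submodule.subset_span ⟨i, rfl⟩
  have hX : ∀ i, x ξ * monomial ξ i ∈ Submodule.span k (Set.range (monomial ξ)) := by
    have h0 : (0 : B21Alg ξ) ∈ Submodule.span k (Set.range (monomial ξ)) := zero_mem _
    generalize Submodule.span k (Set.range (monomial ξ)) = S at hm h0
    have h4 : x ξ ∈ S := hm 4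
    intro i
    fin_cases i
    · change x ξ * 1 ∈ S
      rwa [mul_one]
    · exact hm 5
    · exact hm 6
    · exact hm 7
    · change x ξ * x ξ ∈ S
      rwa [x_mul_x]
    all_goals
      change x ξ * (x ξ * _) ∈ S
      rwa [x_mul_x']
  have hY : ∀ i, y ξ * monomial ξ i ∈ Submodule.span k (Set.range (monomial ξ)) := by
    have h0 : (0 : B21Alg ξ) ∈ Submodule.span k (Set.range (monomial ξ)) := zero_mem _
    generalize Submodule.span k (Set.range (monomial ξ)) = S at hm h0
    have h1 : y ξ ∈ S := hm 1
    intro i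
    fin_cases i
    · change y ξ * 1 ∈ S
      rwa [mul_one]
    · exact hm 2
    · exact hm 3
    · change y ξ * (y ξ * (y ξ * y ξ)) ∈ S
      rwa [y_pow]
    · change y ξ * x ξ ∈ S
      rw [y_mul_x hξ]
      exact S.smul_mem _ (hm 5)
    · change y ξ * (x ξ * y ξ) ∈ S
      rw [y_mul_x' hξ]
      exact S.smul_mem _ (hm 6)
    · change y ξ * (x ξ * (y ξ * y ξ)) ∈ S
      rw [y_mul_x' hξ]
      exact S.smul_mem _ (hm 7)
    · change y ξ * (x ξ * (y ξ * (y ξ * y ξ))) ∈ S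
      rwa [y_mul_x' hξ, y_pow, mul_zero, smul_zero]
  have hX' : Submodule.span k (Set.range (monomial ξ)) ≤
      (Submodule.span k (Set.range (monomial ξ))).comap (opX ξ) :=
    Submodule.span_le.2 (Set.range_subset_iff.2 hX)
  have hY' : Submodule.span k (Set.range (monomial ξ)) ≤
      (Submodule.span k (Set.range (monomial ξ))).comap (opY ξ) :=
    Submodule.span_le.2 (Set.range_subset_iff.2 hY)
  induction s using B21Alg.induction with
  | one => exact hm 0
  | smul c s hs => exact Submodule.smul_mem _ _ (hs trivial)
  | add s t hs ht => exact add_mem (hs trivial) (ht trivial)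
  | x_mul s hs => exact hX' (hs trivial)
  | y_mul s hs => exact hY' (hs trivial)

variable (ξ) in
/-- The linear combination of monomials with given coefficients. -/
noncomputable def combination (c : Fin 8 → k) : B21Alg ξ :=
  c 0 • 1 + c 1 • y ξ + c 2 • (y ξ * y ξ) + c 3 • (y ξ * (y ξ * y ξ)) + c 4 • x ξ +
    c 5 • (x ξ * y ξ) + c 6 • (x ξ * (y ξ * y ξ)) + c 7 • (x ξ * (y ξ * (y ξ * y ξ)))

theorem combination_eq_sum (c : Fin 8 → k) : combination ξ c = ∑ i, c i • monomial ξ i := by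
  simp [combination, monomial, Fin.sum_univ_eight]

theorem exists_combination (hξ : IsPrimitiveRoot ξ 4) (r : B21Alg ξ) :
    ∃ c, combination ξ c = r := by
  have h : r ∈ Submodule.span k (Set.range (monomial ξ)) := by simp [span_monomial hξ]
  obtain ⟨c, hc⟩ := (Submodule.mem_span_range_iff_exists_fun k).1 h
  exact ⟨c, by rw [combination_eq_sum, hc]⟩

/-- The derivation lowers the degree by one. It does not kill `y²`: the coaction of `e₂` contains `b
⊗ e₁`, and `b · y = x`, so `y²` goes to a nonzero multiple of `x`. -/
theorem derivX_combination (c : Fin 8 → k) : deriv hξ 1 0 (combination ξ c) =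
    combination ξ ![c 4, -ξ * c 5, -c 6, ξ * c 7, -(1 + ξ) / 2 * c 2, (1 + ξ) / 2 * c 3, 0, 0] := by
  have h1 := KAlg.xi_sq hξ
  have h2 := two_ne_zero_of_xi hξ
  have hx : x ξ = x ξ * 1 := (mul_one _).symm
  have hy : y ξ = y ξ * 1 := (mul_one _).symm
  have ex : deriv hξ 1 0 (x ξ) = 1 := by
    rw [hx, deriv_x_mul]
    simp [actEntry_one, deriv_one]
  have ey : deriv hξ 1 0 (y ξ) = 0 := by
    rw [hy, deriv_y_mul]
    simp [actEntry_one, deriv_one]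
  simp only [combination, map_add, map_smul, deriv_one, ex, ey, deriv_x_mul, deriv_y_mul,
    actEntry_zero_y_mul, actEntry_one_y_mul, actEntry_y, Matrix.of_apply, Matrix.cons_val',
    Matrix.cons_val_zero, Matrix.cons_val_one, Matrix.cons_val_fin_one, Matrix.cons_val, mul_add,
    mul_sub, mul_neg, neg_mul, mul_smul_comm, smul_add, smul_neg, smul_sub, mul_assoc, x_mul_x,
    x_mul_x', y_mul_x hξ, y_mul_x' hξ, mul_zero, smul_zero, mul_one, smul_smul]
  match_scalars <;> field_simp <;> grind

theorem derivY_combination (c : Fin 8 → k) : deriv hξ 0 1 (combination ξ c) =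
    combination ξ ![c 1, (1 + ξ) * c 2, ξ * c 3, 0, ξ * c 5, (ξ - 1) * c 6, -c 7, 0] := by
  have h1 := KAlg.xi_sq hξ
  have h2 := two_ne_zero_of_xi hξ
  have hx : x ξ = x ξ * 1 := (mul_one _).symm
  have hy : y ξ = y ξ * 1 := (mul_one _).symm
  have ex : deriv hξ 0 1 (x ξ) = 0 := by
    rw [hx, deriv_x_mul]
    simp [actEntry_one, deriv_one]
  have ey : deriv hξ 0 1 (y ξ) = 1 := by
    rw [hy, deriv_y_mul]
    simp [actEntry_one, deriv_one]
  simp only [combination, map_add, map_smul, deriv_one, ex, ey, deriv_x_mul, deriv_y_mul,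
    actEntry_zero_y_mul, actEntry_one_y_mul, actEntry_y, Matrix.of_apply, Matrix.cons_val',
    Matrix.cons_val_zero, Matrix.cons_val_one, Matrix.cons_val_fin_one, Matrix.cons_val, mul_add,
    mul_sub, mul_neg, mul_smul_comm, smul_add, smul_neg, smul_sub, mul_assoc, x_mul_x, x_mul_x',
    y_mul_x hξ, y_mul_x' hξ, mul_zero, smul_zero, mul_one, smul_smul]
  match_scalars <;> field_simp <;> grind

theorem combination_sub_smul_one (c : Fin 8 → k) (r : k) :
    combination ξ c - r • 1 = combination ξ ![c 0 - r, c 1, c 2, c 3, c 4, c 5, c 6, c 7] := by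
  simp only [combination, Matrix.cons_val, Matrix.cons_val_zero, Matrix.cons_val_one]
  module

/-- A nonzero subspace stable under the skew derivations contains `1`. -/
theorem eq_zero_of_combination_mem (I : Submodule k (B21Alg ξ))
    (hX : ∀ r ∈ I, deriv hξ 1 0 r ∈ I) (hY : ∀ r ∈ I, deriv hξ 0 1 r ∈ I)
    (h1 : (1 : B21Alg ξ) ∉ I) (c : Fin 8 → k) (hc : combination ξ c ∈ I) : c = 0 := by
  have hξ2 := KAlg.xi_sq hξ
  have h2 := two_ne_zero_of_xi hξ
  have h0 : ξ ≠ 0 := fun h => by simp [h] at hξ2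
  -- Here `(1 - ξ)(1 + ξ) = 1 - ξ² = 2`.
  have hp : 1 + ξ ≠ 0 := fun h => h2 (by linear_combination (1 - ξ) * h + hξ2)
  have hs : ∀ r : k, r • (1 : B21Alg ξ) ∈ I → r = 0 := fun r hr => by
    by_contra h
    exact h1 ((I.smul_mem_iff h).1 hr)
  have dX := fun c h => (derivX_combination hξ c) ▸ hX (combination ξ c) h
  have dY := fun c h => (derivY_combination hξ c) ▸ hY (combination ξ c) h
  -- The coefficients are eliminated from the top degree down. Once the higher ones vanish, a string
  -- of as many derivations as the degree of the monomial gives a scalar multiple of `1`, which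
  -- isolates one coefficient up to a nonzero factor.
  have c7 : c 7 = 0 := by
    have := dY _ (dY _ (dY _ (dX _ hc)))
    simp [combination] at this
    have := hs _ this
    simpa [h0, hp] using this
  have c6 : c 6 = 0 := by
    have := dY _ (dY _ (dX _ hc))
    simp [combination, c7] at this
    have := hs _ this
    simpa [h0, hp] using this
  have c3 : c 3 = 0 := by
    have := dX _ (dY _ (dX _ hc))
    simp [combination, c6, c7] at this
    have := hs _ this
    simpa [h0, hp, h2] using this
  have c5 : c 5 = 0 := by
    have := dY _ (dX _ hc)
    simp [combination, c3, c6, c7] at this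
    have := hs _ this
    simpa [h0, hp, h2] using this
  have c2 : c 2 = 0 := by
    have := dX _ (dX _ hc)
    simp [combination, c3, c5, c6, c7] at this
    have := hs _ this
    have hp' : -ξ + -1 ≠ 0 := fun h => hp (by linear_combination -h)
    simpa [h0, hp, hp', h2] using this
  have c4 : c 4 = 0 := by
    have := dX _ hc
    simp [combination, c2, c3, c5, c6, c7] at this
    exact hs _ this
  have c1 : c 1 = 0 := by
    have := dY _ hc
    simp [combination, c2, c3, c5, c6, c7] at this
    exact hs _ this
  have c0 : c 0 = 0 := by
    simp [combination, c1, c2, c3, c4, c5, c6, c7] at hc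
    exact hs _ hc
  ext i
  fin_cases i <;> assumption

theorem eq_bot_of_deriv_mem (I : Submodule k (B21Alg ξ))
    (hX : ∀ r ∈ I, deriv hξ 1 0 r ∈ I) (hY : ∀ r ∈ I, deriv hξ 0 1 r ∈ I)
    (h1 : (1 : B21Alg ξ) ∉ I) : I = ⊥ := by
  refine (Submodule.eq_bot_iff I).2 fun r hr => ?_
  obtain ⟨c, rfl⟩ := exists_combination hξ r
  rw [eq_zero_of_combination_mem hξ I hX hY h1 c hr]
  simp [combination]

theorem one_ne_zero' : (1 : B21Alg ξ) ≠ 0 := fun h => by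
  simpa using congrArg (counit ξ) h

/-- The zero subspace is stable under the derivations, and it omits `1` because the counit of `1` is
`1`. -/
theorem combination_eq_zero (hξ : IsPrimitiveRoot ξ 4) {c : Fin 8 → k}
    (hc : combination ξ c = 0) : c = 0 :=
  eq_zero_of_combination_mem hξ ⊥ (by simp) (by simp) (by simpa using one_ne_zero') c (by simpa)

theorem linearIndependent_monomial (hξ : IsPrimitiveRoot ξ 4) :
    LinearIndependent k (monomial ξ) :=
  Fintype.linearIndependent_iff.2 fun c hc =>
    congrFun (combination_eq_zero hξ (by rwa [combination_eq_sum]))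

theorem finrank_eq_eight (hξ : IsPrimitiveRoot ξ 4) : Module.finrank k (B21Alg ξ) = 8 := by
  rw [Module.finrank_eq_card_basis (Module.Basis.mk (linearIndependent_monomial hξ)
    (span_monomial hξ).ge), Fintype.card_fin]

/-- An element whose skew derivatives are constant has degree at most one. -/
theorem exists_of_deriv_eq_smul_one {r : B21Alg ξ} {α β : k} (hX : deriv hξ 1 0 r = α • 1)
    (hY : deriv hξ 0 1 r = β • 1) : ∃ a : k, r = a • 1 + β • y ξ + α • x ξ := by
  have hξ2 := KAlg.xi_sq hξ
  have h2 := two_ne_zero_of_xi hξ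
  have h0 : ξ ≠ 0 := fun h => by simp [h] at hξ2
  have hp : 1 + ξ ≠ 0 := fun h => h2 (by linear_combination (1 - ξ) * h + hξ2)
  have hp' : -ξ + -1 ≠ 0 := fun h => hp (by linear_combination -h)
  obtain ⟨c, rfl⟩ := exists_combination hξ r
  rw [derivX_combination] at hX
  rw [derivY_combination] at hY
  have eX := combination_eq_zero hξ ((combination_sub_smul_one _ α).symm.trans (sub_eq_zero.2 hX))
  have eY := combination_eq_zero hξ ((combination_sub_smul_one _ β).symm.trans (sub_eq_zero.2 hY))
  have c1 : c 1 = β := by simpa [sub_eq_zero] using congrFun eY 0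
  have c4 : c 4 = α := by simpa [sub_eq_zero] using congrFun eX 0
  have c5 : c 5 = 0 := by simpa [h0] using congrFun eX 1
  have c6 : c 6 = 0 := by simpa using congrFun eX 2
  have c7 : c 7 = 0 := by simpa [h0] using congrFun eX 3
  have c2 : c 2 = 0 := by simpa [hp, hp', h2] using congrFun eX 4
  have c3 : c 3 = 0 := by simpa [hp, h2] using congrFun eX 5
  refine ⟨c 0, ?_⟩
  simp [combination, c1, c2, c3, c4, c5, c6, c7]

end Basis

/-! ### Primitive elements. -/

section Primitive

theorem comul_x : comul hξ (x ξ) = x ξ ⊗ₜ 1 + 1 ⊗ₜ x ξ := by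
  rw [← mul_one (x ξ), comul_x_mul, comul_one, comulMul_x]
  simp [opX_apply, opY_apply, actEntry_one]

theorem comul_y : comul hξ (y ξ) = y ξ ⊗ₜ 1 + 1 ⊗ₜ y ξ := by
  rw [← mul_one (y ξ), comul_y_mul, comul_one, comulMul_y]
  simp [opX_apply, opY_apply, actEntry_one]

/-- The skew derivatives of a primitive element are scalars, so it lies in the span of `1`, `x` and
`y`; its counit is zero, which removes the constant term. -/
theorem primitive_iff (r : B21Alg ξ) :
    r ∈ Submodule.span k {x ξ, y ξ} ↔ comul hξ r = r ⊗ₜ 1 + 1 ⊗ₜ r := by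
  constructor
  · intro hr
    obtain ⟨a, b, rfl⟩ := Submodule.mem_span_pair.1 hr
    simp only [map_add, map_smul, comul_x, comul_y, TensorProduct.add_tmul, TensorProduct.tmul_add,
      TensorProduct.tmul_smul, ← TensorProduct.smul_tmul']
    module
  · intro hr
    have hd : ∀ α β, deriv hξ α β r = coord ξ α β r • 1 := fun α β => by
      rw [deriv_apply, hr]
      simp [coord_one]
    have hc : counit ξ r = 0 := by
      have h := rid_lTensor_counit_comul hξ r
      rw [hr] at h
      simpa using congrArg (counit ξ) h
    obtain ⟨a, ha⟩ := exists_of_deriv_eq_smul_one hξ (hd 1 0) (hd 0 1)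
    have ha0 : a = 0 := by
      rw [ha] at hc
      simpa [counit_x, counit_y] using hc
    rw [ha, ha0, zero_smul, zero_add]
    exact add_mem (Submodule.smul_mem _ _ (Submodule.subset_span (by simp)))
      (Submodule.smul_mem _ _ (Submodule.subset_span (by simp)))

end Primitive

end B21Alg

namespace B21Alg

variable {k : Type u} [Field k] {ξ : k} (hξ : IsPrimitiveRoot ξ 4)

/-! ### The grading. -/

section Grading

variable (ξ) in
/-- The homogeneous components of `B21`. -/
noncomputable def deg (n : ℕ) : Submodule k (B21Alg ξ) := Submodule.span k {x ξ, y ξ} ^ n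

theorem x_mem : x ξ ∈ Submodule.span k {x ξ, y ξ} := Submodule.subset_span (by simp)

theorem y_mem : y ξ ∈ Submodule.span k {x ξ, y ξ} := Submodule.subset_span (by simp)

theorem deg_one : deg ξ 1 = Submodule.span k {x ξ, y ξ} := pow_one _

theorem x_mul_mem {n : ℕ} {s : B21Alg ξ} (hs : s ∈ deg ξ n) : x ξ * s ∈ deg ξ (n + 1) := by
  rw [deg, pow_succ']
  exact Submodule.mul_mem_mul x_mem hs

theorem y_mul_mem {n : ℕ} {s : B21Alg ξ} (hs : s ∈ deg ξ n) : y ξ * s ∈ deg ξ (n + 1) := by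
  rw [deg, pow_succ']
  exact Submodule.mul_mem_mul y_mem hs

theorem mul_x_mem {n : ℕ} {s : B21Alg ξ} (hs : s ∈ deg ξ n) : s * x ξ ∈ deg ξ (n + 1) := by
  rw [deg, pow_succ]
  exact Submodule.mul_mem_mul hs x_mem

theorem mul_y_mem {n : ℕ} {s : B21Alg ξ} (hs : s ∈ deg ξ n) : s * y ξ ∈ deg ξ (n + 1) := by
  rw [deg, pow_succ]
  exact Submodule.mul_mem_mul hs y_mem

theorem one_mem_deg : (1 : B21Alg ξ) ∈ deg ξ 0 := by
  rw [deg, pow_zero]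
  exact Submodule.one_le.1 le_rfl

-- The graded form of `B21Alg.induction`: each left multiplication raises the degree by one.
@[elab_as_elim]
theorem deg_induction {C : ∀ (n : ℕ) (r : B21Alg ξ), r ∈ deg ξ n → Prop} (one : C 0 1 one_mem_deg)
    (smul : ∀ n (c : k) r (hr : r ∈ deg ξ n), C n r hr → C n (c • r) (Submodule.smul_mem _ c hr))
    (add : ∀ n r s (hr : r ∈ deg ξ n) (hs : s ∈ deg ξ n), C n r hr → C n s hs →
      C n (r + s) (add_mem hr hs))
    (x_mul : ∀ n s (hs : s ∈ deg ξ n), C n s hs → C (n + 1) (x ξ * s) (x_mul_mem hs))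
    (y_mul : ∀ n s (hs : s ∈ deg ξ n), C n s hs → C (n + 1) (y ξ * s) (y_mul_mem hs)) {n : ℕ}
    {r : B21Alg ξ} (hr : r ∈ deg ξ n) : C n r hr := by
  induction hr using Submodule.pow_induction_on_left' with
  | algebraMap r =>
    simp only [Algebra.algebraMap_eq_smul_one]
    exact smul _ _ _ _ one
  | add x y i hx hy ihx ihy => exact add _ _ _ _ _ ihx ihy
  | mem_mul m hm i s hs ih =>
    obtain ⟨a, b, rfl⟩ := Submodule.mem_span_pair.1 hm
    simp only [add_mul, smul_mul_assoc]
    exact add _ _ _ _ _ (smul _ _ _ _ (x_mul _ _ _ ih)) (smul _ _ _ _ (y_mul _ _ _ ih))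

instance : SetLike.GradedMonoid (deg ξ) :=
  inferInstanceAs (SetLike.GradedMonoid (Submodule.span k {x ξ, y ξ} ^ ·))

open DirectSum in
/-- The algebra map from `B21` to the direct sum of its homogeneous components. -/
noncomputable def toDirectSum (hξ : IsPrimitiveRoot ξ 4) : B21Alg ξ →ₐ[k] ⨁ n, deg ξ n :=
  lift (of (fun n => deg ξ n) 1 ⟨x ξ, by rw [deg_one]; exact x_mem⟩)
    (of (fun n => deg ξ n) 1 ⟨y ξ, by rw [deg_one]; exact y_mem⟩)
    -- Each relation is homogeneous, so it can be checked inside a single component.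
    (by
      rw [of_mul_of, ← map_zero (of (fun n => deg ξ n) (1 + 1))]
      congr 1
      exact Subtype.ext x_mul_x)
    (by
      rw [of_mul_of, of_mul_of, ← lof_eq_of k, ← lof_eq_of k, ← map_smul, ← map_add,
        ← map_zero (lof k ℕ (fun n => deg ξ n) (1 + 1))]
      congr 1
      exact Subtype.ext x_mul_y_add)
    (by
      have e : ∀ z : ⨁ n, deg ξ n, z ^ 4 = z * (z * (z * z)) := fun z => by noncomm_ring
      rw [e, of_mul_of, of_mul_of, of_mul_of,
        ← map_zero (of (fun n => deg ξ n) (1 + (1 + (1 + 1))))]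
      congr 1
      exact Subtype.ext y_pow)

/-- The map `toDirectSum` inverts summation: in one direction both maps agree on `x` and `y`, in the
other the claim is an induction on homogeneous elements. -/
noncomputable instance gradedAlgebra [Fact (IsPrimitiveRoot ξ 4)] : GradedAlgebra (deg ξ) :=
  GradedAlgebra.ofAlgHom _ (toDirectSum Fact.out)
    (by
      apply algHom_ext <;> simp [toDirectSum])
    (by
      rintro n ⟨r, hr⟩
      induction hr using deg_induction with
      | one => exact map_one _
      | smul n c r hr ih =>
        rw [map_smul, ih, ← DirectSum.lof_eq_of k, ← map_smul]
        rfl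
      | add n r s hr hs ihr ihs =>
        rw [map_add, ihr, ihs, ← map_add]
        rfl
      | x_mul n s hs ih =>
        rw [map_mul, ih, toDirectSum, lift_x, DirectSum.of_mul_of]
        exact DirectSum.of_eq_of_gradedMonoid_eq (Sigma.subtype_ext (add_comm _ _) rfl)
      | y_mul n s hs ih =>
        rw [map_mul, ih, toDirectSum, lift_y, DirectSum.of_mul_of]
        exact DirectSum.of_eq_of_gradedMonoid_eq (Sigma.subtype_ext (add_comm _ _) rfl))

theorem deg_isInternal (hξ : IsPrimitiveRoot ξ 4) : DirectSum.IsInternal (deg ξ) :=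
  haveI : Fact (IsPrimitiveRoot ξ 4) := ⟨hξ⟩
  DirectSum.Decomposition.isInternal (deg ξ)

theorem actEntry_mem (i j : Fin 2) {n : ℕ} {r : B21Alg ξ} (hr : r ∈ deg ξ n) :
    actEntry hξ i j r ∈ deg ξ n := by
  -- All entries are treated at once, because the step for `y` mixes the two rows.
  suffices h : ∀ i j, actEntry hξ i j r ∈ deg ξ n from h i j
  induction hr using deg_induction with
  | one =>
    intro i j
    rw [actEntry_one, Matrix.one_apply]
    split_ifs
    exacts [one_mem_deg, zero_mem _]
  | smul n c r hr ih =>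
    intro i j
    rw [map_smul]
    exact Submodule.smul_mem _ _ (ih i j)
  | add n r s hr hs ihr ihs =>
    intro i j
    rw [map_add]
    exact add_mem (ihr i j) (ihs i j)
  | x_mul n s hs ih =>
    intro i j
    rw [actEntry_x_mul]
    exact neg_mem (x_mul_mem (ih i j))
  | y_mul n s hs ih =>
    intro i j
    fin_cases i
    · change actEntry hξ 0 j _ ∈ _
      rw [actEntry_zero_y_mul]
      exact add_mem (Submodule.smul_mem _ _ (y_mul_mem (ih 0 j))) (x_mul_mem (ih 1 j))
    · change actEntry hξ 1 j _ ∈ _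
      rw [actEntry_one_y_mul]
      exact sub_mem (x_mul_mem (ih 0 j)) (Submodule.smul_mem _ _ (y_mul_mem (ih 1 j)))

theorem act_mem (n : ℕ) (h : KAlg hξ) (r : B21Alg ξ) (hr : r ∈ deg ξ n) :
    act hξ h r ∈ deg ξ n := by
  induction h using KAlg.induction_genMatrix generalizing r with
  | hs c => simpa using Submodule.smul_mem _ _ hr
  | hg i j =>
    rw [act_genMatrix]
    exact actEntry_mem hξ i j hr
  | hm a b ha hb =>
    rw [map_mul, Module.End.mul_apply]
    exact ha _ (hb _ hr)
  | ha a b ha hb =>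
    rw [map_add, LinearMap.add_apply]
    exact add_mem (ha _ hr) (hb _ hr)

theorem tmul_mem_range_lTensor (h : KAlg hξ) {n : ℕ} {r : B21Alg ξ} (hr : r ∈ deg ξ n) :
    h ⊗ₜ r ∈ LinearMap.range ((deg ξ n).subtype.lTensor (KAlg hξ)) :=
  ⟨h ⊗ₜ ⟨r, hr⟩, rfl⟩

theorem coact_mem (n : ℕ) (r : B21Alg ξ) (hr : r ∈ deg ξ n) :
    coact hξ r ∈ LinearMap.range ((deg ξ n).subtype.lTensor (KAlg hξ)) := by
  induction hr using deg_induction with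
  | one =>
    rw [map_one]
    exact tmul_mem_range_lTensor hξ 1 one_mem_deg
  | smul n c r hr ih =>
    rw [map_smul]
    exact Submodule.smul_mem _ _ ih
  | add n r s hr hs ihr ihs =>
    rw [map_add]
    exact add_mem ihr ihs
  | x_mul n s hs ih =>
    rw [map_mul, coact_x]
    obtain ⟨w, hw⟩ := ih
    rw [← hw]
    clear hw
    induction w with
    | zero => simp
    | add z w hz hw =>
      rw [map_add, mul_add]
      exact add_mem hz hw
    | tmul h t =>
      rw [LinearMap.lTensor_tmul, coactX, add_mul, smul_mul_assoc,
        Algebra.TensorProduct.tmul_mul_tmul, Algebra.TensorProduct.tmul_mul_tmul]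
      exact add_mem (tmul_mem_range_lTensor hξ _ (x_mul_mem t.2))
        (Submodule.smul_mem _ _ (tmul_mem_range_lTensor hξ _ (y_mul_mem t.2)))
  | y_mul n s hs ih =>
    rw [map_mul, coact_y]
    obtain ⟨w, hw⟩ := ih
    rw [← hw]
    clear hw
    induction w with
    | zero => simp
    | add z w hz hw =>
      rw [map_add, mul_add]
      exact add_mem hz hw
    | tmul h t =>
      rw [LinearMap.lTensor_tmul, coactY, add_mul, smul_mul_assoc,
        Algebra.TensorProduct.tmul_mul_tmul, Algebra.TensorProduct.tmul_mul_tmul]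
      exact add_mem (tmul_mem_range_lTensor hξ _ (y_mul_mem t.2))
        (Submodule.smul_mem _ _ (tmul_mem_range_lTensor hξ _ (x_mul_mem t.2)))

variable (ξ) in
/-- The homogeneous components of `B21 ⊗ B21`. -/
noncomputable def tensorDeg (n : ℕ) : Submodule k (B21Alg ξ ⊗[k] B21Alg ξ) :=
  ⨆ p ∈ Finset.HasAntidiagonal.antidiagonal n,
    LinearMap.range (TensorProduct.map (deg ξ p.1).subtype (deg ξ p.2).subtype)

theorem tmul_mem_tensorDeg {i j n : ℕ} (hn : i + j = n) {r s : B21Alg ξ} (hr : r ∈ deg ξ i)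
    (hs : s ∈ deg ξ j) : r ⊗ₜ s ∈ tensorDeg ξ n :=
  Submodule.mem_iSup_of_mem (i, j) (Submodule.mem_iSup_of_mem
    (Finset.HasAntidiagonal.mem_antidiagonal.2 hn) ⟨⟨r, hr⟩ ⊗ₜ ⟨s, hs⟩, rfl⟩)

theorem tensorDeg_le {n : ℕ} {S : Submodule k (B21Alg ξ ⊗[k] B21Alg ξ)}
    (h : ∀ i j, i + j = n → ∀ r ∈ deg ξ i, ∀ s ∈ deg ξ j, r ⊗ₜ s ∈ S) : tensorDeg ξ n ≤ S := by
  refine iSup₂_le fun p hp => ?_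
  rintro _ ⟨w, rfl⟩
  induction w with
  | zero => simp
  | add z w hz hw =>
    rw [map_add]
    exact add_mem hz hw
  | tmul r s => exact h _ _ (Finset.HasAntidiagonal.mem_antidiagonal.1 hp) _ r.2 _ s.2

theorem comul_mem (n : ℕ) (r : B21Alg ξ) (hr : r ∈ deg ξ n) : comul hξ r ∈ tensorDeg ξ n := by
  induction hr using deg_induction with
  | one =>
    rw [comul_one]
    exact tmul_mem_tensorDeg (zero_add 0) one_mem_deg one_mem_deg
  | smul n c r hr ih =>
    rw [map_smul]
    exact Submodule.smul_mem _ _ ih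
  | add n r s hr hs ihr ihs =>
    rw [map_add]
    exact add_mem ihr ihs
  | x_mul n s hs ih =>
    rw [comul_x_mul]
    -- It suffices that multiplication by `Δ(x)` raises the total degree by one, and this is checked
    -- on pure tensors.
    refine tensorDeg_le (S := (tensorDeg ξ (n + 1)).comap (comulMul hξ (x ξ)))
      (fun i j hij r hr s hs => ?_) ih
    rw [Submodule.mem_comap, comulMul_x]
    exact add_mem (add_mem (tmul_mem_tensorDeg (by omega) (x_mul_mem hr) hs)
      (tmul_mem_tensorDeg (by omega) (actEntry_mem hξ 1 1 hr) (x_mul_mem hs)))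
      (Submodule.smul_mem _ _
        (tmul_mem_tensorDeg (by omega) (actEntry_mem hξ 1 0 hr) (y_mul_mem hs)))
  | y_mul n s hs ih =>
    rw [comul_y_mul]
    refine tensorDeg_le (S := (tensorDeg ξ (n + 1)).comap (comulMul hξ (y ξ)))
      (fun i j hij r hr s hs => ?_) ih
    rw [Submodule.mem_comap, comulMul_y]
    exact add_mem (add_mem (tmul_mem_tensorDeg (by omega) (y_mul_mem hr) hs)
      (tmul_mem_tensorDeg (by omega) (actEntry_mem hξ 0 0 hr) (y_mul_mem hs)))
      (Submodule.smul_mem _ _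
        (tmul_mem_tensorDeg (by omega) (actEntry_mem hξ 0 1 hr) (x_mul_mem hs)))

theorem counit_eq_zero (n : ℕ) (hn : n ≠ 0) (r : B21Alg ξ) (hr : r ∈ deg ξ n) :
    counit ξ r = 0 := by
  revert hn
  induction hr using deg_induction with
  | one => exact fun h => absurd rfl h
  | smul n c r hr ih => exact fun h => by rw [map_smul, ih h, smul_zero]
  | add n r s hr hs ihr ihs => exact fun h => by rw [map_add, ihr h, ihs h, add_zero]
  | x_mul n s hs ih => exact fun _ => by rw [map_mul, counit_x, zero_mul]
  | y_mul n s hs ih => exact fun _ => by rw [map_mul, counit_y, zero_mul]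

theorem antipode_mem (n : ℕ) (r : B21Alg ξ) (hr : r ∈ deg ξ n) : antipode hξ r ∈ deg ξ n := by
  induction hr using deg_induction with
  | one =>
    rw [antipode_one]
    exact one_mem_deg
  | smul n c r hr ih =>
    rw [map_smul]
    exact Submodule.smul_mem _ _ ih
  | add n r s hr hs ihr ihs =>
    rw [map_add]
    exact add_mem ihr ihs
  | x_mul n s hs ih =>
    rw [antipode_x_mul, antipodeX_apply]
    exact neg_mem (add_mem (mul_x_mem (actEntry_mem hξ 1 1 ih))
      (Submodule.smul_mem _ _ (mul_y_mem (actEntry_mem hξ 1 0 ih))))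
  | y_mul n s hs ih =>
    rw [antipode_y_mul, antipodeY_apply]
    exact neg_mem (add_mem (mul_y_mem (actEntry_mem hξ 0 0 ih))
      (Submodule.smul_mem _ _ (mul_x_mem (actEntry_mem hξ 0 1 ih))))

end Grading

/-! ### The Nichols algebra structure. -/

section Nichols

variable (ξ) in
/-- The inclusion of `V_{2,1}` in `B21`. -/
noncomputable def ι : (Fin 2 → k) →ₗ[k] B21Alg ξ :=
  (LinearMap.proj 0).smulRight (x ξ) + (LinearMap.proj 1).smulRight (y ξ)

theorem ι_apply (v : Fin 2 → k) : ι ξ v = v 0 • x ξ + v 1 • y ξ := rfl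

theorem ι_e₁ : ι ξ (e₁ k) = x ξ := by simp [ι_apply, e₁]

theorem ι_e₂ : ι ξ (e₂ k) = y ξ := by simp [ι_apply, e₂]

theorem ι_injective (hξ : IsPrimitiveRoot ξ 4) : Function.Injective (ι ξ) := by
  refine (injective_iff_map_eq_zero _).2 fun v hv => ?_
  have h := combination_eq_zero hξ (c := ![0, v 1, 0, 0, v 0, 0, 0, 0])
    (by rw [← hv, ι_apply]; simp [combination, add_comm])
  ext i
  fin_cases i
  · simpa using congrFun h 4
  · simpa using congrFun h 1

theorem ι_range : LinearMap.range (ι ξ) = deg ξ 1 := by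
  ext r
  rw [deg_one, Submodule.mem_span_pair]
  constructor
  · rintro ⟨v, rfl⟩
    exact ⟨v 0, v 1, rfl⟩
  · rintro ⟨a, b, rfl⟩
    exact ⟨![a, b], by simp [ι_apply]⟩

theorem ι_isYDHom : IsYDHom (V21 hξ) (ydModule hξ) (ι ξ) where
  map_act h m := by
    refine KAlg.map_act (v21Act hξ) (act hξ) (ι ξ) (fun i j m => ?_) h m
    refine LinearMap.congr_fun (f := ι ξ ∘ₗ v21Act hξ (KAlg.genMatrix hξ i j))
      (g := act hξ (KAlg.genMatrix hξ i j) ∘ₗ ι ξ) (v21_ext ?_ ?_) m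
    · rw [LinearMap.comp_apply, LinearMap.comp_apply, ι_e₁, act_genMatrix, actEntry_x]
      fin_cases i <;> fin_cases j <;> simp [KAlg.genMatrix, v21Act_e₁, v21Mat, ι_e₁]
    · rw [LinearMap.comp_apply, LinearMap.comp_apply, ι_e₂, act_genMatrix, actEntry_y]
      fin_cases i <;> fin_cases j <;> simp [KAlg.genMatrix, v21Act_e₂, v21Mat, ι_e₁, ι_e₂]
  map_coact m := by
    refine LinearMap.congr_fun (f := (coact hξ).toLinearMap ∘ₗ ι ξ)
      (g := (ι ξ).lTensor _ ∘ₗ v21Coact hξ) (v21_ext ?_ ?_) m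
    · simp [ι_e₁, ι_e₂, coact_x, coactX, v21Coact_e₁]
    · simp [ι_e₁, ι_e₂, coact_y, coactY, v21Coact_e₂]

theorem adjoin_deg_one : Algebra.adjoin k (deg ξ 1 : Set (B21Alg ξ)) = ⊤ := by
  refine eq_top_iff.2 fun s _ => ?_
  have hx : x ξ ∈ Algebra.adjoin k (deg ξ 1 : Set (B21Alg ξ)) :=
    Algebra.subset_adjoin (by rw [deg_one]; exact x_mem)
  have hy : y ξ ∈ Algebra.adjoin k (deg ξ 1 : Set (B21Alg ξ)) :=
    Algebra.subset_adjoin (by rw [deg_one]; exact y_mem)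
  induction s using B21Alg.induction with
  | one => exact one_mem _
  | smul c s hs => exact Subalgebra.smul_mem _ (hs trivial) _
  | add s t hs ht => exact add_mem (hs trivial) (ht trivial)
  | x_mul s hs => exact mul_mem hx (hs trivial)
  | y_mul s hs => exact mul_mem hy (hs trivial)

/-- The structure of a Nichols algebra of `V_{2,1}` on `B21`. -/
noncomputable def nicholsAlgebra : NicholsAlgebra (V21 hξ) (B21Alg ξ) where
  toYDHopfAlgebra := ydHopfAlgebra hξ
  deg := deg ξ
  deg_isInternal := deg_isInternal hξ
  deg_gradedMonoid := inferInstance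
  act_mem := act_mem hξ
  coact_mem := coact_mem hξ
  comul_mem := comul_mem hξ
  counit_eq_zero := counit_eq_zero
  antipode_mem := antipode_mem hξ
  deg_zero := by rw [deg, pow_zero, Submodule.one_eq_span]
  ι := ι ξ
  ι_injective := ι_injective hξ
  ι_range := ι_range
  ι_hom := ι_isYDHom hξ
  mem_deg_one_iff r := by
    rw [deg_one]
    exact primitive_iff hξ r
  adjoin_deg_one := adjoin_deg_one

end Nichols

end B21Alg

/-- `B21Alg ξ` and its algebra structure unfold to those of `B21 ξ`, so the structure is transferred
as it is. -/
theorem exists_nicholsAlgebra_b21 {k : Type u} [Field k] {ξ : k} (hξ : IsPrimitiveRoot ξ 4) :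
    ∃ N : NicholsAlgebra (V21 hξ) (B21 ξ), N.ι (e₁ k) = B21.x ξ ∧ N.ι (e₂ k) = B21.y ξ :=
  ⟨B21Alg.nicholsAlgebra hξ, B21Alg.ι_e₁, B21Alg.ι_e₂⟩

namespace NicholsAlgebra

variable {k : Type u} [Field k] {ξ : k} {hξ : IsPrimitiveRoot ξ 4} {R : Type w} [Ring R]
  [Algebra k R] (N : NicholsAlgebra (V21 hξ) R)

open KAlg (genMatrix)

/-! ### An arbitrary Nichols algebra: formulas on the generators. -/

section Generators

/-- The image of `e₁` in a Nichols algebra of `V_{2,1}`. -/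
def X : R := N.ι (e₁ k)

/-- The image of `e₂` in a Nichols algebra of `V_{2,1}`. -/
def Y : R := N.ι (e₂ k)

theorem X_mem : N.X ∈ N.deg 1 := N.ι_range ▸ LinearMap.mem_range_self _ _

theorem Y_mem : N.Y ∈ N.deg 1 := N.ι_range ▸ LinearMap.mem_range_self _ _

theorem mul_mem_deg {m n : ℕ} {r s : R} (hr : r ∈ N.deg m) (hs : s ∈ N.deg n) :
    r * s ∈ N.deg (m + n) :=
  haveI := N.deg_gradedMonoid
  SetLike.mul_mem_graded hr hs

theorem comul_X : N.comul N.X = N.X ⊗ₜ 1 + 1 ⊗ₜ N.X := (N.mem_deg_one_iff _).1 N.X_mem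

theorem comul_Y : N.comul N.Y = N.Y ⊗ₜ 1 + 1 ⊗ₜ N.Y := (N.mem_deg_one_iff _).1 N.Y_mem

theorem act_X (i j : Fin 2) : N.act (genMatrix hξ i j) N.X =
    (!![-N.X, 0; 0, -N.X] : Matrix (Fin 2) (Fin 2) R) i j := by
  rw [X, ← N.ι_hom.map_act]
  change N.ι (v21Act hξ _ _) = _
  fin_cases i <;> fin_cases j <;> simp [genMatrix, v21Act_e₁, v21Mat]

theorem act_Y (i j : Fin 2) : N.act (genMatrix hξ i j) N.Y =
    (!![ξ • N.Y, N.X; N.X, -(ξ • N.Y)] : Matrix (Fin 2) (Fin 2) R) i j := by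
  rw [X, Y, ← N.ι_hom.map_act]
  change N.ι (v21Act hξ _ _) = _
  fin_cases i <;> fin_cases j <;> simp [genMatrix, v21Act_e₂, v21Mat]

theorem act_genMatrix_one (i j : Fin 2) :
    N.act (genMatrix hξ i j) 1 = (1 : Matrix (Fin 2) (Fin 2) R) i j := by
  rw [N.act_one, KAlg.counit_genMatrix, Matrix.one_apply, Matrix.one_apply]
  split_ifs <;> simp

theorem act_genMatrix_mul (i j : Fin 2) (r s : R) : N.act (genMatrix hξ i j) (r * s) =
    ∑ l, N.act (genMatrix hξ i l) r * N.act (genMatrix hξ l j) s := by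
  have h := N.act_mul (genMatrix hξ i j) (r ⊗ₜ s)
  rw [ydTensorAct_genMatrix] at h
  simpa using h

theorem coact_X : N.coact N.X = genMatrix hξ 1 1 ⊗ₜ N.X + (ξ - 1) • genMatrix hξ 1 0 ⊗ₜ N.Y := by
  rw [X, Y, N.ι_hom.map_coact]
  change (N.ι).lTensor _ (v21Coact hξ _) = _
  simp [v21Coact_e₁, genMatrix]

theorem coact_Y : N.coact N.Y =
    genMatrix hξ 0 0 ⊗ₜ N.Y + (-(1 + ξ) / 2) • genMatrix hξ 0 1 ⊗ₜ N.X := by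
  rw [X, Y, N.ι_hom.map_coact]
  change (N.ι).lTensor _ (v21Coact hξ _) = _
  simp [v21Coact_e₂, genMatrix]

/-- The same recursion as `comulMul_x`. It needs only that `X` is primitive and that its coaction
comes from `V_{2,1}`. -/
theorem comul_X_mul (s : R) : N.comul (N.X * s) =
    TensorProduct.map (LinearMap.mulLeft k N.X) LinearMap.id (N.comul s) +
    TensorProduct.map (N.act (genMatrix hξ 1 1)) (LinearMap.mulLeft k N.X) (N.comul s) +
    (ξ - 1) •
      TensorProduct.map (N.act (genMatrix hξ 1 0)) (LinearMap.mulLeft k N.Y) (N.comul s) := by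
  rw [N.comul_mul, comul_X]
  generalize N.comul s = u
  induction u with
  | zero => simp
  | add z w hz hw =>
    simp only [map_add, TensorProduct.tmul_add, smul_add] at hz hw ⊢
    linear_combination (norm := module) hz + hw
  | tmul p q =>
    rw [TensorProduct.add_tmul, map_add, braidedTensorMul_tmul, braidedTensorMul_tmul,
      N.coact_one, coact_X]
    simp [add_assoc]

theorem comul_Y_mul (s : R) : N.comul (N.Y * s) =
    TensorProduct.map (LinearMap.mulLeft k N.Y) LinearMap.id (N.comul s) +
    TensorProduct.map (N.act (genMatrix hξ 0 0)) (LinearMap.mulLeft k N.Y) (N.comul s) +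
    (-(1 + ξ) / 2) •
      TensorProduct.map (N.act (genMatrix hξ 0 1)) (LinearMap.mulLeft k N.X) (N.comul s) := by
  rw [N.comul_mul, comul_Y]
  generalize N.comul s = u
  induction u with
  | zero => simp
  | add z w hz hw =>
    simp only [map_add, TensorProduct.tmul_add, smul_add] at hz hw ⊢
    linear_combination (norm := module) hz + hw
  | tmul p q =>
    rw [TensorProduct.add_tmul, map_add, braidedTensorMul_tmul, braidedTensorMul_tmul,
      N.coact_one, coact_Y]
    simp [add_assoc]

end Generators

/-! ### The defining relations hold in every Nichols algebra. -/

section Relations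

/-- A primitive element lies in degree one, and distinct homogeneous components meet in zero. -/
theorem eq_zero_of_primitive {n : ℕ} (hn : 1 ≠ n) {r : R} (hr : r ∈ N.deg n)
    (h : N.comul r = r ⊗ₜ 1 + 1 ⊗ₜ r) : r = 0 :=
  Submodule.disjoint_def.1 (N.deg_isInternal.submodule_iSupIndep.pairwiseDisjoint hn) r
    ((N.mem_deg_one_iff r).2 h) hr

/-- The cross terms `x ⊗ x` and `(d · x) ⊗ x` cancel, since `d · x = -x` and `c · x = 0`. -/
theorem X_mul_X : N.X * N.X = 0 := by
  refine N.eq_zero_of_primitive (by decide) (N.mul_mem_deg N.X_mem N.X_mem) ?_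
  simp [comul_X_mul, comul_X, act_X, act_genMatrix_one, TensorProduct.neg_tmul]

/-- The cross terms of `Δ(xy)` are `ξ x ⊗ y - ξ y ⊗ x`, those of `Δ(yx)` are `y ⊗ x - x ⊗ y`. -/
theorem X_mul_Y_add : N.X * N.Y + ξ • (N.Y * N.X) = 0 := by
  refine N.eq_zero_of_primitive (by decide) (add_mem (N.mul_mem_deg N.X_mem N.Y_mem)
    (Submodule.smul_mem _ _ (N.mul_mem_deg N.Y_mem N.X_mem))) ?_
  have h := KAlg.xi_sq hξ
  simp only [map_add, map_smul, comul_X_mul, comul_Y_mul, comul_X, comul_Y, TensorProduct.map_tmul,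
    LinearMap.mulLeft_apply, LinearMap.id_apply, act_X, act_Y, act_genMatrix_one, mul_one, X_mul_X,
    TensorProduct.add_tmul, TensorProduct.tmul_add, TensorProduct.tmul_smul,
    ← TensorProduct.smul_tmul']
  simp [TensorProduct.neg_tmul, ← TensorProduct.smul_tmul']
  match_scalars <;> grind

theorem Y_mul_X : N.Y * N.X = ξ • (N.X * N.Y) := by
  have h := KAlg.xi_sq hξ
  have e := N.X_mul_Y_add
  linear_combination (norm := skip) (-ξ) • e
  match_scalars <;> grind

theorem X_mul_X' (s : R) : N.X * (N.X * s) = 0 := by rw [← mul_assoc, X_mul_X, zero_mul]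

theorem Y_mul_X' (s : R) : N.Y * (N.X * s) = ξ • (N.X * (N.Y * s)) := by
  rw [← mul_assoc, Y_mul_X, smul_mul_assoc, mul_assoc]

theorem comul_Y_mul_Y : N.comul (N.Y * N.Y) = (N.Y * N.Y) ⊗ₜ 1 + (1 + ξ) • N.Y ⊗ₜ N.Y +
    (-(1 + ξ) / 2) • N.X ⊗ₜ N.X + 1 ⊗ₜ (N.Y * N.Y) := by
  simp [comul_Y_mul, comul_Y, act_Y, act_genMatrix_one, ← TensorProduct.smul_tmul']
  module

theorem Y_pow : N.Y * (N.Y * (N.Y * N.Y)) = 0 := by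
  refine N.eq_zero_of_primitive (by decide) (N.mul_mem_deg N.Y_mem
    (N.mul_mem_deg N.Y_mem (N.mul_mem_deg N.Y_mem N.Y_mem))) ?_
  have h := KAlg.xi_sq hξ
  have h2 := two_ne_zero_of_xi hξ
  -- One factor is peeled off at a time down to `y²`. With the quadratic relations already known,
  -- all words reduce to `x ^ i y ^ j`, and the coefficients of the cross terms vanish.
  rw [comul_Y_mul N (N.Y * (N.Y * N.Y)), comul_Y_mul N (N.Y * N.Y), comul_Y_mul_Y]
  simp only [map_add, map_smul, TensorProduct.map_tmul, LinearMap.mulLeft_apply, LinearMap.id_apply,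
    act_X, act_Y, act_genMatrix_one, act_genMatrix_mul, Fin.sum_univ_two, Matrix.of_apply,
    Matrix.cons_val_zero, Matrix.cons_val_one, Matrix.cons_val_fin_one, Matrix.one_apply_eq,
    Matrix.cons_val', ne_eq, zero_ne_one, not_false_eq_true, Matrix.one_apply_ne, mul_one, mul_zero,
    zero_mul, add_zero, zero_add, TensorProduct.zero_tmul, TensorProduct.tmul_zero, smul_zero,
    mul_add, add_mul, mul_smul_comm, smul_mul_assoc, mul_neg, neg_mul, neg_neg, smul_add, smul_neg,
    mul_assoc, X_mul_X, X_mul_X', Y_mul_X, Y_mul_X', TensorProduct.add_tmul, TensorProduct.neg_tmul,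
    TensorProduct.tmul_smul, ← TensorProduct.smul_tmul', smul_smul, map_neg]
  match_scalars <;> field_simp <;> grind

end Relations

/-! ### The comparison map is an isomorphism. -/

section Isomorphism

/-- The algebra map from the presented algebra to a Nichols algebra of `V_{2,1}`. -/
noncomputable def ofB21 : B21Alg ξ →ₐ[k] R :=
  B21Alg.lift N.X N.Y N.X_mul_X N.X_mul_Y_add
    (by rw [← N.Y_pow]; noncomm_ring)

theorem ofB21_x : N.ofB21 (B21Alg.x ξ) = N.X := B21Alg.lift_x ..

theorem ofB21_y : N.ofB21 (B21Alg.y ξ) = N.Y := B21Alg.lift_y ..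

theorem act_ofB21 (i j : Fin 2) (r : B21Alg ξ) :
    N.act (genMatrix hξ i j) (N.ofB21 r) = N.ofB21 (B21Alg.actEntry hξ i j r) := by
  induction r using B21Alg.induction generalizing i j with
  | one =>
    rw [map_one, act_genMatrix_one, B21Alg.actEntry_one, Matrix.one_apply, Matrix.one_apply]
    split_ifs <;> simp
  | smul c s hs => simp only [map_smul, hs]
  | add s t hs ht => simp only [map_add, hs, ht]
  | x_mul s hs =>
    rw [map_mul, ofB21_x, act_genMatrix_mul, B21Alg.actEntry_x_mul, map_neg, map_mul, ofB21_x]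
    fin_cases i <;> simp [act_X, hs]
  | y_mul s hs =>
    rw [map_mul, ofB21_y, act_genMatrix_mul]
    fin_cases i
    · simp [act_Y, hs, B21Alg.actEntry_zero_y_mul, ofB21_x, ofB21_y]
    · simp [act_Y, hs, B21Alg.actEntry_one_y_mul, ofB21_x, ofB21_y, sub_eq_add_neg]

/-- Both comultiplications obey the same recursion, and `act_ofB21` carries the action across the
comparison map. -/
theorem comul_ofB21 (r : B21Alg ξ) : N.comul (N.ofB21 r) =
    TensorProduct.map N.ofB21.toLinearMap N.ofB21.toLinearMap (B21Alg.comul hξ r) := by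
  induction r using B21Alg.induction with
  | one => simp [N.comul_one, B21Alg.comul_one]
  | smul c s hs => simp only [map_smul, hs]
  | add s t hs ht => simp only [map_add, hs, ht]
  | x_mul s hs =>
    rw [map_mul, ofB21_x, comul_X_mul, hs, B21Alg.comul_x_mul, B21Alg.comulMul_x]
    generalize B21Alg.comul hξ s = u
    induction u with
    | zero => simp
    | add z w hz hw =>
      simp only [map_add, smul_add] at hz hw ⊢
      linear_combination (norm := module) hz + hw
    | tmul p q => simp [act_ofB21, ofB21_x, ofB21_y, B21Alg.opX_apply, B21Alg.opY_apply]
  | y_mul s hs =>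
    rw [map_mul, ofB21_y, comul_Y_mul, hs, B21Alg.comul_y_mul, B21Alg.comulMul_y]
    generalize B21Alg.comul hξ s = u
    induction u with
    | zero => simp
    | add z w hz hw =>
      simp only [map_add, smul_add] at hz hw ⊢
      linear_combination (norm := module) hz + hw
    | tmul p q => simp [act_ofB21, ofB21_x, ofB21_y, B21Alg.opX_apply, B21Alg.opY_apply]

theorem ofB21_surjective : Function.Surjective N.ofB21 := by
  rw [← AlgHom.range_eq_top, eq_top_iff, ← N.adjoin_deg_one, Algebra.adjoin_le_iff]
  intro r hr
  rw [SetLike.mem_coe, ← N.ι_range] at hr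
  obtain ⟨v, rfl⟩ := hr
  have hv : v = v 0 • e₁ k + v 1 • e₂ k := by
    ext i
    fin_cases i <;> simp [e₁, e₂]
  refine ⟨v 0 • B21Alg.x ξ + v 1 • B21Alg.y ξ, ?_⟩
  change N.ofB21 _ = _
  rw [map_add, map_smul, map_smul, ofB21_x, ofB21_y]
  conv_rhs => rw [hv, map_add, map_smul, map_smul]
  rfl

theorem one_ne_zero (N : NicholsAlgebra (V21 hξ) R) : (1 : R) ≠ 0 := fun h => by
  have := N.counit_one
  rw [h, map_zero] at this
  exact zero_ne_one this

/-- The element has degree one and lies in the sum of the other components, so it is zero;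
injectivity of `ι` then gives the coefficients. -/
theorem eq_zero_of_smul_add_smul_mem {a b : k}
    (h : a • N.X + b • N.Y ∈ ⨆ (n : ℕ) (_ : n ≠ 1), N.deg n) : a = 0 ∧ b = 0 := by
  have h0 := Submodule.disjoint_def.1 (N.deg_isInternal.submodule_iSupIndep 1) _
    (add_mem (Submodule.smul_mem _ a N.X_mem) (Submodule.smul_mem _ b N.Y_mem)) h
  have h1 : N.ι (a • e₁ k + b • e₂ k) = 0 := by rw [map_add, map_smul, map_smul]; exact h0
  have h2 := (injective_iff_map_eq_zero _).1 N.ι_injective _ h1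
  exact ⟨by simpa [e₁, e₂] using congrFun h2 0, by simpa [e₁, e₂] using congrFun h2 1⟩

/-- The functional depends only on the coefficients of `x` and `y`. In the image these form the
component of degree one, all other monomials being homogeneous of other degrees, so they vanish when
the image does. -/
theorem coord_eq_zero (α β : k) {r : B21Alg ξ} (hr : N.ofB21 r = 0) :
    B21Alg.coord ξ α β r = 0 := by
  obtain ⟨c, rfl⟩ := B21Alg.exists_combination hξ r
  simp only [B21Alg.combination, map_add, map_smul, map_mul, map_one, ofB21_x, ofB21_y] at hr
  have hm : ∀ {n : ℕ} {s : R} (a : k), n ≠ 1 → s ∈ N.deg n →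
      a • s ∈ ⨆ (n : ℕ) (_ : n ≠ 1), N.deg n := fun a hn hs =>
    Submodule.smul_mem _ _ (Submodule.mem_iSup_of_mem _ (Submodule.mem_iSup_of_mem hn hs))
  have h2 := N.mul_mem_deg N.Y_mem N.Y_mem
  have h3 := N.mul_mem_deg N.Y_mem h2
  have key : c 4 • N.X + c 1 • N.Y ∈ ⨆ (n : ℕ) (_ : n ≠ 1), N.deg n := by
    have e : c 4 • N.X + c 1 • N.Y = (-c 0) • (1 : R) + (-c 2) • (N.Y * N.Y) +
        (-c 3) • (N.Y * (N.Y * N.Y)) + (-c 5) • (N.X * N.Y) + (-c 6) • (N.X * (N.Y * N.Y)) +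
        (-c 7) • (N.X * (N.Y * (N.Y * N.Y))) := by
      linear_combination (norm := module) hr
    rw [e]
    refine add_mem (add_mem (add_mem (add_mem (add_mem
      (hm _ zero_ne_one N.deg_gradedMonoid.one_mem) (hm _ ?_ h2)) (hm _ ?_ h3))
      (hm _ ?_ (N.mul_mem_deg N.X_mem N.Y_mem))) (hm _ ?_ (N.mul_mem_deg N.X_mem h2)))
      (hm _ ?_ (N.mul_mem_deg N.X_mem h3)) <;> decide
  obtain ⟨h4, h1⟩ := N.eq_zero_of_smul_add_smul_mem key
  have hx : B21Alg.coord ξ α β (B21Alg.x ξ) = α := by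
    simpa using B21Alg.coord_x_mul α β (1 : B21Alg ξ)
  simp [B21Alg.combination, h4, h1, B21Alg.coord_one, B21Alg.coord_x_mul, B21Alg.coord_y_mul,
    B21Alg.counit_y]

/-- The functional vanishes on the kernel, hence factors as `g` after the comparison map. The image
of the derivative of `r` is then obtained from the comultiplication of the image of `r`, which is
zero, by applying `g` to the second leg. -/
theorem ofB21_deriv_eq_zero (α β : k) {r : B21Alg ξ} (hr : N.ofB21 r = 0) :
    N.ofB21 (B21Alg.deriv hξ α β r) = 0 := by
  -- Over a field, the functionals that factor through a linear map are those that vanish on its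
  -- kernel.
  have hf : B21Alg.coord ξ α β ∈ LinearMap.range N.ofB21.toLinearMap.dualMap := by
    rw [LinearMap.range_dualMap_eq_dualAnnihilator_ker, Submodule.mem_dualAnnihilator]
    exact fun s hs => N.coord_eq_zero α β hs
  obtain ⟨g, hg⟩ := hf
  have key : ∀ u, N.ofB21 (TensorProduct.rid k _ ((B21Alg.coord ξ α β).lTensor _ u)) =
      TensorProduct.rid k _ (g.lTensor _
        (TensorProduct.map N.ofB21.toLinearMap N.ofB21.toLinearMap u)) := by
    intro u
    induction u with
    | zero => simp
    | add z w hz hw => simp only [map_add, hz, hw]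
    | tmul p q => simp [← hg]
  rw [B21Alg.deriv_apply, key, ← comul_ofB21, hr]
  simp

/-- The kernel is stable under both derivations and does not contain `1`, so nondegeneracy applies.
-/
theorem ofB21_injective : Function.Injective N.ofB21 := by
  have h := B21Alg.eq_bot_of_deriv_mem hξ (LinearMap.ker N.ofB21.toLinearMap)
    (fun r hr => N.ofB21_deriv_eq_zero 1 0 hr) (fun r hr => N.ofB21_deriv_eq_zero 0 1 hr)
    (fun h1 => N.one_ne_zero ((map_one N.ofB21).symm.trans h1))
  exact LinearMap.ker_eq_bot.1 h

/-- The isomorphism from the presented algebra to a Nichols algebra of `V_{2,1}`. -/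
noncomputable def equivB21 : B21Alg ξ ≃ₐ[k] R :=
  AlgEquiv.ofBijective N.ofB21 ⟨N.ofB21_injective, N.ofB21_surjective⟩

theorem finrank_eq_eight (N : NicholsAlgebra (V21 hξ) R) : Module.finrank k R = 8 := by
  rw [← N.equivB21.toLinearEquiv.finrank_eq, B21Alg.finrank_eq_eight hξ]

end Isomorphism

end NicholsAlgebra

theorem mainTheorem7 {k : Type u} [Field k] [IsAlgClosed k] [CharZero k] {ξ : k}
    (hξ : IsPrimitiveRoot ξ 4) :
    -- the presented algebra is a Nichols algebra of `V_{2,1}`, with `x = e₁` and `y = e₂`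
    (∃ N : NicholsAlgebra (V21 hξ) (B21 ξ), N.ι (e₁ k) = B21.x ξ ∧ N.ι (e₂ k) = B21.y ξ) ∧
    -- every Nichols algebra of `V_{2,1}` has this presentation, and has dimension `8`
    (∀ (R : Type w) [Ring R] [Algebra k R] (N : NicholsAlgebra (V21 hξ) R),
      (∃ φ : B21 ξ ≃ₐ[k] R, φ (B21.x ξ) = N.ι (e₁ k) ∧ φ (B21.y ξ) = N.ι (e₂ k)) ∧
      Module.finrank k R = 8) :=
  ⟨exists_nicholsAlgebra_b21 hξ, fun _ _ _ N =>
    ⟨⟨N.equivB21, N.ofB21_x, N.ofB21_y⟩, N.finrank_eq_eight⟩⟩
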